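/- Let $1<p<\infty$, $1/p+1/q=1$, $k\in\mathbf R$, and let $A_k(x)=\begin{bmatrix}1&k\,\mathrm{sgn}(x)\\-k\,\mathrm{sgn}(x)&1\end{bmatrix}$, where points of the upper half plane are written $(t,x)$, $t>0$, $x\in\mathbf R$, and $\nabla U=[\partial_tU,\partial_xU]^t$. Let $T_k=\begin{bmatrix}k(\mathrm{sgn}(x)\partial_x-\partial_x\mathrm{sgn}(x))&\partial_x\\-\partial_x&0\end{bmatrix}$ be the self-adjoint operator in $L_2(\mathbf R;\mathbf C^2)$ with domain $\{f: f_0\in H^1(\mathbf R),\ f_1-k\,\mathrm{sgn}(x)f_0\in H^1(\mathbf R)\}$. For $t>0$ the operator $e^{-t|T_k|}\chi_+(T_k)$, defined by the functional calculus of $T_k$ with $\chi_+$ the characteristic function of $(0,\infty)$, extends from $L_2\cap L_p$ to a bounded operator $h\mapsto (C_k^+h)(t,\cdot)$ on $L_p(\mathbf R;\mathbf C^2)$. The operator $$Kf(x)=\mathrm{sgn}(x)\,\frac1\pi\,\mathrm{p.v.}\!\int_{\mathbf R}\frac{f(y)}{x-y}\,dy-\frac1\pi\int_{\mathbf R}\frac{f(y)}{|x|+|y|}\,dy$$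 is defined for almost every $x$ and is bounded on $L_p(\mathbf R;\mathbf C)$ and on $L_q(\mathbf R;\mathbf C)$. Write $(I+kK)^*$ for the adjoint on $L_p$ of $I+kK$ acting on $L_q$. A function $U$ is called a solution below if $U\in W^{1,2}_{loc}$ in the upper half plane and $\mathrm{div}A_k\nabla U=0$ there in the weak sense. The following hold. * (Neumann) Let $\phi,\psi\in L_p(\mathbf R;\mathbf C)$ and $F=C_k^+[\psi,\,0]^t$. Then $\phi=\tfrac12(I+kK)\psi$ if and only if $F$ solves the Neumann problem with datum $\phi$, that is: $F=\nabla U$ for a solution $U$, $\sup_{t>0}\|F(t,\cdot)\|_p<\infty$, and $F(t,\cdot)$ converges in $L_p$, as $t\to0^+$, to some $f$ with $f_0+k\,\mathrm{sgn}(x)f_1=\phi$. * (Regularity) Let $u$ be a locally integrable function on $\mathbf R$ with weak derivative $u'\in L_p(\mathbf R;\mathbf C)$, let $\psi\in L_p(\mathbf R;\mathbf C)$ and $F=C_k^+[-k\,\mathrm{sgn}(x)\psi,\ \psi]^t$. Then $\mathrm{sgn}(x)u'=\tfrac12(I-kK)(\mathrm{sgn}\cdot\psi)$ if and only if $F$ solves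 the regularity problem with datum $u$, that is: $F=\nabla U$ for a solution $U$, $\sup_{t>0}\|F(t,\cdot)\|_p<\infty$, and $F(t,\cdot)$ converges in $L_p$, as $t\to0^+$, to some $f$ with $f_1=u'$. * (Dirichlet) Let $u,\psi\in L_p(\mathbf R;\mathbf C)$ and let $U=e_0\cdot C_k^+[\psi,\ k\,\mathrm{sgn}(x)\psi]^t$ be the first component of the Cauchy extension. Then $u=\tfrac12(I+kK)^*\psi$ if and only if $U$ solves the Dirichlet problem with datum $u$, that is: $U$ is a solution, $\sup_{t>0}\|U(t,\cdot)\|_p<\infty$, and $\|U(t,\cdot)-u\|_p\to0$ as $t\to0^+$. -/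

import Mathlib

open MeasureTheory Filter Topology
open scoped ENNReal ContDiff Matrix

noncomputable section

namespace JumpBVP

/-- `ℂ²` with its Euclidean norm. The coordinates are ordered as `(e₀, e₁)`, that is, the
vertical (`t`) component comes first and the horizontal (`x`) component second. -/
abbrev C2 : Type := EuclideanSpace ℂ (Fin 2)

/-- `sgn(x)`, as a complex number. -/
def sgn (x : ℝ) : ℂ := ((Real.sign x : ℝ) : ℂ)

/-! ### The coefficients and weak solutions of the divergence form equation -/

/-- The coefficient matrix `A_k(x) = [1, k sgn x; -k sgn x, 1]`. -/
def coeff (k : ℝ) (x : ℝ) : Matrix (Fin 2) (Fin 2) ℂ :=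
  !![1, (k : ℂ) * sgn x; -((k : ℂ) * sgn x), 1]

/-- The open upper half plane, with coordinates `(t, x)`. -/
def upperHalf : Set (ℝ × ℝ) := {z | 0 < z.1}

/-- Partial derivatives of a real function of `(t, x)`: index `0` is `∂_t`, index `1` is `∂_x`. -/
def partialD (i : Fin 2) (η : ℝ × ℝ → ℝ) (z : ℝ × ℝ) : ℝ :=
  fderiv ℝ η z (if i = 0 then (1, 0) else (0, 1))

/-- Smooth real test functions with compact support in the open upper half plane. -/
def IsTest (η : ℝ × ℝ → ℝ) : Prop :=
  ContDiff ℝ ∞ η ∧ HasCompactSupport η ∧ tsupport η ⊆ upperHalf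

/-- `U ∈ W^{1,2}_loc` on the upper half plane has the weak gradient `G = (∂_t U, ∂_x U)`, and is a
weak solution of `div A(x) ∇U = 0` there. -/
structure IsWeakSolution (A : ℝ → Matrix (Fin 2) (Fin 2) ℂ) (U : ℝ × ℝ → ℂ) (G : ℝ × ℝ → C2) :
    Prop where
  memLp_potential : ∀ S : Set (ℝ × ℝ), IsCompact S → S ⊆ upperHalf →
    MemLp U 2 (volume.restrict S)
  memLp_gradient : ∀ S : Set (ℝ × ℝ), IsCompact S → S ⊆ upperHalf →
    MemLp G 2 (volume.restrict S)
  gradient : ∀ η : ℝ × ℝ → ℝ, IsTest η → ∀ i : Fin 2,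
    ∫ z, U z * ((partialD i η z : ℝ) : ℂ) = - ∫ z, G z i * (η z : ℂ)
  equation : ∀ η : ℝ × ℝ → ℝ, IsTest η →
    ∫ z, ∑ i : Fin 2, (A z.2 *ᵥ (G z).ofLp) i * (partialD i η z : ℂ) = 0

/-- `g` is the weak derivative of `f` on the real line (both assumed locally integrable). -/
def IsWeakDeriv (f g : ℝ → ℂ) : Prop :=
  ∀ η : ℝ → ℝ, ContDiff ℝ ∞ η → HasCompactSupport η →
    ∫ x, f x * ((deriv η x : ℝ) : ℂ) = - ∫ x, g x * (η x : ℂ)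

/-! ### The operator `T_k` on `L₂(ℝ; ℂ²)`, its functional calculus, and the Cauchy extension -/

/-- The graph of the self-adjoint operator
`T_k = [k (sgn(x) ∂ - ∂ sgn(x)), ∂; -∂, 0]` in `L₂(ℝ; ℂ²)`, with domain
`{f | f₀ ∈ H¹(ℝ), f₁ - k sgn(x) f₀ ∈ H¹(ℝ)}`. Here `a = f₀'` and `b = (f₁ - k sgn(x) f₀)'`, and
the value is `T_k f = (k sgn(x) f₀' + (f₁ - k sgn(x) f₀)', -f₀')`. -/
def graphT (k : ℝ) (f g : Lp C2 2 (volume : Measure ℝ)) : Prop :=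
  ∃ a b : ℝ → ℂ, MemLp a 2 volume ∧ MemLp b 2 volume ∧
    IsWeakDeriv (fun x => f x 0) a ∧
    IsWeakDeriv (fun x => f x 1 - (k : ℂ) * sgn x * f x 0) b ∧
    ∀ᵐ x : ℝ, g x 0 = (k : ℂ) * sgn x * a x + b x ∧ g x 1 = - a x

/-- `S = b(T)` in the sense of the spectral theorem, where `T` is a self-adjoint operator in the
Hilbert space `H`, given by its graph, and `b` is a Borel function on `ℝ`: there is a unitary map
`V` of `H` onto an `L₂` space under which `T` (with its domain) becomes the maximal operator of
multiplication by a real measurable function `m`, and `S` becomes multiplication by `b ∘ m`.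
By the spectral theorem, such a `V` exists for every self-adjoint `T`, and `S` depends only on
`T` and `b`. -/
def IsFunctionOf {H : Type} [NormedAddCommGroup H] [InnerProductSpace ℂ H]
    (T : H → H → Prop) (b : ℝ → ℝ) (S : H →L[ℂ] H) : Prop :=
  ∃ (X : Type) (_ : MeasurableSpace X) (μ : Measure X) (m : X → ℝ)
    (V : H ≃ₗᵢ[ℂ] Lp ℂ 2 μ), Measurable m ∧
    (∀ f g : H, T f g ↔ ∀ᵐ x ∂μ, V g x = (m x : ℂ) * V f x) ∧
    ∀ f : H, ∀ᵐ x ∂μ, V (S f) x = (b (m x) : ℂ) * V f x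

/-- The symbol `e^{-t|λ|} χ₊(λ)`, where `χ₊` is the characteristic function of `λ > 0`. -/
def hardySymbol (t : ℝ) (l : ℝ) : ℝ := if 0 < l then Real.exp (-(t * |l|)) else 0

/-- `C` is the Cauchy extension operator `h ↦ C_k⁺ h (t, ·)` on `L_p(ℝ; ℂ²)`: the bounded operator
which agrees on `L_p ∩ L₂` with `e^{-t|T_k|} χ₊(T_k)`. -/
def IsCauchyExtension (k : ℝ) (p : ℝ≥0∞) [Fact (1 ≤ p)] (t : ℝ)
    (C : Lp C2 p (volume : Measure ℝ) →L[ℂ] Lp C2 p (volume : Measure ℝ)) : Prop :=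
  ∃ S : Lp C2 2 (volume : Measure ℝ) →L[ℂ] Lp C2 2 (volume : Measure ℝ),
    IsFunctionOf (graphT k) (hardySymbol t) S ∧
    ∀ (h : Lp C2 p (volume : Measure ℝ)) (h₂ : Lp C2 2 (volume : Measure ℝ)),
      h =ᵐ[volume] h₂ → C h =ᵐ[volume] S h₂

/-! ### The double layer potential type operator `K` -/

/-- The principal value integral `p.v.∫ f(y) / (x - y) dy` exists and equals `L`. -/
def HasPV (f : ℝ → ℂ) (x : ℝ) (L : ℂ) : Prop :=
  Tendsto (fun ε : ℝ => ∫ y in {y : ℝ | ε < |x - y|}, f y / ((x - y : ℝ) : ℂ)) (𝓝[>] 0) (𝓝 L)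

/-- `K` is the operator
`K f(x) = sgn(x) (1/π) p.v.∫ f(y)/(x-y) dy - (1/π) ∫ f(y)/(|x|+|y|) dy` on `L_p(ℝ; ℂ)`, where
the principal value exists for almost every `x`. -/
def IsDoubleLayer (p : ℝ≥0∞) [Fact (1 ≤ p)]
    (K : Lp ℂ p (volume : Measure ℝ) →L[ℂ] Lp ℂ p (volume : Measure ℝ)) : Prop :=
  ∀ f : Lp ℂ p (volume : Measure ℝ), ∀ᵐ x : ℝ, ∃ L : ℂ, HasPV f x L ∧
    Integrable (fun y : ℝ => f y / ((|x| + |y| : ℝ) : ℂ)) ∧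
    K f x = sgn x * ((1 / Real.pi : ℝ) : ℂ) * L
      - ((1 / Real.pi : ℝ) : ℂ) * ∫ y : ℝ, f y / ((|x| + |y| : ℝ) : ℂ)

/-- `N = M^*`: the operator `N` on `L_p` is the adjoint of the operator `M` on the dual space
`L_q`, with respect to the pairing `⟨g, f⟩ = ∫ conj(g) f`. -/
def IsAdjoint (p q : ℝ≥0∞) [Fact (1 ≤ p)] [Fact (1 ≤ q)]
    (M : Lp ℂ q (volume : Measure ℝ) →L[ℂ] Lp ℂ q (volume : Measure ℝ))
    (N : Lp ℂ p (volume : Measure ℝ) →L[ℂ] Lp ℂ p (volume : Measure ℝ)) : Prop :=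
  ∀ (g : Lp ℂ q (volume : Measure ℝ)) (f : Lp ℂ p (volume : Measure ℝ)),
    ∫ x, (starRingEnd ℂ) (M g x) * f x = ∫ x, (starRingEnd ℂ) (g x) * N f x

/-! ### The ansatzes -/

theorem measurable_sgn : Measurable sgn := by
  unfold sgn Real.sign
  refine Complex.measurable_ofReal.comp ?_
  exact Measurable.ite measurableSet_Iio measurable_const
    (Measurable.ite measurableSet_Ioi measurable_const measurable_const)

theorem norm_sgn_le (x : ℝ) : ‖sgn x‖ ≤ 1 := by
  unfold sgn
  rcases Real.sign_apply_eq x with h | h | h <;> simp [h]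

theorem memLp_mul_sgn (c : ℂ) {p : ℝ≥0∞} (ψ : Lp ℂ p (volume : Measure ℝ)) :
    MemLp (fun x => c * sgn x * ψ x) p volume := by
  refine (Lp.memLp ψ).of_le_mul (c := ‖c‖) ?_ (ae_of_all _ fun x => ?_)
  · exact ((measurable_const.mul measurable_sgn).aestronglyMeasurable).mul
      (Lp.memLp ψ).aestronglyMeasurable
  · rw [norm_mul, norm_mul]
    have := norm_sgn_le x
    gcongr
    nlinarith [norm_nonneg c]

theorem memLp_pair {p : ℝ≥0∞} {a b : ℝ → ℂ} (ha : MemLp a p volume) (hb : MemLp b p volume) :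
    MemLp (fun x => (!₂[a x, b x] : C2)) p volume := by
  rw [memLp_piLp_iff]
  intro i
  fin_cases i
  · simpa using ha
  · simpa using hb

/-- `sgn · ψ`. -/
def sgnMul {p : ℝ≥0∞} (ψ : Lp ℂ p (volume : Measure ℝ)) : Lp ℂ p (volume : Measure ℝ) :=
  (memLp_mul_sgn 1 ψ).toLp _

/-- The field `[ψ, 0]`. -/
def neumannAnsatz {p : ℝ≥0∞} (ψ : Lp ℂ p (volume : Measure ℝ)) : Lp C2 p (volume : Measure ℝ) :=
  (memLp_pair (Lp.memLp ψ) MemLp.zero).toLp (fun x => !₂[ψ x, 0])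

/-- The field `[-k sgn(x) ψ, ψ]`. -/
def regularityAnsatz (k : ℝ) {p : ℝ≥0∞} (ψ : Lp ℂ p (volume : Measure ℝ)) :
    Lp C2 p (volume : Measure ℝ) :=
  (memLp_pair (memLp_mul_sgn (-(k : ℂ)) ψ) (Lp.memLp ψ)).toLp
    (fun x => !₂[-(k : ℂ) * sgn x * ψ x, ψ x])

/-- The field `[ψ, k sgn(x) ψ]`. -/
def dirichletAnsatz (k : ℝ) {p : ℝ≥0∞} (ψ : Lp ℂ p (volume : Measure ℝ)) :
    Lp C2 p (volume : Measure ℝ) :=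
  (memLp_pair (Lp.memLp ψ) (memLp_mul_sgn (k : ℂ) ψ)).toLp
    (fun x => !₂[ψ x, (k : ℂ) * sgn x * ψ x])

/-- The normal component `e₀ · h` of a field `h`. -/
def normalPart {p : ℝ≥0∞} (h : Lp C2 p (volume : Measure ℝ)) : Lp ℂ p (volume : Measure ℝ) :=
  (EuclideanSpace.proj (0 : Fin 2) : C2 →L[ℂ] ℂ).compLp h

/-! ### Solutions of the boundary value problems in the `L_∞(L_p)` sense

A function on the upper half plane is given by its slices at the heights `t > 0`, which are
elements of `L_p(ℝ)`. -/

/-- The slices `F t` (`t > 0`) form a gradient field `F = ∇U` with `div A_k ∇U = 0` in the upper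
half plane, `sup_{t>0} ‖F_t‖_p < ∞`, and `F_t → f` in `L_p` as `t → 0⁺`. -/
def IsGradientSolution (k : ℝ) (p : ℝ≥0∞) [Fact (1 ≤ p)]
    (F : ℝ → Lp C2 p (volume : Measure ℝ)) (f : Lp C2 p (volume : Measure ℝ)) : Prop :=
  (∃ (U : ℝ × ℝ → ℂ) (G : ℝ × ℝ → C2), IsWeakSolution (coeff k) U G ∧
    ∀ t : ℝ, 0 < t → F t =ᵐ[volume] fun x => G (t, x)) ∧
  (∃ M : ℝ, ∀ t : ℝ, 0 < t → ‖F t‖ ≤ M) ∧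
  Tendsto F (𝓝[>] 0) (𝓝 f)

/-- `F = ∇U` solves the Neumann problem with datum `φ`: the conormal derivative `e₀ · A_k f` of
the trace `f` of `F` is `φ`. -/
def SolvesNeumann (k : ℝ) (p : ℝ≥0∞) [Fact (1 ≤ p)] (φ : Lp ℂ p (volume : Measure ℝ))
    (F : ℝ → Lp C2 p (volume : Measure ℝ)) : Prop :=
  ∃ f : Lp C2 p (volume : Measure ℝ), IsGradientSolution k p F f ∧
    ∀ᵐ x : ℝ, (coeff k x *ᵥ (f x).ofLp) 0 = φ x

/-- `F = ∇U` solves the regularity problem with datum `u' = du`: the tangential component of the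
trace `f` of `F` is `u'`. -/
def SolvesRegularity (k : ℝ) (p : ℝ≥0∞) [Fact (1 ≤ p)] (du : Lp ℂ p (volume : Measure ℝ))
    (F : ℝ → Lp C2 p (volume : Measure ℝ)) : Prop :=
  ∃ f : Lp C2 p (volume : Measure ℝ), IsGradientSolution k p F f ∧ ∀ᵐ x : ℝ, f x 1 = du x

/-- The function `U` with slices `W t` (`t > 0`) solves the Dirichlet problem with datum `u`:
`div A_k ∇U = 0` in the upper half plane, `sup_{t>0} ‖U_t‖_p < ∞`, and `U_t → u` in `L_p` as
`t → 0⁺`. -/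
def SolvesDirichlet (k : ℝ) (p : ℝ≥0∞) [Fact (1 ≤ p)] (u : Lp ℂ p (volume : Measure ℝ))
    (W : ℝ → Lp ℂ p (volume : Measure ℝ)) : Prop :=
  (∃ (U : ℝ × ℝ → ℂ) (G : ℝ × ℝ → C2), IsWeakSolution (coeff k) U G ∧
    ∀ t : ℝ, 0 < t → W t =ᵐ[volume] fun x => U (t, x)) ∧
  (∃ M : ℝ, ∀ t : ℝ, 0 < t → ‖W t‖ ≤ M) ∧
  Tendsto W (𝓝[>] 0) (𝓝 u)

end JumpBVP

end

noncomputable section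

namespace JumpBVP

/-! ### Conjugate exponents and decay of order `1 / |x|` -/

/-! The operator T_k is diagonalized explicitly, by a transformation that makes sense on every L_p.
Let R be the reflection x ↦ -x, E and O the projections onto even and odd functions, and D = -i
d/dx. Multiplication by sgn exchanges parities, and it commutes with differentiation on odd
functions, whose Sobolev representatives vanish at 0 (`IsWeakDeriv.sgn_mul`). So the jump is
invisible to the pair (O f₀, E f₁), and on the pair (E f₀, O f₁) it is removed by the factor 1 - ik
sgn. Precisely, f lies in the domain if and only if both u = (1 - ik sgn)(E f₀ + i O f₁) and v = O
f₀ + i E f₁ lie in H¹, and T_k acts on each of them as D (`graphT_iff`). As |1 - ik sgn|² = 1 + k²,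
dividing u by √(1 + k²) makes f ↦ (u, v) unitary (`norm_sq_fwd`). After a Fourier transform T_k is
multiplication by 2πξ on two copies of the line, and the Hardy semigroup acts on u and v as the
multiplier e^{-2πtξ} on ξ > 0, which is the classical Cauchy integral at height t
(`isFunctionOf_extend`).

The analysis is thereby reduced to the scalar Cauchy integral C_t on L_p. Its uniform boundedness is
M. Riesz' theorem (`exists_eLpNorm_cauchyInt_le`), obtained from a pointwise inequality for w^r and
Cauchy's theorem when p ≤ 2, and by duality when p ≥ 2. The relation C_t P_s = C_{t+s} with the
Poisson semigroup gives strong convergence at the boundary on the dense range of the P_s, hence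
everywhere (`exists_tendsto_cauchyOperator`). The limit is (I + iH)/2, and comparison of truncated
and conjugate Poisson kernels at Lebesgue points identifies H as the principal value operator
(`exists_hilbertTransform`).

The extended field is a gradient because it is built from two holomorphic functions A and B of x +
it. With primitives Φ and Ψ, their even and odd parts in x combine to a potential U and to a stream
function for the flux A_k∇U, and the factors sgn fall only on odd parts, which vanish on the axis
(`isWeakSolution_of_hasDerivAt`). The same combination with iA and iB in place of Φ and Ψ shows that
the first component of the field is itself a solution.

What remains is algebra on the boundary. The identity (sgn x - sgn y)/(x - y) = (1 - sgn x sgn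
y)/(|x| + |y|) gives K = H sgn E + sgn H O (`isDoubleLayer_doubleLayer`), and H* = -H gives K*
(`IsAdjoint.hilbert`). With R² = sgn² = I, R sgn = -sgn R and RH = -HR, the traces of the three
ansatzes become ½(I + kK)ψ, ½(I - kK)(sgn ψ) up to the factor sgn, and ½(I + kK)*ψ. Every Cauchy
extension solves the equation with bounded slices and converges in L_p, and limits are unique, so
each boundary value problem amounts to the equation for the trace. -/

theorem exists_holderConjugate {p : ℝ≥0∞} (hp : 1 < p) (hp' : p ≠ ⊤) :
    ∃ q : ℝ≥0∞, ENNReal.HolderConjugate p q ∧ 1 < q ∧ q ≠ ⊤ := by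
  have h1 : 1 < p.toReal := by
    rw [← ENNReal.toReal_one]
    exact (ENNReal.toReal_lt_toReal ENNReal.one_ne_top hp').2 hp
  have h := Real.HolderConjugate.conjExponent h1
  refine ⟨ENNReal.ofReal (Real.conjExponent p.toReal), ?_, ?_, ENNReal.ofReal_ne_top⟩
  · rw [ENNReal.holderConjugate_iff]
    have h2 := h.inv_add_inv_ennreal
    rwa [ENNReal.ofReal_toReal hp'] at h2
  · rw [← ENNReal.ofReal_one]
    exact (ENNReal.ofReal_lt_ofReal_iff h.symm.pos).2 h.symm.lt

theorem one_lt_toReal {p : ℝ≥0∞} (hp : 1 < p) (hp' : p ≠ ⊤) : 1 < p.toReal := by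
  rw [← ENNReal.toReal_one]
  exact (ENNReal.toReal_lt_toReal ENNReal.one_ne_top hp').2 hp

/-- The function 1/(1 + |x|) is p-integrable precisely because p > 1. Kernels at a fixed positive
height decay at this rate, so Hölder pairs them with every L_p function. -/
theorem memLp_of_decay {E : Type*} [NormedAddCommGroup E] {f : ℝ → E}
    (hf : AEStronglyMeasurable f volume) {B : ℝ} (h : ∀ x, ‖f x‖ ≤ B * (1 + |x|)⁻¹)
    {p : ℝ≥0∞} (hp : 1 < p) (hp' : p ≠ ⊤) : MemLp f p volume := by
  have h1 := one_lt_toReal hp hp'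
  have hm : Measurable fun x : ℝ => (1 + |x|)⁻¹ := by fun_prop
  have key : MemLp (fun x : ℝ => (1 + |x|)⁻¹) p volume := by
    rw [← integrable_norm_rpow_iff hm.aestronglyMeasurable (by positivity) hp']
    have := integrable_one_add_norm (E := ℝ) (μ := volume) (r := p.toReal) (by simpa using h1)
    refine this.congr (ae_of_all _ fun x => ?_)
    have h0 : 0 ≤ 1 + |x| := by positivity
    simp only [Real.norm_eq_abs]
    rw [abs_of_nonneg (inv_nonneg.2 h0), Real.inv_rpow h0, Real.rpow_neg h0]
  refine key.of_le_mul (c := B) hf (ae_of_all _ fun x => (h x).trans_eq ?_)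
  rw [Real.norm_of_nonneg (by positivity)]

theorem integrable_mul_of_decay {k f : ℝ → ℂ} (hk : AEStronglyMeasurable k volume) {B : ℝ}
    (h : ∀ x, ‖k x‖ ≤ B * (1 + |x|)⁻¹) {p : ℝ≥0∞} (hp : 1 < p) (hp' : p ≠ ⊤)
    (hf : MemLp f p volume) : Integrable (fun y => k y * f y) volume := by
  obtain ⟨q, hq, hq1, hq2⟩ := exists_holderConjugate hp hp'
  have := hq.symm
  exact (memLp_of_decay hk h hq1 hq2).integrable_mul hf

/-! ### The Cauchy kernel and the Cauchy integral -/

/-- The Cauchy kernel `i / (2π w)`. -/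
def cauchyKer (w : ℂ) : ℂ := Complex.I / (2 * Real.pi * w)

/-- The Cauchy integral of `f` at a point `z` of the upper half plane. -/
def cauchyInt (f : ℝ → ℂ) (z : ℂ) : ℂ := ∫ y : ℝ, cauchyKer (z - y) * f y

/-- The point `x + i t`. -/
def pt (t x : ℝ) : ℂ := x + t * Complex.I

@[simp] theorem pt_re (t x : ℝ) : (pt t x).re = x := by simp [pt]

@[simp] theorem pt_im (t x : ℝ) : (pt t x).im = t := by simp [pt]

theorem pt_sub (t x y : ℝ) : pt t x - y = pt t (x - y) := by simp [pt]; ring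

theorem continuous_pt_prod : Continuous fun z : ℝ × ℝ => pt z.1 z.2 := by
  unfold pt; fun_prop

theorem continuous_pt (t : ℝ) : Continuous (pt t) := by
  unfold pt; fun_prop

theorem measurable_cauchyKer : Measurable cauchyKer := by
  unfold cauchyKer; fun_prop

theorem norm_cauchyKer (w : ℂ) : ‖cauchyKer w‖ = (2 * Real.pi)⁻¹ * ‖w‖⁻¹ := by
  unfold cauchyKer
  rw [norm_div, Complex.norm_I, norm_mul, norm_mul, Complex.norm_real,
    Real.norm_of_nonneg Real.pi_pos.le, one_div, mul_inv]
  simp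

theorem two_pi_inv_le_one : (2 * Real.pi)⁻¹ ≤ 1 := by
  apply inv_le_one_of_one_le₀
  nlinarith [Real.pi_gt_three]

/-- One has 1 + |y| ≤ (1 + M) + |z - y|, and 1 + M is absorbed because |z - y| ≥ δ. The constant
depends only on δ and M, so the bound also serves as a majorant locally uniform in z. -/
theorem norm_inv_sub_le {z : ℂ} {δ M : ℝ} (hδ : 0 < δ) (hz : δ ≤ z.im) (hM : ‖z‖ ≤ M) (y : ℝ) :
    ‖z - y‖⁻¹ ≤ ((1 + M) / δ + 1) * (1 + |y|)⁻¹ := by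
  have h1 : δ ≤ ‖z - y‖ := by
    have := Complex.abs_im_le_norm (z - y)
    simp only [Complex.sub_im, Complex.ofReal_im, sub_zero] at this
    exact hz.trans ((le_abs_self _).trans this)
  have h2 : |y| ≤ ‖z‖ + ‖z - y‖ := by
    have : (y : ℂ) = z - (z - y) := by ring
    calc |y| = ‖(y : ℂ)‖ := by simp
      _ = ‖z - (z - y)‖ := by rw [← this]
      _ ≤ _ := norm_sub_le _ _
  have h3 : 0 ≤ M := (norm_nonneg _).trans hM
  have h4 : 1 + M ≤ (1 + M) / δ * ‖z - y‖ := by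
    rw [div_mul_eq_mul_div, le_div_iff₀ hδ]
    nlinarith
  rw [← div_eq_mul_inv, le_div_iff₀ (by positivity), inv_mul_le_iff₀ (by linarith)]
  nlinarith

theorem norm_cauchyKer_sub_le {z : ℂ} {δ M : ℝ} (hδ : 0 < δ) (hz : δ ≤ z.im) (hM : ‖z‖ ≤ M)
    (y : ℝ) : ‖cauchyKer (z - y)‖ ≤ ((1 + M) / δ + 1) * (1 + |y|)⁻¹ := by
  rw [norm_cauchyKer]
  refine le_trans ?_ (norm_inv_sub_le hδ hz hM y)
  exact mul_le_of_le_one_left (by positivity) two_pi_inv_le_one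

theorem measurable_cauchyKer_sub (z : ℂ) : Measurable fun y : ℝ => cauchyKer (z - y) :=
  measurable_cauchyKer.comp (by fun_prop)

theorem integrable_cauchyKer_mul {p : ℝ≥0∞} (hp : 1 < p) (hp' : p ≠ ⊤) {f : ℝ → ℂ}
    (hf : MemLp f p volume) {z : ℂ} (hz : 0 < z.im) :
    Integrable (fun y : ℝ => cauchyKer (z - y) * f y) volume :=
  integrable_mul_of_decay (measurable_cauchyKer_sub z).aestronglyMeasurable
    (norm_cauchyKer_sub_le hz le_rfl le_rfl) hp hp' hf

theorem memLp_cauchyKer {t : ℝ} (ht : 0 < t) {p : ℝ≥0∞} (hp : 1 < p) (hp' : p ≠ ⊤) (x : ℝ) :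
    MemLp (fun y : ℝ => cauchyKer (pt t x - y)) p volume :=
  memLp_of_decay (measurable_cauchyKer_sub _).aestronglyMeasurable
    (norm_cauchyKer_sub_le (δ := t) ht (by simp) le_rfl) hp hp'

theorem hasDerivAt_cauchyInt {p : ℝ≥0∞} (hp : 1 < p) (hp' : p ≠ ⊤) {f : ℝ → ℂ}
    (hf : MemLp f p volume) {z : ℂ} (hz : 0 < z.im) :
    HasDerivAt (cauchyInt f)
      (∫ y : ℝ, (-Complex.I / (2 * Real.pi) * (z - y)⁻¹ * (z - y)⁻¹) * f y) z := by
  -- Half the height: the ball of this radius about z stays above height δ, where the kernel bound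
  -- is uniform.
  set δ := z.im / 2 with hδ
  have hδ0 : 0 < δ := by positivity
  have hball : ∀ w ∈ Metric.ball z δ, δ ≤ w.im ∧ ‖w‖ ≤ ‖z‖ + δ := by
    intro w hw
    rw [mem_ball_iff_norm] at hw
    have h1 := Complex.abs_im_le_norm (w - z)
    rw [Complex.sub_im, abs_le] at h1
    constructor
    · linarith [h1.1]
    · calc ‖w‖ = ‖z + (w - z)‖ := by ring_nf
        _ ≤ ‖z‖ + ‖w - z‖ := norm_add_le _ _
        _ ≤ _ := by linarith
  set B := (1 + (‖z‖ + δ)) / δ + 1 with hB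
  -- Of the two factors (w - y)⁻¹ in the derivative, one is bounded by δ⁻¹ and the other supplies
  -- the decay in y.
  have hbd : Integrable (fun y : ℝ => δ⁻¹ * (B * (1 + |y|)⁻¹) * ‖f y‖) volume := by
    have := (integrable_mul_of_decay (k := fun y : ℝ => ((δ⁻¹ * (B * (1 + |y|)⁻¹) : ℝ) : ℂ))
      (B := δ⁻¹ * B) (by fun_prop) (fun y => ?_) hp hp' hf).norm
    · refine this.congr (ae_of_all _ fun y => ?_)
      simp only
      rw [norm_mul, Complex.norm_real, Real.norm_of_nonneg (by positivity)]
    · rw [Complex.norm_real, Real.norm_of_nonneg (by positivity), mul_assoc]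
  refine (hasDerivAt_integral_of_dominated_loc_of_deriv_le
    (F := fun w y => cauchyKer (w - y) * f y)
    (F' := fun w y => (-Complex.I / (2 * Real.pi) * (w - y)⁻¹ * (w - y)⁻¹) * f y)
    (bound := fun y => δ⁻¹ * (B * (1 + |y|)⁻¹) * ‖f y‖)
    (Metric.ball_mem_nhds z hδ0) (Eventually.of_forall fun w => ?_)
    (integrable_cauchyKer_mul hp hp' hf hz) ?_ (ae_of_all _ fun y w hw => ?_) hbd
    (ae_of_all _ fun y w hw => ?_)).2
  · exact (measurable_cauchyKer_sub w).aestronglyMeasurable.mul hf.aestronglyMeasurable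
  · refine AEStronglyMeasurable.mul ?_ hf.aestronglyMeasurable
    exact (by fun_prop : Measurable _).aestronglyMeasurable
  · obtain ⟨h1, h2⟩ := hball w hw
    rw [norm_mul, norm_mul, norm_mul, norm_div, norm_neg, Complex.norm_I, norm_mul,
      Complex.norm_real, Real.norm_of_nonneg Real.pi_pos.le, norm_inv]
    have h3 := norm_inv_sub_le hδ0 h1 h2 y
    have h4 : ‖w - y‖⁻¹ ≤ δ⁻¹ := by
      apply inv_anti₀ hδ0
      have := Complex.abs_im_le_norm (w - y)
      simp only [Complex.sub_im, Complex.ofReal_im, sub_zero] at this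
      exact h1.trans ((le_abs_self _).trans this)
    have h5 : 1 / (‖(2 : ℂ)‖ * Real.pi) ≤ 1 := by
      have := two_pi_inv_le_one
      simpa using this
    gcongr
    calc 1 / (‖(2 : ℂ)‖ * Real.pi) * ‖w - y‖⁻¹ ≤ 1 * δ⁻¹ := by gcongr
      _ = δ⁻¹ := one_mul _
  · obtain ⟨h1, h2⟩ := hball w hw
    refine HasDerivAt.mul_const ?_ _
    have hne : w - y ≠ 0 := by
      intro h
      have := congrArg Complex.im h
      simp at this
      linarith
    have h3 : HasDerivAt (fun w : ℂ => Complex.I / (2 * Real.pi) * (w - y)⁻¹)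
        (Complex.I / (2 * Real.pi) * (-1 / (w - y) ^ 2)) w :=
      (((hasDerivAt_id w).sub_const _).inv hne).const_mul _
    have h4 : (fun w : ℂ => cauchyKer (w - y)) =
        fun w : ℂ => Complex.I / (2 * Real.pi) * (w - y)⁻¹ := by
      ext w
      simp only [cauchyKer]
      rw [div_mul_eq_div_div, div_eq_mul_inv (_ / _)]
    rw [h4]
    have h5 : -Complex.I / (2 * Real.pi) * (w - y)⁻¹ * (w - y)⁻¹ =
        Complex.I / (2 * Real.pi) * (-1 / (w - y) ^ 2) := by
      rw [div_eq_mul_inv (-1 : ℂ), pow_two, mul_inv]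
      ring
    rw [h5]
    exact h3

theorem differentiableOn_cauchyInt {p : ℝ≥0∞} (hp : 1 < p) (hp' : p ≠ ⊤) {f : ℝ → ℂ}
    (hf : MemLp f p volume) : DifferentiableOn ℂ (cauchyInt f) {z | 0 < z.im} :=
  fun _ hz => (hasDerivAt_cauchyInt hp hp' hf hz).differentiableAt.differentiableWithinAt

theorem continuous_cauchyInt_pt {p : ℝ≥0∞} (hp : 1 < p) (hp' : p ≠ ⊤) {f : ℝ → ℂ}
    (hf : MemLp f p volume) {t : ℝ} (ht : 0 < t) : Continuous fun x => cauchyInt f (pt t x) :=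
  (differentiableOn_cauchyInt hp hp' hf).continuousOn.comp_continuous (continuous_pt t)
    fun x => by simpa using ht

theorem cauchyInt_congr_ae {f g : ℝ → ℂ} (h : f =ᵐ[volume] g) (z : ℂ) :
    cauchyInt f z = cauchyInt g z :=
  integral_congr_ae (h.mono fun y hy => by simp [hy])

theorem cauchyInt_add {p : ℝ≥0∞} (hp : 1 < p) (hp' : p ≠ ⊤) {f g : ℝ → ℂ}
    (hf : MemLp f p volume) (hg : MemLp g p volume) {z : ℂ} (hz : 0 < z.im) :
    cauchyInt (f + g) z = cauchyInt f z + cauchyInt g z := by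
  unfold cauchyInt
  rw [← integral_add (integrable_cauchyKer_mul hp hp' hf hz)
    (integrable_cauchyKer_mul hp hp' hg hz)]
  simp only [Pi.add_apply, mul_add]

theorem cauchyInt_smul (c : ℂ) (f : ℝ → ℂ) (z : ℂ) :
    cauchyInt (c • f) z = c * cauchyInt f z := by
  unfold cauchyInt
  rw [← integral_const_mul]
  refine integral_congr_ae (ae_of_all _ fun y => ?_)
  simp only [Pi.smul_apply, smul_eq_mul]; ring

/-! ### The Poisson kernel and Young's inequality -/

/-- The Poisson kernel of the upper half plane. -/
def poissonKer (t x : ℝ) : ℝ := t / (Real.pi * (t ^ 2 + x ^ 2))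

/-- The Poisson integral. -/
def poissonInt (t : ℝ) (f : ℝ → ℂ) (x : ℝ) : ℂ := ∫ y : ℝ, (poissonKer t (x - y) : ℂ) * f y

theorem measurable_poissonKer (t : ℝ) : Measurable (poissonKer t) := by
  unfold poissonKer; fun_prop

theorem poissonKer_pos {t : ℝ} (ht : 0 < t) (x : ℝ) : 0 < poissonKer t x := by
  unfold poissonKer; have := Real.pi_pos; positivity

theorem poissonKer_neg (t x : ℝ) : poissonKer t (-x) = poissonKer t x := by
  unfold poissonKer; simp

/-- Multiply numerator and denominator by x - it. Twice the Cauchy kernel is thus the Poisson kernel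
plus i times the conjugate Poisson kernel, which is the reason for the factor 2 in front of Cauchy
integrals below. -/
theorem cauchyKer_pt (t x : ℝ) : cauchyKer (pt t x) =
    (1 / 2 : ℂ) * (poissonKer t x + Complex.I * (x / (Real.pi * (t ^ 2 + x ^ 2)) : ℝ)) := by
  unfold cauchyKer pt poissonKer
  by_cases h : t ^ 2 + x ^ 2 = 0
  · have h1 : t = 0 := by nlinarith [sq_nonneg t, sq_nonneg x]
    have h2 : x = 0 := by nlinarith [sq_nonneg t, sq_nonneg x]
    simp [h1, h2]
  · have h1 : ((t : ℂ) ^ 2 + (x : ℂ) ^ 2) ≠ 0 := by exact_mod_cast h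
    have hprod : ((t : ℂ) ^ 2 + (x : ℂ) ^ 2) =
        (x + t * Complex.I) * (x - t * Complex.I) := by
      linear_combination (t : ℂ) ^ 2 * Complex.I_sq
    have h2 : ((x : ℂ) + t * Complex.I) ≠ 0 := fun h0 => h1 (by rw [hprod, h0, zero_mul])
    have h4 : ((x : ℂ) - t * Complex.I) ≠ 0 := fun h0 => h1 (by rw [hprod, h0, mul_zero])
    have h3 : (Real.pi : ℂ) ≠ 0 := by exact_mod_cast Real.pi_ne_zero
    push_cast
    rw [hprod]
    have hb : Complex.I * (x - t * Complex.I) = t + Complex.I * x := by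
      linear_combination (-(t : ℂ)) * Complex.I_sq
    clear hprod h h1
    generalize (x : ℂ) + t * Complex.I = a at *
    generalize (x : ℂ) - t * Complex.I = b at *
    field_simp
    linear_combination hb

/-- Conjugation in the upper half plane followed by a sign change is x + it ↦ -x + it. This symmetry
makes convolution with the kernel formally self-adjoint for the Hermitian pairing. -/
theorem conj_cauchyKer_pt (t x : ℝ) :
    (starRingEnd ℂ) (cauchyKer (pt t x)) = cauchyKer (pt t (-x)) := by
  unfold cauchyKer pt
  simp only [map_div₀, map_mul, map_add, Complex.conj_I, Complex.conj_ofReal, map_ofNat]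
  rw [← neg_div_neg_eq, neg_neg]
  congr 1
  push_cast; ring

theorem poissonKer_eq (t x : ℝ) :
    (poissonKer t x : ℂ) = cauchyKer (pt t x) + (starRingEnd ℂ) (cauchyKer (pt t x)) := by
  rw [Complex.add_conj, cauchyKer_pt, Complex.mul_re, Complex.add_re, Complex.I_mul_re,
    Complex.ofReal_im, Complex.ofReal_re]
  norm_num
  ring

/-- As a function of y the kernel is the density of the Cauchy distribution with location x and
scale t. -/
theorem lintegral_poissonKer {t : ℝ} (ht : 0 < t) (x : ℝ) :
    ∫⁻ y, ENNReal.ofReal (poissonKer t (x - y)) = 1 := by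
  have h := ProbabilityTheory.lintegral_cauchyPDF_eq_one x (γ := t.toNNReal)
    (by simpa using ht)
  rw [← h]
  refine lintegral_congr fun y => ?_
  rw [ProbabilityTheory.cauchyPDF_def, ProbabilityTheory.cauchyPDFReal_def]
  congr 1
  unfold poissonKer
  rw [Real.coe_toNNReal _ ht.le, div_eq_mul_inv, mul_inv]
  ring

theorem integrable_poissonKer {t : ℝ} (ht : 0 < t) (x : ℝ) :
    Integrable (fun y => poissonKer t (x - y)) volume := by
  refine ⟨((measurable_poissonKer t).comp (by fun_prop)).aestronglyMeasurable, ?_⟩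
  rw [hasFiniteIntegral_iff_ofReal (ae_of_all _ fun y => (poissonKer_pos ht _).le),
    lintegral_poissonKer ht]
  exact ENNReal.one_lt_top

theorem integral_poissonKer {t : ℝ} (ht : 0 < t) (x : ℝ) :
    ∫ y, poissonKer t (x - y) = 1 := by
  rw [integral_eq_lintegral_of_nonneg_ae (ae_of_all _ fun y => (poissonKer_pos ht _).le)
    (integrable_poissonKer ht x).1, lintegral_poissonKer ht, ENNReal.toReal_one]

/-- Jensen's inequality for the probability measure with Poisson density, in the form that L₁ norms
are at most L_r norms. -/
theorem lintegral_poissonKer_mul_rpow_le {t : ℝ} (ht : 0 < t) {g : ℝ → ℝ≥0∞}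
    (hg : AEMeasurable g volume) {r : ℝ} (hr : 1 ≤ r) (x : ℝ) :
    (∫⁻ y, ENNReal.ofReal (poissonKer t (x - y)) * g y) ^ r ≤
      ∫⁻ y, ENNReal.ofReal (poissonKer t (x - y)) * g y ^ r := by
  have hm : Measurable fun y => ENNReal.ofReal (poissonKer t (x - y)) :=
    ((measurable_poissonKer t).comp (by fun_prop)).ennreal_ofReal
  set ν := volume.withDensity fun y => ENNReal.ofReal (poissonKer t (x - y)) with hν
  have hprob : IsProbabilityMeasure ν :=
    ⟨by rw [hν, withDensity_apply _ MeasurableSet.univ, setLIntegral_univ,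
      lintegral_poissonKer ht]⟩
  have hgν : AEMeasurable g ν := hg.mono_ac (withDensity_absolutelyContinuous _ _)
  have h1 := eLpNorm_le_eLpNorm_of_exponent_le (μ := ν) (p := 1) (q := ENNReal.ofReal r)
    (f := g) (by rw [← ENNReal.ofReal_one]; exact ENNReal.ofReal_le_ofReal hr)
    hgν.aestronglyMeasurable
  have hr0 : 0 < r := by linarith
  rw [eLpNorm_one_eq_lintegral_enorm, eLpNorm_eq_lintegral_rpow_enorm_toReal
    (by simpa using hr0) ENNReal.ofReal_ne_top, ENNReal.toReal_ofReal hr0.le] at h1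
  simp only [enorm_eq_self] at h1
  have h2 := ENNReal.rpow_le_rpow h1 hr0.le
  rw [← ENNReal.rpow_mul, one_div_mul_cancel hr0.ne', ENNReal.rpow_one] at h2
  rwa [hν, lintegral_withDensity_eq_lintegral_mul₀ hm.aemeasurable hg,
    lintegral_withDensity_eq_lintegral_mul₀ hm.aemeasurable (hg.pow_const r)] at h2

theorem lintegral_poissonKer_young {t : ℝ} (ht : 0 < t) {g : ℝ → ℝ≥0∞}
    (hg : AEMeasurable g volume) {r : ℝ} (hr : 1 ≤ r) :
    ∫⁻ x, (∫⁻ y, ENNReal.ofReal (poissonKer t (x - y)) * g y) ^ r ≤ ∫⁻ y, g y ^ r := by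
  have hm : Measurable fun z : ℝ × ℝ => ENNReal.ofReal (poissonKer t (z.1 - z.2)) :=
    ((measurable_poissonKer t).comp (by fun_prop)).ennreal_ofReal
  calc _ ≤ ∫⁻ x, ∫⁻ y, ENNReal.ofReal (poissonKer t (x - y)) * g y ^ r :=
        lintegral_mono fun x => lintegral_poissonKer_mul_rpow_le ht hg hr x
    _ = ∫⁻ y, ∫⁻ x, ENNReal.ofReal (poissonKer t (x - y)) * g y ^ r := by
        rw [lintegral_lintegral_swap]
        exact hm.aemeasurable.mul ((hg.pow_const r).comp_snd)
    _ = ∫⁻ y, g y ^ r := by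
        refine lintegral_congr fun y => ?_
        rw [lintegral_mul_const'' (f := fun x => ENNReal.ofReal (poissonKer t (x - y))) _
          ((hm.comp (by fun_prop : Measurable fun x : ℝ => (x, y))).aemeasurable)]
        have : ∀ x, poissonKer t (x - y) = poissonKer t (y - x) := fun x => by
          rw [← poissonKer_neg, neg_sub]
        simp_rw [this]
        rw [lintegral_poissonKer ht, one_mul]

/-- Only a pointwise majorization is asked for, so this applies to any operator whose kernel is
dominated by a Poisson kernel: Poisson integrals, real parts of Cauchy integrals, and differences of
Cauchy integrals at two heights. -/
theorem eLpNorm_le_of_le_poissonKer {E F : Type*} [NormedAddCommGroup E] [NormedAddCommGroup F]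
    {t : ℝ} (ht : 0 < t) {p : ℝ≥0∞} (hp : 1 ≤ p)
    (hp' : p ≠ ⊤) {f : ℝ → E} (hf : AEStronglyMeasurable f volume) {h : ℝ → F} (C : ℝ≥0∞)
    (hh : ∀ x, ‖h x‖ₑ ≤ C * ∫⁻ y, ENNReal.ofReal (poissonKer t (x - y)) * ‖f y‖ₑ) :
    eLpNorm h p volume ≤ C * eLpNorm f p volume := by
  have hr : 1 ≤ p.toReal := by
    rw [← ENNReal.toReal_one]; exact (ENNReal.toReal_le_toReal ENNReal.one_ne_top hp').2 hp
  have hr0 : 0 < p.toReal := by linarith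
  have hp0 : p ≠ 0 := (zero_lt_one.trans_le hp).ne'
  rw [eLpNorm_eq_lintegral_rpow_enorm_toReal hp0 hp', eLpNorm_eq_lintegral_rpow_enorm_toReal hp0 hp']
  have hm : AEMeasurable (fun x => ∫⁻ y, ENNReal.ofReal (poissonKer t (x - y)) * ‖f y‖ₑ) volume := by
    have hm : Measurable fun z : ℝ × ℝ => ENNReal.ofReal (poissonKer t (z.1 - z.2)) :=
      ((measurable_poissonKer t).comp (by fun_prop)).ennreal_ofReal
    exact (hm.aemeasurable.mul (hf.enorm.comp_snd)).lintegral_prod_right'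
  calc (∫⁻ x, ‖h x‖ₑ ^ p.toReal) ^ (1 / p.toReal)
      ≤ (∫⁻ x, C ^ p.toReal *
        (∫⁻ y, ENNReal.ofReal (poissonKer t (x - y)) * ‖f y‖ₑ) ^ p.toReal) ^ (1 / p.toReal) := by
        gcongr with x
        rw [← ENNReal.mul_rpow_of_nonneg _ _ hr0.le]
        gcongr
        exact hh x
    _ = C * (∫⁻ x, (∫⁻ y, ENNReal.ofReal (poissonKer t (x - y)) * ‖f y‖ₑ) ^ p.toReal) ^
        (1 / p.toReal) := by
        rw [lintegral_const_mul'' _ (hm.pow_const _), ENNReal.mul_rpow_of_nonneg _ _ (by positivity),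
          ← ENNReal.rpow_mul, mul_one_div_cancel hr0.ne', ENNReal.rpow_one]
    _ ≤ _ := mul_le_mul_right (ENNReal.rpow_le_rpow
        (lintegral_poissonKer_young ht hf.enorm hr) (by positivity)) _


/-! ### The pointwise inequality behind M. Riesz' theorem -/

/-- By homogeneity this is a claim about the angle: |sin θ|^r ≤ a cos^r θ - b cos(rθ) for |θ| < π/2.
Near ±π/2 the angle rθ lies in the second (or third) quadrant, since 1 < r ≤ 2, so -cos(rθ) is
bounded below and b does the work; elsewhere cos θ is bounded below and a does it. On integration
the term Re w^r disappears by Cauchy's theorem. -/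
theorem exists_abs_im_rpow_le {r : ℝ} (hr : 1 < r) (hr2 : r ≤ 2) :
    ∃ a b : ℝ, 0 ≤ a ∧ ∀ w : ℂ, 0 < w.re →
      |w.im| ^ r ≤ a * w.re ^ r - b * (w ^ (r : ℂ)).re := by
  have hπ := Real.pi_pos
  have hr0 : 0 < r := by linarith
  -- The midpoint of π/(2r), where cos(rθ) changes sign, and π/2.
  set θ₀ := Real.pi / 4 * (1 + 1 / r) with hθ₀
  have hrθ : r * θ₀ = Real.pi / 4 * (r + 1) := by rw [hθ₀]; field_simp
  have hθ₀0 : 0 < θ₀ := by positivity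
  have hθ₀1 : θ₀ < Real.pi / 2 := by
    have : 1 / r < 1 := by rw [div_lt_one hr0]; exact hr
    rw [hθ₀]; nlinarith
  have hc0 : Real.cos (r * θ₀) < 0 := by
    rw [hrθ]; apply Real.cos_neg_of_pi_div_two_lt_of_lt <;> nlinarith
  have hcos0 : 0 < Real.cos θ₀ := Real.cos_pos_of_mem_Ioo ⟨by linarith, hθ₀1⟩
  set b := 1 / (-Real.cos (r * θ₀)) with hb
  have hb0 : 0 < b := by rw [hb]; apply one_div_pos.2; linarith
  -- The constants are normalized at θ₀: b(-cos rθ₀) = 1 handles larger angles, and a cos^r θ₀ = 1 +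
  -- b compensates the worst value b of b cos(rθ) at smaller angles.
  set a := (1 + b) / Real.cos θ₀ ^ r with ha
  have ha0 : 0 ≤ a := by positivity
  have key : ∀ θ : ℝ, |θ| < Real.pi / 2 →
      |Real.sin θ| ^ r ≤ a * Real.cos θ ^ r - b * Real.cos (r * θ) := by
    intro θ hθ
    have h1 : |Real.sin θ| ^ r ≤ 1 := Real.rpow_le_one (abs_nonneg _) (Real.abs_sin_le_one _) hr0.le
    rw [← Real.cos_abs θ, ← Real.cos_abs (r * θ), abs_mul, abs_of_pos hr0]
    rcases le_or_gt θ₀ |θ| with h | h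
    · have h2 : Real.cos (r * |θ|) ≤ Real.cos (r * θ₀) := by
        apply Real.cos_le_cos_of_nonneg_of_le_pi (by positivity)
        · nlinarith
        · gcongr
      have h3 : 1 ≤ -(b * Real.cos (r * |θ|)) := by
        have h4 : b * -Real.cos (r * θ₀) = 1 := by
          rw [hb]; exact one_div_mul_cancel (by linarith)
        nlinarith
      have h5 : 0 ≤ Real.cos |θ| := Real.cos_nonneg_of_mem_Icc ⟨by linarith [abs_nonneg θ], hθ.le⟩
      have : 0 ≤ a * Real.cos |θ| ^ r := by positivity
      linarith
    · have h2 : Real.cos θ₀ ≤ Real.cos |θ| :=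
        Real.cos_le_cos_of_nonneg_of_le_pi (abs_nonneg _) (by linarith) h.le
      have h3 : 1 + b ≤ a * Real.cos |θ| ^ r := by
        have : 1 + b = a * Real.cos θ₀ ^ r := by rw [ha]; field_simp
        rw [this]; gcongr
      have h4 := Real.cos_le_one (r * |θ|)
      nlinarith
  refine ⟨a, b, ha0, fun w hw => ?_⟩
  have harg : |w.arg| < Real.pi / 2 := Complex.abs_arg_lt_pi_div_two_iff.2 (Or.inl hw)
  have hn : 0 ≤ ‖w‖ := norm_nonneg w
  have h1 : w.re = ‖w‖ * Real.cos w.arg := (Complex.norm_mul_cos_arg w).symm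
  have h2 : w.im = ‖w‖ * Real.sin w.arg := (Complex.norm_mul_sin_arg w).symm
  have h5 : 0 ≤ Real.cos w.arg := by
    rw [abs_lt] at harg
    exact Real.cos_nonneg_of_mem_Icc ⟨by linarith [harg.1], harg.2.le⟩
  rw [Complex.cpow_ofReal_re, h2, abs_mul, abs_of_nonneg hn, Real.mul_rpow hn (abs_nonneg _)]
  conv_rhs => rw [h1, Real.mul_rpow hn h5]
  have := key _ harg
  have h6 : 0 ≤ ‖w‖ ^ r := by positivity
  rw [mul_comm r] at this
  nlinarith

/-! ### Vanishing of line integrals of decaying holomorphic functions -/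

theorem norm_pt_inv_le {t : ℝ} (ht : 0 < t) (x : ℝ) :
    ‖pt t x‖⁻¹ ≤ ((1 + t) / t + 1) * (1 + |x|)⁻¹ := by
  have h := norm_inv_sub_le (z := pt t 0) (M := t) ht (by simp)
    (by simp [pt, abs_of_pos ht]) (-x)
  rwa [pt_sub, abs_neg, zero_sub, neg_neg] at h

/-- Cauchy's theorem on the rectangle [-R, R] × [t, t + R]. On the three other sides |G| ≤ B R^{-r}
and the lengths are O(R), so they contribute O(R^{1-r}), which tends to 0. -/
theorem integral_eq_zero_of_decay {G : ℂ → ℂ} (hG : DifferentiableOn ℂ G {z | 0 < z.im})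
    {t : ℝ} (ht : 0 < t) {B r : ℝ} (hr : 1 < r)
    (hB : ∀ z : ℂ, t ≤ z.im → ‖G z‖ ≤ B * ‖z‖⁻¹ ^ r) :
    Integrable (fun x => G (pt t x)) volume ∧ ∫ x, G (pt t x) = 0 := by
  have hB0 : 0 ≤ B := by
    have h := (norm_nonneg _).trans (hB (pt t 0) (by simp))
    have h2 : 0 < ‖pt t 0‖⁻¹ ^ r := by
      apply Real.rpow_pos_of_pos; simp [pt, ht.ne']
    exact nonneg_of_mul_nonneg_left h h2
  have hcont : Continuous fun x => G (pt t x) :=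
    hG.continuousOn.comp_continuous (continuous_pt t) fun x => by simpa using ht
  have hint : Integrable (fun x => G (pt t x)) volume := by
    have h1 := (integrable_one_add_norm (E := ℝ) (μ := volume) (r := r)
      (by simpa using hr)).const_mul (B * ((1 + t) / t + 1) ^ r)
    refine h1.mono' hcont.aestronglyMeasurable (ae_of_all _ fun x => ?_)
    refine (hB _ (by simp)).trans ?_
    rw [mul_assoc, Real.norm_eq_abs, Real.rpow_neg (by positivity), ← Real.inv_rpow (by positivity),
      ← Real.mul_rpow (by positivity) (by positivity)]
    gcongr
    exact norm_pt_inv_le ht x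
  refine ⟨hint, ?_⟩
  have hlim := intervalIntegral_tendsto_integral hint tendsto_neg_atTop_atBot tendsto_id
  refine tendsto_nhds_unique hlim ?_
  -- The 4 is the total length of the top side (2R) and the two vertical sides (R each), divided by
  -- R.
  have hbound : ∀ R : ℝ, 0 < R → ‖∫ x in (-R)..R, G (pt t x)‖ ≤ 4 * B * R ^ (1 - r) := by
    intro R hR
    have hsmall : ∀ z : ℂ, t ≤ z.im → R ≤ ‖z‖ → ‖G z‖ ≤ B * R⁻¹ ^ r := by
      intro z hz hz'
      refine (hB z hz).trans ?_
      gcongr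
    have hrect := Complex.integral_boundary_rect_eq_zero_of_differentiableOn G
      (pt t (-R)) (pt (t + R) R) (hG.mono ?_)
    · simp only [pt_re, pt_im, smul_eq_mul] at hrect
      have e1 : ‖∫ x in (-R)..R, G (x + ((t + R : ℝ) : ℂ) * Complex.I)‖ ≤
          B * R⁻¹ ^ r * |R - -R| := by
        refine intervalIntegral.norm_integral_le_of_norm_le_const fun x _ => hsmall _ ?_ ?_
        · simp; linarith
        · have := Complex.abs_im_le_norm ((x : ℂ) + ((t + R : ℝ) : ℂ) * Complex.I)
          simp only [Complex.add_im, Complex.ofReal_im, Complex.mul_im, Complex.ofReal_re,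
            Complex.I_im, Complex.I_re] at this
          refine le_trans ?_ this
          rw [abs_of_nonneg] <;> linarith
      have e2 : ∀ c : ℝ, |c| = R → ‖∫ y in t..(t + R), G (c + y * Complex.I)‖ ≤
          B * R⁻¹ ^ r * |t + R - t| := by
        intro c hc
        refine intervalIntegral.norm_integral_le_of_norm_le_const fun y hy => hsmall _ ?_ ?_
        · rw [Set.uIoc_of_le (by linarith)] at hy
          simp; exact hy.1.le
        · have := Complex.abs_re_le_norm ((c : ℂ) + (y : ℂ) * Complex.I)
          simpa [hc] using this
      have e3 := e2 R (abs_of_pos hR)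
      have e4 := e2 (-R) (by rw [abs_neg, abs_of_pos hR])
      have e5 : ∫ x in (-R)..R, G (pt t x) =
          (∫ x in (-R)..R, G (x + ((t + R : ℝ) : ℂ) * Complex.I))
          - Complex.I * (∫ y in t..(t + R), G (R + y * Complex.I))
          + Complex.I * ∫ y in t..(t + R), G ((-R : ℝ) + y * Complex.I) := by
        unfold pt
        linear_combination hrect
      have e6 : R⁻¹ ^ r * R = R ^ (1 - r) := by
        rw [Real.rpow_sub hR, Real.rpow_one, Real.inv_rpow hR.le]; field_simp
      have e7 : |R - -R| = 2 * R := by rw [abs_of_nonneg] <;> linarith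
      have e8 : |t + R - t| = R := by rw [abs_of_nonneg] <;> linarith
      rw [e7] at e1
      rw [e8] at e3 e4
      rw [e5]
      refine (norm_add_le _ _).trans ?_
      refine (add_le_add_left (norm_sub_le _ _) _).trans ?_
      rw [norm_mul, norm_mul, Complex.norm_I, one_mul, one_mul, ← e6]
      linarith
    · intro z hz
      rw [Complex.mem_reProdIm] at hz
      have := hz.2
      simp only [pt_im] at this
      rw [Set.uIcc_of_le (by linarith)] at this
      exact lt_of_lt_of_le ht this.1
  rw [tendsto_zero_iff_norm_tendsto_zero]
  have h0 : Tendsto (fun R : ℝ => 4 * B * R ^ (1 - r)) atTop (𝓝 0) := by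
    have := (tendsto_rpow_neg_atTop (y := r - 1) (by linarith)).const_mul (4 * B)
    simpa [neg_sub] using this
  refine squeeze_zero' (Eventually.of_forall fun _ => norm_nonneg _) ?_ h0
  filter_upwards [eventually_gt_atTop 0] with R hR using hbound R hR

/-! ### Bounded functions with bounded support -/

/-- Bounded measurable functions with bounded support. -/
structure IsNice (f : ℝ → ℂ) : Prop where
  meas : AEStronglyMeasurable f volume
  bdd : ∃ M, ∀ x, ‖f x‖ ≤ M
  supp : ∃ R, ∀ x, R < |x| → f x = 0

namespace IsNice

theorem memLp {f : ℝ → ℂ} (hf : IsNice f) {p : ℝ≥0∞} (hp : 1 < p) (hp' : p ≠ ⊤) :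
    MemLp f p volume := by
  obtain ⟨M, hM⟩ := hf.bdd
  obtain ⟨R, hR⟩ := hf.supp
  have hM0 : 0 ≤ M := (norm_nonneg _).trans (hM 0)
  refine memLp_of_decay (B := M * (1 + |R|)) hf.meas (fun x => ?_) hp hp'
  by_cases h : R < |x|
  · rw [hR x h, norm_zero]; positivity
  · refine (hM x).trans ?_
    rw [mul_assoc]
    refine le_mul_of_one_le_right hM0 ?_
    rw [← div_eq_mul_inv, le_div_iff₀ (by positivity)]
    have := le_abs_self R
    linarith [not_lt.1 h]

theorem integrable {f : ℝ → ℂ} (hf : IsNice f) : Integrable f volume := by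
  obtain ⟨M, hM⟩ := hf.bdd
  obtain ⟨R, hR⟩ := hf.supp
  have h : IntegrableOn f (Set.Icc (-R) R) volume :=
    Measure.integrableOn_of_bounded (M := M) (by simp) hf.meas (ae_of_all _ hM)
  refine (integrableOn_iff_integrable_of_support_subset fun x hx => ?_).1 h
  by_contra hx'
  apply hx
  apply hR
  by_contra h'
  exact hx' (abs_le.1 (not_lt.1 h'))

/-- On the support of f, |z| ≤ |z - y| + |R| ≤ (1 + |R|/t)|z - y|. The resulting decay in z is what
the contour argument needs, and it is the reason for working first with bounded functions of bounded
support. -/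
theorem exists_norm_cauchyKer_mul_le {f : ℝ → ℂ} (hf : IsNice f) {t : ℝ} (ht : 0 < t) :
    ∃ B : ℝ, 0 ≤ B ∧ ∀ z : ℂ, t ≤ z.im → ∀ y : ℝ,
      ‖cauchyKer (z - y) * f y‖ ≤ B * ‖z‖⁻¹ * ‖f y‖ := by
  obtain ⟨R, hR⟩ := hf.supp
  refine ⟨1 + |R| / t, by positivity, fun z hz y => ?_⟩
  by_cases h : R < |y|
  · simp [hR y h]
  · rw [norm_mul]
    gcongr
    rw [norm_cauchyKer]
    refine (mul_le_of_le_one_left (by positivity) two_pi_inv_le_one).trans ?_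
    have h1 : t ≤ ‖z - y‖ := by
      have := Complex.abs_im_le_norm (z - y)
      simp only [Complex.sub_im, Complex.ofReal_im, sub_zero] at this
      exact hz.trans ((le_abs_self _).trans this)
    have h2 : ‖z‖ ≤ ‖z - y‖ + |y| := by
      calc ‖z‖ = ‖(z - y) + y‖ := by ring_nf
        _ ≤ ‖z - y‖ + ‖(y : ℂ)‖ := norm_add_le _ _
        _ = _ := by simp
    have h3 : |y| ≤ |R| / t * ‖z - y‖ := by
      have h4 : |y| ≤ |R| := (not_lt.1 h).trans (le_abs_self _)
      rw [div_mul_eq_mul_div, le_div_iff₀ ht]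
      have := abs_nonneg y
      nlinarith [abs_nonneg R]
    have h4 : 0 < ‖z‖ := ht.trans_le (hz.trans ((le_abs_self _).trans (Complex.abs_im_le_norm z)))
    rw [← div_eq_mul_inv, le_div_iff₀ h4, inv_mul_le_iff₀ (by linarith)]
    linarith

theorem exists_norm_cauchyInt_le {f : ℝ → ℂ} (hf : IsNice f) {t : ℝ} (ht : 0 < t) :
    ∃ B : ℝ, 0 ≤ B ∧ ∀ z : ℂ, t ≤ z.im → ‖cauchyInt f z‖ ≤ B * ‖z‖⁻¹ := by
  obtain ⟨B, hB0, hB⟩ := hf.exists_norm_cauchyKer_mul_le ht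
  refine ⟨B * ∫ y, ‖f y‖, mul_nonneg hB0 (integral_nonneg fun _ => norm_nonneg _), fun z hz => ?_⟩
  calc ‖cauchyInt f z‖ ≤ ∫ y, B * ‖z‖⁻¹ * ‖f y‖ :=
        norm_integral_le_of_norm_le (hf.integrable.norm.const_mul _) (ae_of_all _ (hB z hz))
    _ = _ := by rw [integral_const_mul]; ring

theorem memLp_cauchyInt {f : ℝ → ℂ} (hf : IsNice f) {t : ℝ} (ht : 0 < t) {p : ℝ≥0∞}
    (hp : 1 < p) (hp' : p ≠ ⊤) : MemLp (fun x => cauchyInt f (pt t x)) p volume := by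
  obtain ⟨B, hB0, hB⟩ := hf.exists_norm_cauchyInt_le ht
  refine memLp_of_decay (B := B * ((1 + t) / t + 1))
    (continuous_cauchyInt_pt hp hp' (hf.memLp hp hp') ht).aestronglyMeasurable (fun x => ?_) hp hp'
  refine (hB _ (by simp)).trans ?_
  rw [mul_assoc]
  gcongr
  exact norm_pt_inv_le ht x

/-- Fubini and the conjugation symmetry of the kernel. With f nice and g merely in L_q the double
integral converges absolutely; the case of two general functions follows later by density. -/
theorem integral_conj_cauchyInt_mul {f : ℝ → ℂ} (hf : IsNice f) {q : ℝ≥0∞} (hq : 1 < q)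
    (hq' : q ≠ ⊤) {g : ℝ → ℂ} (hg : MemLp g q volume) {t : ℝ} (ht : 0 < t) :
    ∫ x, (starRingEnd ℂ) (cauchyInt g (pt t x)) * f x =
      ∫ x, (starRingEnd ℂ) (g x) * cauchyInt f (pt t x) := by
  obtain ⟨B, hB0, hB⟩ := hf.exists_norm_cauchyKer_mul_le ht
  have hint : Integrable (fun z : ℝ × ℝ =>
      (starRingEnd ℂ) (g z.1) * (cauchyKer (pt t z.1 - z.2) * f z.2)) (volume.prod volume) := by
    have h1 : Integrable (fun x => (((B * ‖pt t x‖⁻¹ : ℝ) : ℂ)) * g x) volume := by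
      refine integrable_mul_of_decay (B := B * ((1 + t) / t + 1)) ?_ (fun x => ?_) hq hq' hg
      · have := (continuous_pt t).measurable
        exact (by fun_prop : Measurable _).aestronglyMeasurable
      · rw [Complex.norm_real, Real.norm_of_nonneg (by positivity), mul_assoc]
        gcongr
        exact norm_pt_inv_le ht x
    refine (h1.mul_prod hf.integrable).mono ?_ (ae_of_all _ fun z => ?_)
    · refine AEStronglyMeasurable.mul ?_ (AEStronglyMeasurable.mul ?_ hf.meas.comp_snd)
      · exact Complex.continuous_conj.comp_aestronglyMeasurable hg.1.comp_fst
      · refine (measurable_cauchyKer.comp ?_).aestronglyMeasurable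
        have := (continuous_pt t).measurable
        fun_prop
    · rw [norm_mul, norm_mul (_ * _), norm_mul (Complex.ofReal _), RCLike.norm_conj,
        Complex.norm_real, Real.norm_of_nonneg (by positivity)]
      have := mul_le_mul_of_nonneg_left (hB (pt t z.1) (by simp) z.2) (norm_nonneg (g z.1))
      linarith
  have hswap := integral_integral_swap
    (f := fun x y : ℝ => (starRingEnd ℂ) (g x) * (cauchyKer (pt t x - y) * f y)) hint
  calc _ = ∫ y : ℝ, ∫ x : ℝ, (starRingEnd ℂ) (g x) * (cauchyKer (pt t x - y) * f y) := by
        refine integral_congr_ae (ae_of_all _ fun y => ?_)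
        simp only
        rw [cauchyInt, ← integral_conj, ← integral_mul_const]
        refine integral_congr_ae (ae_of_all _ fun x => ?_)
        simp only
        rw [map_mul, pt_sub, conj_cauchyKer_pt, neg_sub, pt_sub]
        ring
    _ = ∫ x : ℝ, ∫ y : ℝ, (starRingEnd ℂ) (g x) * (cauchyKer (pt t x - y) * f y) := hswap.symm
    _ = _ := by
        refine integral_congr_ae (ae_of_all _ fun x => ?_)
        simp only
        rw [integral_const_mul, cauchyInt]

end IsNice


/-! ### M. Riesz' theorem: uniform `L_p` bounds for Cauchy integrals -/

theorem re_cauchyInt_ofReal {p : ℝ≥0∞} (hp : 1 < p) (hp' : p ≠ ⊤) {f : ℝ → ℝ}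
    (hf : MemLp (fun x => (f x : ℂ)) p volume) {t : ℝ} (ht : 0 < t) (x : ℝ) :
    Integrable (fun y => poissonKer t (x - y) * f y) volume ∧
    (2 * cauchyInt (fun y => (f y : ℂ)) (pt t x)).re = ∫ y, poissonKer t (x - y) * f y := by
  have h := (integrable_cauchyKer_mul hp hp' hf (z := pt t x) (by simpa using ht)).const_mul 2
  have h2 : ∀ y : ℝ, (2 * (cauchyKer (pt t x - y) * (f y : ℂ))).re = poissonKer t (x - y) * f y := by
    intro y
    rw [pt_sub, cauchyKer_pt]
    simp only [Complex.mul_re, Complex.mul_im, Complex.add_re, Complex.add_im, Complex.I_re,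
      Complex.I_im, Complex.ofReal_re, Complex.ofReal_im]
    norm_num
    ring
  constructor
  · exact h.re.congr (ae_of_all _ h2)
  · rw [cauchyInt, ← integral_const_mul, ← Complex.reCLM_apply,
      ← Complex.reCLM.integral_comp_comm h]
    exact integral_congr_ae (ae_of_all _ h2)

/-- Insert F = 2 C f into the pointwise inequality and integrate along the line at height t.
Positivity of f makes Re F > 0, so F^r is holomorphic on the principal branch; it decays like
|z|^{-r} and hence has integral 0. -/
theorem lintegral_im_cauchyInt_le {r a b : ℝ} (hr : 1 < r) (ha : 0 ≤ a)
    (hab : ∀ w : ℂ, 0 < w.re → |w.im| ^ r ≤ a * w.re ^ r - b * (w ^ (r : ℂ)).re)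
    {f : ℝ → ℝ} (hf0 : ∀ x, 0 ≤ f x) (hf : IsNice fun x => (f x : ℂ)) {t : ℝ} (ht : 0 < t) :
    ∫⁻ x, ‖(2 * cauchyInt (fun y => (f y : ℂ)) (pt t x)).im‖ₑ ^ r ≤
      ENNReal.ofReal a * ∫⁻ x, ‖(2 * cauchyInt (fun y => (f y : ℂ)) (pt t x)).re‖ₑ ^ r := by
  have hr0 : 0 < r := by linarith
  set p := ENNReal.ofReal r with hp_def
  have hp : 1 < p := by rw [hp_def, ← ENNReal.ofReal_one]; exact (ENNReal.ofReal_lt_ofReal_iff hr0).2 hr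
  have hp' : p ≠ ⊤ := ENNReal.ofReal_ne_top
  have hpr : p.toReal = r := ENNReal.toReal_ofReal hr0.le
  -- If f vanishes almost everywhere then F = 0, Re F is not positive and the branch argument fails,
  -- but the claim is trivial.
  by_cases hz : (fun x => (f x : ℂ)) =ᵐ[volume] 0
  · have : ∀ z, cauchyInt (fun y => (f y : ℂ)) z = 0 := fun z => by
      rw [cauchyInt_congr_ae hz]; simp [cauchyInt]
    simp [this, hr0]
  set F : ℂ → ℂ := fun z => 2 * cauchyInt (fun y => (f y : ℂ)) z with hF
  have hfL := hf.memLp hp hp'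
  have hre : ∀ z : ℂ, 0 < z.im → 0 < (F z).re := by
    intro z hz'
    have hzpt : z = pt z.im z.re := by simp [pt, Complex.re_add_im]
    obtain ⟨h1, h2⟩ := re_cauchyInt_ofReal hp hp' hfL hz' z.re
    rw [hzpt, hF]
    simp only
    rw [h2, integral_pos_iff_support_of_nonneg
      (fun y => mul_nonneg (poissonKer_pos hz' _).le (hf0 y)) h1, pos_iff_ne_zero]
    intro h0
    apply hz
    rw [Filter.EventuallyEq, ae_iff]
    refine measure_mono_null (fun y hy => ?_) h0
    simp only [Pi.zero_apply, Complex.ofReal_eq_zero, Set.mem_ofPred_eq] at hy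
    exact mul_ne_zero (poissonKer_pos hz' _).ne' hy
  have hFd : DifferentiableOn ℂ F {z | 0 < z.im} :=
    (differentiableOn_cauchyInt hp hp' hfL).const_mul 2
  have hGd : DifferentiableOn ℂ (fun z => F z ^ (r : ℂ)) {z | 0 < z.im} := by
    intro z hz'
    exact (hFd z hz').cpow_const (Or.inl (hre z hz'))
  obtain ⟨B, hB0, hB⟩ := hf.exists_norm_cauchyInt_le ht
  have hFB : ∀ z : ℂ, t ≤ z.im → ‖F z‖ ^ r ≤ (2 * B) ^ r * ‖z‖⁻¹ ^ r := by
    intro z hz'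
    rw [← Real.mul_rpow (by positivity) (by positivity)]
    have : ‖F z‖ ≤ 2 * B * ‖z‖⁻¹ := by
      rw [hF]; simp only [norm_mul]
      have := hB z hz'
      norm_num
      linarith
    gcongr
  have hGn : ∀ z : ℂ, 0 < z.im → ‖F z ^ (r : ℂ)‖ = ‖F z‖ ^ r := fun z hz' => by
    rw [Complex.norm_cpow_of_ne_zero (by intro h; have := hre z hz'; simp [h] at this)]
    simp
  obtain ⟨hGi, hG0⟩ := integral_eq_zero_of_decay hGd ht hr (B := (2 * B) ^ r) fun z hz' => by
    rw [hGn z (ht.trans_le hz')]; exact hFB z hz'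
  have hFL : MemLp (fun x => F (pt t x)) p volume := (hf.memLp_cauchyInt ht hp hp').const_mul 2
  have hFi := hFL.integrable_norm_rpow (by positivity) hp'
  rw [hpr] at hFi
  have hcont : Continuous fun x => F (pt t x) :=
    hFd.continuousOn.comp_continuous (continuous_pt t) fun x => by simpa using ht
  have hc1 : Continuous fun x => (F (pt t x)).re := Complex.continuous_re.comp hcont
  have hc2 : Continuous fun x => (F (pt t x)).im := Complex.continuous_im.comp hcont
  have hi1 : Integrable (fun x => |(F (pt t x)).re| ^ r) volume :=
    hFi.mono' (hc1.abs.rpow_const fun _ => Or.inr hr0.le).aestronglyMeasurable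
      (ae_of_all _ fun x => by
        rw [Real.norm_of_nonneg (by positivity)]
        gcongr
        exact Complex.abs_re_le_norm _)
  have hi2 : Integrable (fun x => |(F (pt t x)).im| ^ r) volume :=
    hFi.mono' (hc2.abs.rpow_const fun _ => Or.inr hr0.le).aestronglyMeasurable
      (ae_of_all _ fun x => by
        rw [Real.norm_of_nonneg (by positivity)]
        gcongr
        exact Complex.abs_im_le_norm _)
  have hGr : Integrable (fun x => ((F (pt t x)) ^ (r : ℂ)).re) volume := hGi.re
  have hmain : ∫ x, |(F (pt t x)).im| ^ r ≤ a * ∫ x, |(F (pt t x)).re| ^ r := by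
    have h0 : ∫ x, ((F (pt t x)) ^ (r : ℂ)).re = 0 := by
      have := Complex.reCLM.integral_comp_comm hGi
      simp only [Complex.reCLM_apply] at this
      rw [this, hG0, Complex.zero_re]
    calc ∫ x, |(F (pt t x)).im| ^ r
        ≤ ∫ x, (a * |(F (pt t x)).re| ^ r - b * ((F (pt t x)) ^ (r : ℂ)).re) := by
          refine integral_mono hi2 ((hi1.const_mul a).sub (hGr.const_mul b)) fun x => ?_
          have hx := hre (pt t x) (by simpa using ht)
          have := hab _ hx
          simp only
          rwa [abs_of_pos hx]
      _ = _ := by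
          rw [integral_sub (hi1.const_mul a) (hGr.const_mul b), integral_const_mul,
            integral_const_mul, h0]
          ring
  have hconv : ∀ {g : ℝ → ℝ}, Integrable (fun x => |g x| ^ r) volume →
      ∫⁻ x, ‖g x‖ₑ ^ r = ENNReal.ofReal (∫ x, |g x| ^ r) := by
    intro g hg
    rw [ofReal_integral_eq_lintegral_ofReal hg (ae_of_all _ fun x => by positivity)]
    refine lintegral_congr fun x => ?_
    rw [← ofReal_norm, Real.norm_eq_abs, ENNReal.ofReal_rpow_of_nonneg (abs_nonneg _) hr0.le]
  rw [hconv hi1, hconv hi2, ← ENNReal.ofReal_mul ha]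
  exact ENNReal.ofReal_le_ofReal hmain

/-- The real part of 2 C f is the Poisson integral of f and is controlled by Young's inequality; the
imaginary part is controlled by the real part through the contour argument. The constant does not
depend on the height. -/
theorem exists_eLpNorm_cauchyInt_le_of_nonneg {p : ℝ≥0∞} (hp : 1 < p) (hp2 : p ≤ 2) :
    ∃ M : NNReal, ∀ t : ℝ, 0 < t → ∀ f : ℝ → ℝ, (∀ x, 0 ≤ f x) → IsNice (fun x => (f x : ℂ)) →
      eLpNorm (fun x => cauchyInt (fun y => (f y : ℂ)) (pt t x)) p volume ≤
        M * eLpNorm (fun x => (f x : ℂ)) p volume := by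
  have hp' : p ≠ ⊤ := (hp2.trans_lt (by simp)).ne
  have hr : 1 < p.toReal := one_lt_toReal hp hp'
  have hr0 : 0 < p.toReal := by linarith
  have hp0 : p ≠ 0 := (zero_lt_one.trans hp).ne'
  have hr2 : p.toReal ≤ 2 := by
    have := (ENNReal.toReal_le_toReal hp' (by simp)).2 hp2
    simpa using this
  obtain ⟨a, b, ha, hab⟩ := exists_abs_im_rpow_le hr hr2
  refine ⟨1 + (a.toNNReal) ^ (1 / p.toReal), fun t ht f hf0 hf => ?_⟩
  set F : ℝ → ℂ := fun x => 2 * cauchyInt (fun y => (f y : ℂ)) (pt t x) with hF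
  have hfL := hf.memLp hp hp'
  have hFL : MemLp F p volume := (hf.memLp_cauchyInt ht hp hp').const_mul 2
  have hReF : eLpNorm (fun x => (F x).re) p volume ≤ eLpNorm (fun x => (f x : ℂ)) p volume := by
    have := eLpNorm_le_of_le_poissonKer ht hp.le hp' hfL.1 (h := fun x => (F x).re) 1 (fun x => by
      rw [one_mul]
      obtain ⟨h1, h2⟩ := re_cauchyInt_ofReal hp hp' hfL ht x
      rw [hF]; simp only
      rw [h2]
      refine (enorm_integral_le_lintegral_enorm _).trans_eq (lintegral_congr fun y => ?_)
      rw [enorm_mul, Real.enorm_of_nonneg (poissonKer_pos ht _).le]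
      congr 1
      rw [← ofReal_norm, ← ofReal_norm, Complex.norm_real])
    simpa using this
  have hImF : eLpNorm (fun x => (F x).im) p volume ≤
      ENNReal.ofReal a ^ (1 / p.toReal) * eLpNorm (fun x => (f x : ℂ)) p volume := by
    refine le_trans ?_ (mul_le_mul_right hReF _)
    rw [eLpNorm_eq_lintegral_rpow_enorm_toReal hp0 hp',
      eLpNorm_eq_lintegral_rpow_enorm_toReal hp0 hp',
      ← ENNReal.mul_rpow_of_nonneg _ _ (by positivity)]
    exact ENNReal.rpow_le_rpow (lintegral_im_cauchyInt_le hr ha hab hf0 hf ht) (by positivity)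
  have hc : Continuous F := (continuous_cauchyInt_pt hp hp' hfL ht).const_mul 2
  have h1 : eLpNorm (fun x => cauchyInt (fun y => (f y : ℂ)) (pt t x)) p volume ≤
      eLpNorm F p volume := by
    refine eLpNorm_mono fun x => ?_
    rw [hF]; simp only [norm_mul]
    norm_num
    linarith [norm_nonneg (cauchyInt (fun y => (f y : ℂ)) (pt t x))]
  have h2 : F = (fun x => ((F x).re : ℂ)) + fun x => ((F x).im : ℂ) * Complex.I := by
    ext x; simp [Complex.re_add_im]
  have h3 : eLpNorm (fun x => ((F x).re : ℂ)) p volume = eLpNorm (fun x => (F x).re) p volume :=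
    eLpNorm_congr_norm_ae (ae_of_all _ fun x => by simp)
  have h4 : eLpNorm (fun x => ((F x).im : ℂ) * Complex.I) p volume =
      eLpNorm (fun x => (F x).im) p volume :=
    eLpNorm_congr_norm_ae (ae_of_all _ fun x => by simp)
  refine h1.trans ?_
  rw [h2]
  refine (eLpNorm_add_le (by fun_prop) (by fun_prop) hp.le).trans ?_
  rw [h3, h4]
  refine (add_le_add hReF hImF).trans_eq ?_
  rw [ENNReal.coe_add, ENNReal.coe_one, add_mul, one_mul,
    ENNReal.coe_rpow_of_nonneg _ (by positivity)]
  rfl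

/-- Decompose f into the positive and negative parts of Re f and Im f. Each is dominated by |f|, so
the constant is multiplied by 4. -/
theorem exists_eLpNorm_cauchyInt_le_of_isNice {p : ℝ≥0∞} (hp : 1 < p) (hp2 : p ≤ 2) :
    ∃ M : NNReal, ∀ t : ℝ, 0 < t → ∀ f : ℝ → ℂ, IsNice f →
      eLpNorm (fun x => cauchyInt f (pt t x)) p volume ≤ M * eLpNorm f p volume := by
  have hp' : p ≠ ⊤ := (hp2.trans_lt (by simp)).ne
  obtain ⟨M, hM⟩ := exists_eLpNorm_cauchyInt_le_of_nonneg hp hp2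
  refine ⟨4 * M, fun t ht f hf => ?_⟩
  have part : ∀ φ : ℂ → ℝ, Continuous φ → (∀ w, 0 ≤ φ w) → (∀ w, φ w ≤ ‖w‖) →
      IsNice (fun x => (φ (f x) : ℂ)) ∧
      eLpNorm (fun x => cauchyInt (fun y => (φ (f y) : ℂ)) (pt t x)) p volume ≤
        M * eLpNorm f p volume := by
    intro φ hφ hφ0 hφ1
    have hn : IsNice (fun x => (φ (f x) : ℂ)) := by
      obtain ⟨B, hB⟩ := hf.bdd
      obtain ⟨R, hR⟩ := hf.supp
      refine ⟨?_, ⟨B, fun x => ?_⟩, ⟨R, fun x hx => ?_⟩⟩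
      · exact (Complex.continuous_ofReal.comp hφ).comp_aestronglyMeasurable hf.meas
      · rw [Complex.norm_real, Real.norm_of_nonneg (hφ0 _)]
        exact (hφ1 _).trans (hB x)
      · have := hφ1 (f x)
        rw [hR x hx, norm_zero] at this
        rw [hR x hx, le_antisymm this (hφ0 0), Complex.ofReal_zero]
    refine ⟨hn, (hM t ht _ (fun x => hφ0 _) hn).trans ?_⟩
    gcongr
    refine eLpNorm_mono fun x => ?_
    rw [Complex.norm_real, Real.norm_of_nonneg (hφ0 _)]
    exact hφ1 _
  obtain ⟨n1, b1⟩ := part (fun w => max w.re 0) (by fun_prop) (fun w => le_max_right _ _)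
    (fun w => max_le ((le_abs_self _).trans (Complex.abs_re_le_norm w)) (norm_nonneg _))
  obtain ⟨n2, b2⟩ := part (fun w => max (-w.re) 0) (by fun_prop) (fun w => le_max_right _ _)
    (fun w => max_le ((neg_le_abs _).trans (Complex.abs_re_le_norm w)) (norm_nonneg _))
  obtain ⟨n3, b3⟩ := part (fun w => max w.im 0) (by fun_prop) (fun w => le_max_right _ _)
    (fun w => max_le ((le_abs_self _).trans (Complex.abs_im_le_norm w)) (norm_nonneg _))
  obtain ⟨n4, b4⟩ := part (fun w => max (-w.im) 0) (by fun_prop) (fun w => le_max_right _ _)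
    (fun w => max_le ((neg_le_abs _).trans (Complex.abs_im_le_norm w)) (norm_nonneg _))
  set f1 : ℝ → ℂ := fun y => ((max (f y).re 0 : ℝ) : ℂ)
  set f2 : ℝ → ℂ := fun y => ((max (-(f y).re) 0 : ℝ) : ℂ)
  set f3 : ℝ → ℂ := fun y => ((max (f y).im 0 : ℝ) : ℂ)
  set f4 : ℝ → ℂ := fun y => ((max (-(f y).im) 0 : ℝ) : ℂ)
  have l1 := n1.memLp hp hp'
  have l2 := n2.memLp hp hp'
  have l3 := n3.memLp hp hp'
  have l4 := n4.memLp hp hp'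
  have hmax : ∀ u : ℝ, max u 0 - max (-u) 0 = u := fun u => by
    rcases le_total 0 u with h | h
    · rw [max_eq_left h, max_eq_right (by linarith), sub_zero]
    · rw [max_eq_right h, max_eq_left (by linarith)]; ring
  have hf_eq : f = (f1 + (-1 : ℂ) • f2) + Complex.I • (f3 + (-1 : ℂ) • f4) := by
    ext y
    simp only [f1, f2, f3, f4, Pi.add_apply, Pi.smul_apply, smul_eq_mul]
    have h1 := hmax (f y).re
    have h2 := hmax (f y).im
    rw [← sub_eq_zero] at h1 h2
    conv_lhs => rw [← Complex.re_add_im (f y)]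
    rw [← hmax (f y).re, ← hmax (f y).im]
    push_cast
    simp only [hmax]
    ring
  have hC : (fun x => cauchyInt f (pt t x)) =
      ((fun x => cauchyInt f1 (pt t x)) + (-1 : ℂ) • fun x => cauchyInt f2 (pt t x)) +
      Complex.I • ((fun x => cauchyInt f3 (pt t x)) + (-1 : ℂ) • fun x => cauchyInt f4 (pt t x)) := by
    ext x
    have hz : 0 < (pt t x).im := by simpa using ht
    rw [hf_eq, cauchyInt_add hp hp' (l1.add (l2.const_smul _)) ((l3.add (l4.const_smul _)).const_smul _) hz,
      cauchyInt_smul, cauchyInt_add hp hp' l1 (l2.const_smul _) hz, cauchyInt_smul,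
      cauchyInt_add hp hp' l3 (l4.const_smul _) hz, cauchyInt_smul]
    simp only [Pi.add_apply, Pi.smul_apply, smul_eq_mul]
  have c1 := (continuous_cauchyInt_pt hp hp' l1 ht).aestronglyMeasurable (μ := volume)
  have c2 := (continuous_cauchyInt_pt hp hp' l2 ht).aestronglyMeasurable (μ := volume)
  have c3 := (continuous_cauchyInt_pt hp hp' l3 ht).aestronglyMeasurable (μ := volume)
  have c4 := (continuous_cauchyInt_pt hp hp' l4 ht).aestronglyMeasurable (μ := volume)
  rw [hC]
  refine (eLpNorm_add_le (c1.add (c2.const_smul _)) ((c3.add (c4.const_smul _)).const_smul _)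
    hp.le).trans ?_
  rw [eLpNorm_const_smul]
  refine (add_le_add (eLpNorm_add_le c1 (c2.const_smul _) hp.le) (mul_le_mul_right
    (eLpNorm_add_le c3 (c4.const_smul _) hp.le) _)).trans ?_
  rw [eLpNorm_const_smul, eLpNorm_const_smul]
  simp only [enorm_neg, enorm_one, one_mul]
  have hI : ‖Complex.I‖ₑ = 1 := by rw [← ofReal_norm, Complex.norm_I, ENNReal.ofReal_one]
  rw [hI, one_mul]
  refine (add_le_add (add_le_add b1 b2) (add_le_add b3 b4)).trans_eq ?_
  push_cast
  ring

/-- Bounds for Cauchy integrals of bounded functions with bounded support extend to `L_p`. -/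
theorem eLpNorm_cauchyInt_le_of_isNice {p : ℝ≥0∞} (hp : 1 < p) (hp' : p ≠ ⊤) {M : NNReal} {t : ℝ}
    (ht : 0 < t) (hM : ∀ f : ℝ → ℂ, IsNice f →
      eLpNorm (fun x => cauchyInt f (pt t x)) p volume ≤ M * eLpNorm f p volume)
    {f : ℝ → ℂ} (hf : MemLp f p volume) :
    eLpNorm (fun x => cauchyInt f (pt t x)) p volume ≤ M * eLpNorm f p volume := by
  -- A strongly measurable representative, so that the truncation sets {|x| ≤ n, |g| ≤ n} are
  -- measurable. The truncations converge to g everywhere, their Cauchy integrals converge by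
  -- domination, and Fatou's lemma preserves the constant.
  set g := hf.1.mk f with hg
  have hgm : StronglyMeasurable g := hf.1.stronglyMeasurable_mk
  have hfg : f =ᵐ[volume] g := hf.1.ae_eq_mk
  have hgL : MemLp g p volume := hf.ae_eq hfg
  simp_rw [cauchyInt_congr_ae hfg]
  rw [eLpNorm_congr_ae hfg]
  set S : ℕ → Set ℝ := fun n => {x | |x| ≤ n ∧ ‖g x‖ ≤ n} with hS
  have hSm : ∀ n, MeasurableSet (S n) := fun n =>
    (measurableSet_le measurable_norm measurable_const).inter
      (measurableSet_le hgm.norm.measurable measurable_const)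
  set gn : ℕ → ℝ → ℂ := fun n => (S n).indicator g with hgn
  have hnice : ∀ n, IsNice (gn n) := fun n => by
    refine ⟨(hgm.indicator (hSm n)).aestronglyMeasurable, ⟨n, fun x => ?_⟩, ⟨n, fun x hx => ?_⟩⟩
    · by_cases h : x ∈ S n
      · simp only [hgn, Set.indicator_of_mem h]; exact h.2
      · simp [hgn, Set.indicator_of_notMem h]
    · exact Set.indicator_of_notMem (fun h => (not_le.2 hx) h.1) _
  have hle : ∀ n x, ‖gn n x‖ ≤ ‖g x‖ := fun n x => norm_indicator_le_norm_self _ _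
  have hlim : ∀ x, Tendsto (fun n => gn n x) atTop (𝓝 (g x)) := fun x => by
    refine tendsto_const_nhds.congr' ?_
    obtain ⟨N, hN⟩ := exists_nat_ge (max |x| ‖g x‖)
    filter_upwards [eventually_ge_atTop N] with n hn
    have hn' : (N : ℝ) ≤ n := by exact_mod_cast hn
    exact (Set.indicator_of_mem (show x ∈ S n from
      ⟨(le_max_left _ _).trans (hN.trans hn'), (le_max_right _ _).trans (hN.trans hn')⟩) _).symm
  have hlimC : ∀ x, Tendsto (fun n => cauchyInt (gn n) (pt t x)) atTop
      (𝓝 (cauchyInt g (pt t x))) := fun x => by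
    have hz : 0 < (pt t x).im := by simpa using ht
    refine tendsto_integral_of_dominated_convergence
      (fun y => ‖cauchyKer (pt t x - y) * g y‖) (fun n => ?_)
      (integrable_cauchyKer_mul hp hp' hgL hz).norm (fun n => ae_of_all _ fun y => ?_)
      (ae_of_all _ fun y => (hlim y).const_mul _)
    · exact (measurable_cauchyKer_sub _).aestronglyMeasurable.mul (hnice n).meas
    · rw [norm_mul, norm_mul]
      gcongr
      exact hle n y
  refine (Lp.eLpNorm_lim_le_liminf_eLpNorm (f := fun n x => cauchyInt (gn n) (pt t x))
    (fun n => ((continuous_cauchyInt_pt hp hp' ((hnice n).memLp hp hp') ht).aestronglyMeasurable))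
    _ (ae_of_all _ hlimC)).trans ?_
  refine liminf_le_of_frequently_le' (Eventually.frequently (Eventually.of_forall fun n => ?_))
  refine (hM _ (hnice n)).trans ?_
  gcongr
  exact eLpNorm_mono (hle n)

/-- Test h = C f with its extremal dual function g = h|h|^{r-2}. With N = ∫|h|^r = ∫|g|^s one gets N
= ⟨g, C f⟩ = ⟨C g, f⟩ ≤ M N^{1/s} ‖f‖_p, and division by N^{1/s} leaves N^{1/r} ≤ M ‖f‖_p. -/
theorem eLpNorm_cauchyInt_le_of_dual {p q : ℝ≥0∞} (hp : 1 < p) (hp' : p ≠ ⊤) (hq : 1 < q)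
    (hq' : q ≠ ⊤) (hpq : p.HolderConjugate q) {M : NNReal} {t : ℝ} (ht : 0 < t)
    (hM : ∀ g : ℝ → ℂ, MemLp g q volume →
      eLpNorm (fun x => cauchyInt g (pt t x)) q volume ≤ M * eLpNorm g q volume)
    {f : ℝ → ℂ} (hf : IsNice f) :
    eLpNorm (fun x => cauchyInt f (pt t x)) p volume ≤ M * eLpNorm f p volume := by
  set r := p.toReal with hr_def
  set s := q.toReal with hs_def
  have hr : 1 < r := one_lt_toReal hp hp'
  have hs : 1 < s := one_lt_toReal hq hq'
  have hp0 : p ≠ 0 := (zero_lt_one.trans hp).ne'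
  have hq0 : q ≠ 0 := (zero_lt_one.trans hq).ne'
  have hrs : r.HolderConjugate s := by
    rw [Real.holderConjugate_iff]
    refine ⟨hr, ?_⟩
    have h := (ENNReal.holderConjugate_iff).1 hpq
    have h2 := congrArg ENNReal.toReal h
    rwa [ENNReal.toReal_add (by simp [hp0]) (by simp [hq0]), ENNReal.toReal_inv, ENNReal.toReal_inv,
      ENNReal.toReal_one] at h2
  set h : ℝ → ℂ := fun x => cauchyInt f (pt t x) with hh
  have hhL : MemLp h p volume := hf.memLp_cauchyInt ht hp hp'
  have hhc : Continuous h := continuous_cauchyInt_pt hp hp' (hf.memLp hp hp') ht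
  set g : ℝ → ℂ := fun x => h x * ((‖h x‖ ^ (r - 2) : ℝ) : ℂ) with hg
  have hgm : AEStronglyMeasurable g volume := by
    have := hhc.measurable
    exact (by fun_prop : Measurable g).aestronglyMeasurable
  set N := ∫⁻ x, ‖h x‖ₑ ^ r with hN
  -- Qualitative finiteness, known because f is nice, is what permits the final division by N^{1/s}.
  have hNtop : N ≠ ⊤ := (lintegral_rpow_enorm_lt_top_of_eLpNorm_lt_top hp0 hp' hhL.2).ne
  have hgn : ∀ x, ‖g x‖ = ‖h x‖ ^ (r - 1) := fun x => by
    rw [hg]; simp only [norm_mul, Complex.norm_real]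
    rw [Real.norm_of_nonneg (by positivity)]
    rcases eq_or_lt_of_le (norm_nonneg (h x)) with h0 | h0
    · rw [← h0, zero_mul, Real.zero_rpow (by linarith)]
    · rw [show r - 1 = 1 + (r - 2) by ring, Real.rpow_add h0, Real.rpow_one]
  have hgN : ∫⁻ x, ‖g x‖ₑ ^ s = N := by
    refine lintegral_congr fun x => ?_
    rw [← ofReal_norm, ← ofReal_norm, hgn,
      ENNReal.ofReal_rpow_of_nonneg (by positivity) (by linarith),
      ENNReal.ofReal_rpow_of_nonneg (by positivity) (by linarith), ← Real.rpow_mul (norm_nonneg _),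
      hrs.sub_one_mul_conj]
  have hgq : eLpNorm g q volume = N ^ (1 / s) := by
    rw [eLpNorm_eq_lintegral_rpow_enorm_toReal hq0 hq', hgN]
  have hhp : eLpNorm h p volume = N ^ (1 / r) := by
    rw [eLpNorm_eq_lintegral_rpow_enorm_toReal hp0 hp']
  have hgL : MemLp g q volume :=
    ⟨hgm, by rw [hgq]; exact (ENNReal.rpow_ne_top_of_nonneg (by positivity) hNtop).lt_top⟩
  have hpair := hf.integral_conj_cauchyInt_mul hq hq' hgL ht
  have hri : Integrable (fun x => ‖h x‖ ^ r) volume := hhL.integrable_norm_rpow hp0 hp'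
  have h1 : ∫ x, (starRingEnd ℂ) (g x) * h x = ((∫ x, ‖h x‖ ^ r : ℝ) : ℂ) := by
    rw [← integral_complex_ofReal]
    refine integral_congr_ae (ae_of_all _ fun x => ?_)
    simp only [hg, map_mul, Complex.conj_ofReal]
    rw [mul_assoc, mul_left_comm, mul_comm ((starRingEnd ℂ) (h x)), ← mul_assoc, mul_assoc,
      Complex.mul_conj, Complex.normSq_eq_norm_sq, ← Complex.ofReal_mul]
    congr 1
    rcases eq_or_lt_of_le (norm_nonneg (h x)) with h0 | h0
    · rw [← h0, Real.zero_rpow (show r ≠ 0 by linarith)]; ring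
    · rw [← Real.rpow_natCast, ← Real.rpow_add h0]; congr 1; push_cast; ring
  have h2 : N = ‖∫ x, (starRingEnd ℂ) (g x) * h x‖ₑ := by
    rw [h1, ← ofReal_norm, Complex.norm_real, Real.norm_of_nonneg
      (integral_nonneg fun x => by positivity),
      ofReal_integral_eq_lintegral_ofReal hri (ae_of_all _ fun x => by positivity)]
    refine lintegral_congr fun x => ?_
    rw [← ofReal_norm, ENNReal.ofReal_rpow_of_nonneg (norm_nonneg _) (by linarith)]
  have hCg : AEStronglyMeasurable (fun x => cauchyInt g (pt t x)) volume :=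
    (continuous_cauchyInt_pt hq hq' hgL ht).aestronglyMeasurable
  have h3 : N ≤ eLpNorm f p volume * (M * N ^ (1 / s)) := by
    calc N = ‖∫ x, (starRingEnd ℂ) (cauchyInt g (pt t x)) * f x‖ₑ := by rw [hpair, ← h2]
      _ ≤ ∫⁻ x, ‖(starRingEnd ℂ) (cauchyInt g (pt t x)) * f x‖ₑ := enorm_integral_le_lintegral_enorm _
      _ = ∫⁻ x, ((fun x => ‖f x‖ₑ) * fun x => ‖cauchyInt g (pt t x)‖ₑ) x := by
          refine lintegral_congr fun x => ?_
          rw [enorm_mul, mul_comm, Pi.mul_apply, ← ofReal_norm ((starRingEnd ℂ) _),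
            RCLike.norm_conj, ofReal_norm]
      _ ≤ (∫⁻ x, ‖f x‖ₑ ^ r) ^ (1 / r) * (∫⁻ x, ‖cauchyInt g (pt t x)‖ₑ ^ s) ^ (1 / s) :=
          ENNReal.lintegral_mul_le_Lp_mul_Lq _ hrs hf.meas.enorm hCg.enorm
      _ = eLpNorm f p volume * eLpNorm (fun x => cauchyInt g (pt t x)) q volume := by
          rw [eLpNorm_eq_lintegral_rpow_enorm_toReal hp0 hp',
            eLpNorm_eq_lintegral_rpow_enorm_toReal hq0 hq']
      _ ≤ _ := by
          gcongr
          exact (hM g hgL).trans_eq (by rw [hgq])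
  rw [hhp]
  by_cases hN0 : N = 0
  · rw [hN0, ENNReal.zero_rpow_of_pos (by positivity)]; exact zero_le
  have h4 : N = N ^ (1 / r) * N ^ (1 / s) := by
    rw [← ENNReal.rpow_add _ _ hN0 hNtop, one_div, one_div, hrs.inv_add_inv_eq_one, ENNReal.rpow_one]
  have h5 : N ^ (1 / s) ≠ 0 := by
    rw [Ne, ENNReal.rpow_eq_zero_iff]; simp [hN0, hNtop]
  have h6 : N ^ (1 / s) ≠ ⊤ := ENNReal.rpow_ne_top_of_nonneg (by positivity) hNtop
  refine (ENNReal.mul_le_mul_iff_left h5 h6).1 ?_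
  rw [← h4]
  exact h3.trans_eq (by ring)

/-- **M. Riesz' theorem** for the Cauchy integral, uniformly in the height. -/
theorem exists_eLpNorm_cauchyInt_le {p : ℝ≥0∞} (hp : 1 < p) (hp' : p ≠ ⊤) :
    ∃ M : NNReal, ∀ t : ℝ, 0 < t → ∀ f : ℝ → ℂ, MemLp f p volume →
      eLpNorm (fun x => cauchyInt f (pt t x)) p volume ≤ M * eLpNorm f p volume := by
  rcases le_total p 2 with h2 | h2
  · obtain ⟨M, hM⟩ := exists_eLpNorm_cauchyInt_le_of_isNice hp h2
    exact ⟨M, fun t ht f hf => eLpNorm_cauchyInt_le_of_isNice hp hp' ht (hM t ht) hf⟩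
  · obtain ⟨q, hpq, hq, hq'⟩ := exists_holderConjugate hp hp'
    have hq2 : q ≤ 2 := by
      have h := (ENNReal.holderConjugate_iff).1 hpq
      have h1 : p⁻¹ ≤ 2⁻¹ := ENNReal.inv_le_inv.2 h2
      rw [← ENNReal.inv_le_inv]
      by_contra hlt
      have h3 : p⁻¹ + q⁻¹ < 2⁻¹ + 2⁻¹ := ENNReal.add_lt_add_of_le_of_lt
        (ne_top_of_le_ne_top (by simp) h1) h1 (not_le.1 hlt)
      rw [h, ENNReal.inv_two_add_inv_two] at h3
      exact lt_irrefl _ h3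
    obtain ⟨M, hM⟩ := exists_eLpNorm_cauchyInt_le_of_isNice hq hq2
    refine ⟨M, fun t ht f hf => eLpNorm_cauchyInt_le_of_isNice hp hp' ht (fun f hf => ?_) hf⟩
    exact eLpNorm_cauchyInt_le_of_dual hp hp' hq hq' hpq ht
      (fun g hg => eLpNorm_cauchyInt_le_of_isNice hq hq' ht (hM t ht) hg) hf


/-! ### Convergence of Poisson integrals at Lebesgue points -/

theorem integrable_poissonKer_mul {p : ℝ≥0∞} (hp : 1 < p) (hp' : p ≠ ⊤) {f : ℝ → ℂ}
    (hf : MemLp f p volume) {t : ℝ} (ht : 0 < t) (x : ℝ) :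
    Integrable (fun y => (poissonKer t (x - y) : ℂ) * f y) volume := by
  have hz : 0 < (pt t x).im := by simpa using ht
  have h1 := integrable_cauchyKer_mul hp hp' hf hz
  have h2 := integrable_mul_of_decay (k := fun y : ℝ => (starRingEnd ℂ) (cauchyKer (pt t x - y)))
    (Complex.continuous_conj.measurable.comp (measurable_cauchyKer_sub _)).aestronglyMeasurable
    (fun y => by rw [RCLike.norm_conj]; exact norm_cauchyKer_sub_le hz le_rfl le_rfl y) hp hp' hf
  refine (h1.add h2).congr (ae_of_all _ fun y => ?_)
  simp only [Pi.add_apply]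
  rw [pt_sub, poissonKer_eq]
  ring

theorem poissonInt_eq {p : ℝ≥0∞} (hp : 1 < p) (hp' : p ≠ ⊤) {f : ℝ → ℂ}
    (hf : MemLp f p volume) {t : ℝ} (ht : 0 < t) (x : ℝ) :
    poissonInt t f x = cauchyInt f (pt t x) +
      (starRingEnd ℂ) (cauchyInt (fun y => (starRingEnd ℂ) (f y)) (pt t x)) := by
  have hz : 0 < (pt t x).im := by simpa using ht
  have h1 := integrable_cauchyKer_mul hp hp' hf hz
  have h2 := integrable_mul_of_decay (k := fun y : ℝ => (starRingEnd ℂ) (cauchyKer (pt t x - y)))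
    (Complex.continuous_conj.measurable.comp (measurable_cauchyKer_sub _)).aestronglyMeasurable
    (fun y => by rw [RCLike.norm_conj]; exact norm_cauchyKer_sub_le hz le_rfl le_rfl y) hp hp' hf
  have h3 : (starRingEnd ℂ) (cauchyInt (fun y => (starRingEnd ℂ) (f y)) (pt t x)) =
      ∫ y : ℝ, (starRingEnd ℂ) (cauchyKer (pt t x - y)) * f y := by
    rw [cauchyInt, ← integral_conj]
    refine integral_congr_ae (ae_of_all _ fun y => ?_)
    simp
  rw [h3, cauchyInt, ← integral_add h1 h2, poissonInt]
  refine integral_congr_ae (ae_of_all _ fun y => ?_)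
  simp only
  rw [pt_sub, poissonKer_eq]
  ring

theorem continuous_poissonInt {p : ℝ≥0∞} (hp : 1 < p) (hp' : p ≠ ⊤) {f : ℝ → ℂ}
    (hf : MemLp f p volume) {t : ℝ} (ht : 0 < t) : Continuous (poissonInt t f) := by
  have h : poissonInt t f = fun x => cauchyInt f (pt t x) +
      (starRingEnd ℂ) (cauchyInt (fun y => (starRingEnd ℂ) (f y)) (pt t x)) :=
    funext fun x => poissonInt_eq hp hp' hf ht x
  rw [h]
  exact (continuous_cauchyInt_pt hp hp' hf ht).add
    (Complex.continuous_conj.comp (continuous_cauchyInt_pt hp hp' hf.star ht))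

/-- Layer-cake formula: the superlevel sets of the kernel are balls about x, possibly empty, so the
kernel is a superposition of such balls, of total mass 1. -/
theorem lintegral_poissonKer_mul_le_of_ball {t : ℝ} (ht : 0 < t) {x : ℝ} {ε : ℝ≥0∞}
    {h : ℝ → ℝ≥0∞} (hh : AEMeasurable h volume)
    (hball : ∀ r : ℝ, 0 < r → ∫⁻ y in Metric.ball x r, h y ≤ ε * volume (Metric.ball x r)) :
    ∫⁻ y, ENNReal.ofReal (poissonKer t (x - y)) * h y ≤ ε := by
  have hm : Measurable fun y => poissonKer t (x - y) := (measurable_poissonKer t).comp (by fun_prop)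
  have hset : ∀ s : ℝ, 0 < s → {y | s < poissonKer t (x - y)} =
      Metric.ball x (Real.sqrt (t / (Real.pi * s) - t ^ 2)) := by
    intro s hs
    ext y
    simp only [Set.mem_ofPred_eq, Metric.mem_ball, Real.dist_eq]
    rw [Real.lt_sqrt (abs_nonneg _), sq_abs, poissonKer, lt_div_iff₀ (by positivity),
      lt_sub_iff_add_lt, lt_div_iff₀ (by positivity)]
    constructor <;> intro h <;> nlinarith
  have hballle : ∀ s : ℝ, 0 < s → (volume.withDensity h) {y | s < poissonKer t (x - y)} ≤
      ε * volume {y | s < poissonKer t (x - y)} := by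
    intro s hs
    rw [hset s hs]
    rcases eq_or_lt_of_le (Real.sqrt_nonneg (t / (Real.pi * s) - t ^ 2)) with h0 | h0
    · rw [← h0]; simp
    · rw [withDensity_apply _ Metric.isOpen_ball.measurableSet]
      exact hball _ h0
  have hpos : ∀ (μ : Measure ℝ), 0 ≤ᵐ[μ] fun y => poissonKer t (x - y) :=
    fun μ => ae_of_all _ fun y => (poissonKer_pos ht _).le
  calc ∫⁻ y, ENNReal.ofReal (poissonKer t (x - y)) * h y
      = ∫⁻ y, ENNReal.ofReal (poissonKer t (x - y)) ∂(volume.withDensity h) := by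
        rw [lintegral_withDensity_eq_lintegral_mul₀ hh hm.ennreal_ofReal.aemeasurable]
        exact lintegral_congr fun y => mul_comm _ _
    _ = ∫⁻ s in Set.Ioi 0, (volume.withDensity h) {y | s < poissonKer t (x - y)} :=
        lintegral_eq_lintegral_meas_lt _ (hpos _) hm.aemeasurable
    _ ≤ ∫⁻ s in Set.Ioi (0 : ℝ), ε * volume {y | s < poissonKer t (x - y)} :=
        setLIntegral_mono' measurableSet_Ioi fun s hs => hballle s hs
    _ ≤ ε * ∫⁻ s in Set.Ioi (0 : ℝ), volume {y | s < poissonKer t (x - y)} := by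
        rw [lintegral_const_mul'']
        refine Measurable.aemeasurable ?_
        refine Antitone.measurable fun a b hab => measure_mono fun y (hy : b < _) => hab.trans_lt hy
    _ = ε := by
        rw [← lintegral_eq_lintegral_meas_lt _ (hpos _) hm.aemeasurable, lintegral_poissonKer ht,
          mul_one]

/-- This holds at every Lebesgue point. Within distance δ all averages of the oscillation over balls
are small, which controls any Poisson average; outside, the kernel at height t is at most t times a
constant multiple of the kernel at height 1, against which the oscillation is integrable. -/
theorem ae_tendsto_lintegral_poissonKer {p : ℝ≥0∞} (hp : 1 < p) (hp' : p ≠ ⊤) {f : ℝ → ℂ}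
    (hf : MemLp f p volume) : ∀ᵐ x : ℝ, Tendsto (fun t : ℝ =>
      ∫⁻ y, ENNReal.ofReal (poissonKer t (x - y)) * ‖f y - f x‖ₑ) (𝓝[>] 0) (𝓝 0) := by
  filter_upwards [IsUnifLocDoublingMeasure.ae_tendsto_average_norm_sub (volume : Measure ℝ)
    (hf.locallyIntegrable hp.le) 1] with x hx
  have hx1 := hx (l := 𝓝[>] (0 : ℝ)) (fun _ => x) (fun r => r) tendsto_id (by
    filter_upwards [self_mem_nhdsWithin] with r hr
    simpa using (Set.mem_Ioi.1 hr).le)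
  have hmeas : AEMeasurable (fun y => ‖f y - f x‖ₑ) volume :=
    (hf.1.sub aestronglyMeasurable_const).enorm
  rw [ENNReal.tendsto_nhds_zero]
  intro ε hε
  wlog hεtop : ε ≠ ⊤ generalizing ε
  · simp only [not_not.1 hεtop, le_top, Eventually.of_forall, implies_true]
  obtain ⟨e, rfl⟩ : ∃ e : ℝ, ε = ENNReal.ofReal e := ⟨ε.toReal, (ENNReal.ofReal_toReal hεtop).symm⟩
  have he : 0 < e := by simpa using hε
  have h1 : ∀ᶠ r in 𝓝[>] (0 : ℝ), ⨍ y in Metric.closedBall x r, ‖f y - f x‖ < e / 2 :=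
    hx1.eventually_lt_const (by linarith)
  obtain ⟨δ, hδ0, hδ⟩ := mem_nhdsGT_iff_exists_Ioc_subset.1 h1
  have hδ0 : 0 < δ := hδ0
  have hsmall : ∀ r : ℝ, 0 < r → r ≤ δ → ∫⁻ y in Metric.closedBall x r, ‖f y - f x‖ₑ ≤
      ENNReal.ofReal (e / 2) * volume (Metric.ball x r) := by
    intro r hr hrδ
    have h2 : ⨍ y in Metric.closedBall x r, ‖f y - f x‖ < e / 2 := hδ ⟨hr, hrδ⟩
    have h4 : IntegrableOn (fun y => ‖f y - f x‖) (Metric.closedBall x r) volume :=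
      (((hf.locallyIntegrable hp.le).integrableOn_isCompact (isCompact_closedBall x r)).sub
        ((locallyIntegrable_const (f x)).integrableOn_isCompact (isCompact_closedBall x r))).norm
    have h3 : ∫ y in Metric.closedBall x r, ‖f y - f x‖ ≤ e / 2 * (2 * r) := by
      rw [setAverage_eq, smul_eq_mul, Measure.real, Real.volume_closedBall,
        ENNReal.toReal_ofReal (by positivity), inv_mul_lt_iff₀ (by positivity)] at h2
      linarith
    have h5 : ∫⁻ y in Metric.closedBall x r, ‖f y - f x‖ₑ =
        ENNReal.ofReal (∫ y in Metric.closedBall x r, ‖f y - f x‖) := by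
      rw [ofReal_integral_eq_lintegral_ofReal h4 (ae_of_all _ fun y => norm_nonneg _)]
      exact lintegral_congr fun y => (ofReal_norm _).symm
    rw [h5, Real.volume_ball, ← ENNReal.ofReal_mul (by positivity)]
    exact ENNReal.ofReal_le_ofReal h3
  -- Chosen so that 1 + u² ≤ c u² for |u| ≥ δ, which compares the kernels at heights t and 1.
  set c : ℝ := 1 + (δ ^ 2)⁻¹ with hc
  set A := ∫⁻ y, ENNReal.ofReal (poissonKer 1 (x - y)) * ‖f y - f x‖ₑ with hA
  have hAtop : A ≠ ⊤ := by
    have h2 : Integrable (fun y => (poissonKer 1 (x - y) : ℂ) * (f y - f x)) volume := by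
      have := (integrable_poissonKer_mul hp hp' hf one_pos x).sub
        ((integrable_poissonKer one_pos x).ofReal (𝕜 := ℂ) |>.mul_const (f x))
      refine this.congr (ae_of_all _ fun y => ?_)
      simp only [Pi.sub_apply]
      rw [mul_sub]
      rfl
    refine ne_top_of_le_ne_top h2.2.ne (lintegral_mono fun y => ?_)
    rw [enorm_mul, ← ofReal_norm (Complex.ofReal _), Complex.norm_real,
      Real.norm_of_nonneg (poissonKer_pos one_pos _).le]
  have hnear : ∀ t : ℝ, 0 < t → ∫⁻ y, ENNReal.ofReal (poissonKer t (x - y)) *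
      (Metric.ball x δ).indicator (fun y => ‖f y - f x‖ₑ) y ≤ ENNReal.ofReal (e / 2) := by
    intro t ht
    refine lintegral_poissonKer_mul_le_of_ball ht
      (hmeas.indicator Metric.isOpen_ball.measurableSet) fun r hr => ?_
    rw [setLIntegral_indicator Metric.isOpen_ball.measurableSet]
    rcases le_total r δ with h | h
    · exact (lintegral_mono_set (Set.inter_subset_right.trans Metric.ball_subset_closedBall)).trans
        (hsmall r hr h)
    · refine (lintegral_mono_set (Set.inter_subset_left.trans Metric.ball_subset_closedBall)).trans
        ((hsmall δ hδ0 le_rfl).trans ?_)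
      gcongr
  have hfar : ∀ t : ℝ, 0 < t → ∀ y, ENNReal.ofReal (poissonKer t (x - y)) * ‖f y - f x‖ₑ ≤
      ENNReal.ofReal (poissonKer t (x - y)) *
        (Metric.ball x δ).indicator (fun y => ‖f y - f x‖ₑ) y +
      ENNReal.ofReal (t * c) * (ENNReal.ofReal (poissonKer 1 (x - y)) * ‖f y - f x‖ₑ) := by
    intro t ht y
    by_cases hy : y ∈ Metric.ball x δ
    · rw [Set.indicator_of_mem hy]; exact le_self_add
    · refine le_add_of_nonneg_of_le zero_le ?_
      rw [← mul_assoc, ← ENNReal.ofReal_mul (by positivity)]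
      gcongr
      rw [Metric.mem_ball, Real.dist_eq, not_lt, abs_sub_comm] at hy
      have h2 : δ ^ 2 ≤ (x - y) ^ 2 := by rw [← sq_abs (x - y)]; gcongr
      have h3 : 0 < δ ^ 2 := by positivity
      have h4 : 1 ≤ (δ ^ 2)⁻¹ * (x - y) ^ 2 := by
        rw [← div_eq_inv_mul, one_le_div h3]; exact h2
      unfold poissonKer
      rw [mul_div_assoc', mul_one, div_le_div_iff₀ (by positivity) (by positivity)]
      have h5 : 1 ^ 2 + (x - y) ^ 2 ≤ c * (t ^ 2 + (x - y) ^ 2) := by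
        rw [hc]
        have : 0 ≤ (δ ^ 2)⁻¹ * t ^ 2 := by positivity
        nlinarith [sq_nonneg t]
      have : 0 < t * Real.pi := by positivity
      nlinarith
  have hlim : Tendsto (fun t : ℝ => ENNReal.ofReal (t * c) * A) (𝓝[>] 0) (𝓝 0) := by
    have h2 : Tendsto (fun t : ℝ => ENNReal.ofReal (t * c)) (𝓝[>] 0) (𝓝 (ENNReal.ofReal (0 * c))) :=
      ENNReal.tendsto_ofReal ((tendsto_id.mul_const c).mono_left nhdsWithin_le_nhds)
    rw [zero_mul, ENNReal.ofReal_zero] at h2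
    have := ENNReal.Tendsto.mul_const h2 (Or.inr hAtop)
    rwa [zero_mul] at this
  have h6 : ∀ᶠ t : ℝ in 𝓝[>] 0, ENNReal.ofReal (t * c) * A ≤ ENNReal.ofReal (e / 2) :=
    (ENNReal.tendsto_nhds_zero.1 hlim) _ (by simpa using he)
  filter_upwards [h6, self_mem_nhdsWithin] with t ht1 ht2
  have ht2 : 0 < t := ht2
  have hm : Measurable fun y => ENNReal.ofReal (poissonKer 1 (x - y)) :=
    ((measurable_poissonKer 1).comp (by fun_prop)).ennreal_ofReal
  calc _ ≤ _ := lintegral_mono (hfar t ht2)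
    _ = _ := lintegral_add_right' _ (AEMeasurable.const_mul (hm.aemeasurable.mul hmeas) _)
    _ ≤ ENNReal.ofReal (e / 2) + ENNReal.ofReal (e / 2) := by
        refine add_le_add (hnear t ht2) ?_
        have hmm : AEMeasurable (fun y => ENNReal.ofReal (poissonKer 1 (x - y)) * ‖f y - f x‖ₑ)
          volume := hm.aemeasurable.mul hmeas
        rw [lintegral_const_mul'' _ hmm]
        exact ht1
    _ = ENNReal.ofReal e := by rw [← ENNReal.ofReal_add (by positivity) (by positivity), add_halves]

/-- Integrals against kernels dominated by the Poisson kernel only see the oscillation. -/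
theorem enorm_integral_sub_le {f : ℝ → ℂ} {t : ℝ} (ht : 0 < t)
    {D : ℝ → ℂ} (hD : Measurable D) (hDle : ∀ u, ‖D u‖ ≤ poissonKer t u) (x : ℝ)
    (hint : Integrable (fun y => D (x - y) * f y) volume) :
    ‖(∫ y, D (x - y) * f y) - (∫ y, D y) * f x‖ₑ ≤
      ∫⁻ y, ENNReal.ofReal (poissonKer t (x - y)) * ‖f y - f x‖ₑ := by
  have h1 : Integrable (fun y => D (x - y)) volume :=
    (integrable_poissonKer ht x).mono' (hD.comp (by fun_prop)).aestronglyMeasurable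
      (ae_of_all _ fun y => hDle _)
  rw [← integral_sub_left_eq_self D volume x, ← integral_mul_const,
    ← integral_sub hint (h1.mul_const _)]
  refine (enorm_integral_le_lintegral_enorm _).trans (lintegral_mono fun y => ?_)
  rw [← mul_sub, enorm_mul, ← ofReal_norm (D _)]
  gcongr
  exact hDle _

theorem ae_tendsto_poissonInt {p : ℝ≥0∞} (hp : 1 < p) (hp' : p ≠ ⊤) {f : ℝ → ℂ}
    (hf : MemLp f p volume) :
    ∀ᵐ x : ℝ, Tendsto (fun t : ℝ => poissonInt t f x) (𝓝[>] 0) (𝓝 (f x)) := by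
  filter_upwards [ae_tendsto_lintegral_poissonKer hp hp' hf] with x hx
  rw [tendsto_iff_edist_tendsto_0]
  refine tendsto_of_tendsto_of_tendsto_of_le_of_le' tendsto_const_nhds hx
    (Eventually.of_forall fun _ => zero_le) ?_
  filter_upwards [self_mem_nhdsWithin] with t ht
  have ht : 0 < t := ht
  have h := enorm_integral_sub_le ht (D := fun u => (poissonKer t u : ℂ))
    (Complex.measurable_ofReal.comp (measurable_poissonKer t))
    (fun u => by rw [Complex.norm_real, Real.norm_of_nonneg (poissonKer_pos ht _).le]) x
    (integrable_poissonKer_mul hp hp' hf ht x)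
  have h1 : ∫ y, (poissonKer t y : ℂ) = 1 := by
    rw [integral_complex_ofReal, ← integral_sub_left_eq_self (poissonKer t) volume 0,
      integral_poissonKer ht, Complex.ofReal_one]
  rw [h1, one_mul] at h
  rw [edist_eq_enorm_sub]
  exact h

/-- The kernel that compares the truncated and the conjugate Poisson kernel. -/
def truncDiff (ε u : ℝ) : ℝ :=
  ({u : ℝ | ε < |u|}.indicator (fun u => u⁻¹) u - u / (ε ^ 2 + u ^ 2)) / Real.pi

theorem measurable_truncDiff (ε : ℝ) : Measurable (truncDiff ε) := by
  unfold truncDiff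
  refine ((Measurable.indicator (by fun_prop) ?_).sub (by fun_prop)).div_const _
  exact measurableSet_lt measurable_const measurable_norm

/-- For |u| > ε the difference is ε²/(u(ε² + u²)) up to the factor 1/π, for |u| ≤ ε it is -u/(ε² +
u²); both are at most ε/(ε² + u²) in modulus. -/
theorem abs_truncDiff_le {ε : ℝ} (hε : 0 < ε) (u : ℝ) : |truncDiff ε u| ≤ poissonKer ε u := by
  unfold truncDiff poissonKer
  rw [abs_div, abs_of_pos Real.pi_pos, mul_comm Real.pi, ← div_div]
  gcongr
  have h0 : 0 < ε ^ 2 + u ^ 2 := by positivity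
  by_cases h : ε < |u|
  · rw [Set.indicator_of_mem (show u ∈ {u : ℝ | ε < |u|} from h)]
    have hu : u ≠ 0 := by intro h0; rw [h0, abs_zero] at h; linarith
    have h1 : u⁻¹ - u / (ε ^ 2 + u ^ 2) = ε ^ 2 / (u * (ε ^ 2 + u ^ 2)) := by field_simp; ring
    rw [h1, abs_div, abs_mul, abs_of_pos h0, ← div_div, abs_of_pos (by positivity)]
    gcongr
    rw [div_le_iff₀ (by positivity)]
    nlinarith
  · rw [Set.indicator_of_notMem (show u ∉ {u : ℝ | ε < |u|} from h), zero_sub, abs_neg, abs_div,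
      abs_of_pos h0]
    gcongr
    exact not_lt.1 h

theorem integral_truncDiff (ε : ℝ) : ∫ u, truncDiff ε u = 0 := by
  have h : ∀ u, truncDiff ε (-u) = -truncDiff ε u := by
    intro u
    unfold truncDiff
    have : ({u : ℝ | ε < |u|}.indicator (fun u => u⁻¹) (-u) : ℝ) =
        -({u : ℝ | ε < |u|}.indicator (fun u => u⁻¹) u) := by
      by_cases h : ε < |u|
      · rw [Set.indicator_of_mem (show u ∈ {u : ℝ | ε < |u|} from h),
          Set.indicator_of_mem (show -u ∈ {u : ℝ | ε < |u|} by simpa using h), inv_neg]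
      · rw [Set.indicator_of_notMem (show u ∉ {u : ℝ | ε < |u|} from h),
          Set.indicator_of_notMem (show -u ∉ {u : ℝ | ε < |u|} by simpa using h), neg_zero]
    rw [this]
    ring
  have h2 := integral_neg_eq_self (truncDiff ε) volume
  simp_rw [h, integral_neg] at h2
  linarith

theorem integrable_div_truncated {p : ℝ≥0∞} (hp : 1 < p) (hp' : p ≠ ⊤) {f : ℝ → ℂ}
    (hf : MemLp f p volume) {ε : ℝ} (hε : 0 < ε) (x : ℝ) :
    IntegrableOn (fun y : ℝ => f y / ((x - y : ℝ) : ℂ)) {y : ℝ | ε < |x - y|} volume := by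
  have hS : MeasurableSet {y : ℝ | ε < |x - y|} :=
    measurableSet_lt measurable_const (by fun_prop)
  rw [← integrable_indicator_iff hS]
  have := integrable_mul_of_decay (k := {y : ℝ | ε < |x - y|}.indicator
    fun y => (((x - y : ℝ) : ℂ))⁻¹) (B := (1 + |x|) / ε + 1)
    ((Measurable.indicator (by fun_prop) hS).aestronglyMeasurable) (fun y => ?_) hp hp' hf
  · refine this.congr (ae_of_all _ fun y => ?_)
    by_cases h : y ∈ {y : ℝ | ε < |x - y|}
    · simp only [Set.indicator_of_mem h]; rw [div_eq_mul_inv, mul_comm]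
    · simp only [Set.indicator_of_notMem h, zero_mul]
  · by_cases h : ε < |x - y|
    · rw [Set.indicator_of_mem (show y ∈ {y : ℝ | ε < |x - y|} from h), norm_inv,
        Complex.norm_real, Real.norm_eq_abs, ← div_eq_mul_inv, le_div_iff₀ (by positivity),
        inv_mul_le_iff₀ (hε.trans h)]
      have h1 : |y| ≤ |x| + |x - y| := by
        calc |y| = |x - (x - y)| := by ring_nf
          _ ≤ _ := abs_sub _ _
      have h2 : 1 + |x| ≤ (1 + |x|) / ε * |x - y| := by
        rw [div_mul_eq_mul_div, le_div_iff₀ hε]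
        nlinarith [abs_nonneg x]
      linarith
    · rw [Set.indicator_of_notMem (show y ∉ {y : ℝ | ε < |x - y|} from h), norm_zero]
      positivity

/-- The principal value exists wherever the Cauchy and Poisson integrals converge and the
oscillation vanishes. -/
theorem hasPV_of_tendsto {p : ℝ≥0∞} (hp : 1 < p) (hp' : p ≠ ⊤) {f : ℝ → ℂ}
    (hf : MemLp f p volume) {x : ℝ} {c : ℂ}
    (h1 : Tendsto (fun t : ℝ =>
      ∫⁻ y, ENNReal.ofReal (poissonKer t (x - y)) * ‖f y - f x‖ₑ) (𝓝[>] 0) (𝓝 0))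
    (h2 : Tendsto (fun t : ℝ => poissonInt t f x) (𝓝[>] 0) (𝓝 (f x)))
    (h3 : Tendsto (fun t : ℝ => cauchyInt f (pt t x)) (𝓝[>] 0) (𝓝 c)) :
    HasPV f x (Real.pi * (-Complex.I * (2 * c - f x))) := by
  unfold HasPV
  -- The comparison kernel is odd, so it has mean zero, and it is dominated by the Poisson kernel;
  -- its integrals therefore tend to 0 with the oscillation.
  have hD : Tendsto (fun t : ℝ => ∫ y, (truncDiff t (x - y) : ℂ) * f y) (𝓝[>] 0) (𝓝 0) := by
    rw [tendsto_iff_edist_tendsto_0]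
    refine tendsto_of_tendsto_of_tendsto_of_le_of_le' tendsto_const_nhds h1
      (Eventually.of_forall fun _ => zero_le) ?_
    filter_upwards [self_mem_nhdsWithin] with t ht
    have ht : 0 < t := ht
    have h := enorm_integral_sub_le (f := f) ht (D := fun u => (truncDiff t u : ℂ))
      (Complex.measurable_ofReal.comp (measurable_truncDiff t))
      (fun u => by rw [Complex.norm_real]; exact abs_truncDiff_le ht u) x ?_
    · rwa [integral_complex_ofReal, integral_truncDiff, Complex.ofReal_zero, zero_mul,
        ← edist_eq_enorm_sub] at h
    · refine (integrable_poissonKer_mul hp hp' hf ht x).mono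
        ((Complex.measurable_ofReal.comp ((measurable_truncDiff t).comp
          (by fun_prop))).aestronglyMeasurable.mul hf.1) (ae_of_all _ fun y => ?_)
      rw [norm_mul, norm_mul, Complex.norm_real, Complex.norm_real,
        Real.norm_of_nonneg (poissonKer_pos ht _).le]
      gcongr
      exact abs_truncDiff_le ht _
  -- The truncated kernel is π times the comparison kernel plus π times the conjugate Poisson
  -- kernel, and the latter is -i(2 Cauchy - Poisson).
  have hlim := (hD.const_mul (Real.pi : ℂ)).add
    (((h3.const_mul 2).sub h2).const_mul (Real.pi * -Complex.I : ℂ))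
  rw [mul_zero, zero_add, mul_assoc] at hlim
  refine hlim.congr' ?_
  filter_upwards [self_mem_nhdsWithin] with t ht
  have ht : 0 < t := ht
  have hz : 0 < (pt t x).im := by simpa using ht
  have i1 := integrable_cauchyKer_mul hp hp' hf hz
  have i2 := integrable_poissonKer_mul hp hp' hf ht x
  have hS : MeasurableSet {y : ℝ | t < |x - y|} :=
    measurableSet_lt measurable_const (by fun_prop)
  have i3 := (integrable_indicator_iff hS).2 (integrable_div_truncated hp hp' hf ht x)
  have hpt : ∀ y : ℝ, (truncDiff t (x - y) : ℂ) * f y = (Real.pi : ℂ)⁻¹ *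
      ({y : ℝ | t < |x - y|}.indicator (fun y : ℝ => f y / ((x - y : ℝ) : ℂ)) y) -
      -Complex.I * (2 * (cauchyKer (pt t x - y) * f y) - (poissonKer t (x - y) : ℂ) * f y) := by
    intro y
    rw [pt_sub, cauchyKer_pt]
    have hπ : (Real.pi : ℂ) ≠ 0 := by exact_mod_cast Real.pi_ne_zero
    have hI := Complex.I_mul_I
    have e1 : -Complex.I * (2 * (1 / 2 * ((poissonKer t (x - y) : ℂ) + Complex.I *
        (((x - y) / (Real.pi * (t ^ 2 + (x - y) ^ 2)) : ℝ) : ℂ)) * f y) -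
        (poissonKer t (x - y) : ℂ) * f y) =
        (((x - y) / (Real.pi * (t ^ 2 + (x - y) ^ 2)) : ℝ) : ℂ) * f y := by
      linear_combination (-(((x - y) / (Real.pi * (t ^ 2 + (x - y) ^ 2)) : ℝ) : ℂ) * f y) * hI
    have e2 : ({y : ℝ | t < |x - y|}.indicator (fun y : ℝ => f y / ((x - y : ℝ) : ℂ)) y) =
        (({u : ℝ | t < |u|}.indicator (fun u => u⁻¹) (x - y) : ℝ) : ℂ) * f y := by
      by_cases h : t < |x - y|
      · rw [Set.indicator_of_mem (show y ∈ {y : ℝ | t < |x - y|} from h),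
          Set.indicator_of_mem (show x - y ∈ {u : ℝ | t < |u|} from h), div_eq_mul_inv,
          Complex.ofReal_inv, mul_comm]
      · rw [Set.indicator_of_notMem (show y ∉ {y : ℝ | t < |x - y|} from h),
          Set.indicator_of_notMem (show x - y ∉ {u : ℝ | t < |u|} from h), Complex.ofReal_zero,
          zero_mul]
    rw [e1, e2, truncDiff, mul_comm Real.pi, ← div_div]
    push_cast
    field_simp
  simp_rw [hpt]
  have hπ : (Real.pi : ℂ) ≠ 0 := by exact_mod_cast Real.pi_ne_zero
  have i4 : Integrable (fun y : ℝ =>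
      -Complex.I * (2 * (cauchyKer (pt t x - y) * f y) - (poissonKer t (x - y) : ℂ) * f y))
      volume := ((i1.const_mul 2).sub i2).const_mul _
  rw [integral_sub (i3.const_mul _) i4, integral_const_mul, integral_const_mul,
    integral_sub (i1.const_mul 2) i2, integral_const_mul, integral_indicator hS, mul_sub,
    mul_inv_cancel_left₀ hπ, cauchyInt, poissonInt]
  ring


/-! ### Fourier representation of the kernels and the semigroup property -/

open FourierTransform in
theorem fourierInv_eq_integral (f : ℝ → ℂ) (x : ℝ) :
    𝓕⁻ f x = ∫ v : ℝ, Complex.exp (2 * Real.pi * Complex.I * v * x) * f v := by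
  rw [Real.fourierInv_eq']
  refine integral_congr_ae (ae_of_all _ fun v => ?_)
  simp only [smul_eq_mul]
  congr 2
  simp
  ring

open FourierTransform in
theorem fourier_eq_integral (f : ℝ → ℂ) (x : ℝ) :
    𝓕 f x = ∫ v : ℝ, Complex.exp (-(2 * Real.pi * Complex.I * v * x)) * f v := by
  rw [Real.fourier_eq']
  refine integral_congr_ae (ae_of_all _ fun v => ?_)
  simp only [smul_eq_mul]
  congr 2
  simp
  ring

/-- The Fourier multiplier `e^{-2πtξ}` of the Cauchy extension on `ξ > 0`. -/
def cauchySymbol (t ξ : ℝ) : ℝ := if 0 < ξ then Real.exp (-(2 * Real.pi * t * ξ)) else 0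

theorem cauchySymbol_eq_indicator (t : ℝ) :
    cauchySymbol t = (Set.Ioi 0).indicator fun ξ => Real.exp (-(2 * Real.pi * t * ξ)) := by
  ext ξ
  simp [cauchySymbol, Set.indicator_apply]

theorem measurable_cauchySymbol (t : ℝ) : Measurable (cauchySymbol t) := by
  rw [cauchySymbol_eq_indicator]
  exact Measurable.indicator (by fun_prop) measurableSet_Ioi

theorem cauchySymbol_nonneg (t ξ : ℝ) : 0 ≤ cauchySymbol t ξ := by
  unfold cauchySymbol; split_ifs <;> positivity

theorem cauchySymbol_le_one {t : ℝ} (ht : 0 < t) (ξ : ℝ) : cauchySymbol t ξ ≤ 1 := by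
  unfold cauchySymbol
  split_ifs with h
  · rw [Real.exp_le_one_iff]
    have := Real.pi_pos
    have : 0 ≤ 2 * Real.pi * t * ξ := by positivity
    linarith
  · exact zero_le_one

theorem integrable_cauchySymbol {t : ℝ} (ht : 0 < t) : Integrable (cauchySymbol t) volume := by
  rw [cauchySymbol_eq_indicator, integrable_indicator_iff measurableSet_Ioi]
  have := exp_neg_integrableOn_Ioi 0 (b := 2 * Real.pi * t) (by positivity)
  refine this.congr_fun (fun x _ => ?_) measurableSet_Ioi
  simp

theorem integrable_ofReal_cauchySymbol {t : ℝ} (ht : 0 < t) :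
    Integrable (fun ξ => (cauchySymbol t ξ : ℂ)) volume := (integrable_cauchySymbol ht).ofReal

/-- An exponential integral over the half-line, convergent because x + it lies in the upper half
plane. It explains the normalization of `cauchyKer`. -/
theorem integral_exp_mul_cauchySymbol {t : ℝ} (ht : 0 < t) (x : ℝ) :
    ∫ ξ : ℝ, Complex.exp (2 * Real.pi * Complex.I * ξ * x) * cauchySymbol t ξ =
      cauchyKer (pt t x) := by
  have h1 : ∀ ξ : ℝ, Complex.exp (2 * Real.pi * Complex.I * ξ * x) * (cauchySymbol t ξ : ℂ) =
      (Set.Ioi (0 : ℝ)).indicator (fun ξ : ℝ => Complex.exp (2 * Real.pi * Complex.I * pt t x * ξ))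
        ξ := by
    intro ξ
    by_cases h : 0 < ξ
    · rw [Set.indicator_of_mem (Set.mem_Ioi.2 h), cauchySymbol, if_pos h, Complex.ofReal_exp,
        ← Complex.exp_add]
      congr 1
      unfold pt
      push_cast
      linear_combination (-(2 * Real.pi * t * ξ) : ℂ) * Complex.I_mul_I
    · rw [Set.indicator_of_notMem (by simpa using h), cauchySymbol, if_neg h]
      simp
  simp_rw [h1]
  rw [integral_indicator measurableSet_Ioi, integral_exp_mul_complex_Ioi]
  · simp only [Complex.ofReal_zero, mul_zero, Complex.exp_zero, cauchyKer]
    have hI := Complex.I_ne_zero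
    have hπ : (Real.pi : ℂ) ≠ 0 := by exact_mod_cast Real.pi_ne_zero
    have hz : pt t x ≠ 0 := fun h => by
      have := congrArg Complex.im h; simp at this; linarith
    rw [div_eq_div_iff (mul_ne_zero (mul_ne_zero (mul_ne_zero two_ne_zero hπ) hI) hz)
      (mul_ne_zero (mul_ne_zero two_ne_zero hπ) hz)]
    linear_combination (-(2 * Real.pi * pt t x) : ℂ) * Complex.I_mul_I
  · have : (2 * Real.pi * Complex.I * pt t x).re = -(2 * Real.pi * t) := by
      simp [pt]
    rw [this]
    have := Real.pi_pos
    have : 0 < 2 * Real.pi * t := by positivity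
    linarith

/-- The Fourier multiplier `e^{-2πt|ξ|}` of the Poisson extension. -/
def poissonSymbol (t ξ : ℝ) : ℝ := Real.exp (-(2 * Real.pi * t * |ξ|))

/-- The point ξ = 0 is exceptional: there both half-line symbols vanish while the Poisson symbol is
1. -/
theorem poissonSymbol_ae_eq (t : ℝ) :
    ∀ᵐ ξ : ℝ, poissonSymbol t ξ = cauchySymbol t ξ + cauchySymbol t (-ξ) := by
  have h0 : ∀ᵐ ξ : ℝ, ξ ≠ 0 := by simp [ae_iff]
  filter_upwards [h0] with ξ hξ
  unfold poissonSymbol cauchySymbol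
  rcases lt_or_gt_of_ne hξ with h | h
  · rw [if_neg (by linarith), if_pos (by linarith), abs_of_neg h, zero_add]
  · rw [if_pos h, if_neg (by linarith), abs_of_pos h, add_zero]

theorem integrable_poissonSymbol {t : ℝ} (ht : 0 < t) : Integrable (poissonSymbol t) volume :=
  ((integrable_cauchySymbol ht).add (integrable_cauchySymbol ht).comp_neg).congr
    ((poissonSymbol_ae_eq t).mono fun _ h => h.symm)

theorem integrable_exp_mul {g : ℝ → ℂ} (hg : Integrable g volume) (x : ℝ) :
    Integrable (fun ξ : ℝ => Complex.exp (2 * Real.pi * Complex.I * ξ * x) * g ξ) volume := by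
  refine hg.norm.mono' (Continuous.aestronglyMeasurable (by fun_prop) |>.mul hg.1)
    (ae_of_all _ fun ξ => ?_)
  rw [norm_mul]
  have : (2 * Real.pi * Complex.I * ξ * x : ℂ) = ((2 * Real.pi * ξ * x : ℝ) : ℂ) * Complex.I := by
    push_cast; ring
  rw [this, Complex.norm_exp_ofReal_mul_I, one_mul]

open FourierTransform in
theorem fourierInv_poissonSymbol {t : ℝ} (ht : 0 < t) (x : ℝ) :
    𝓕⁻ (fun ξ => (poissonSymbol t ξ : ℂ)) x = poissonKer t x := by
  rw [fourierInv_eq_integral, poissonKer_eq, conj_cauchyKer_pt, ← integral_exp_mul_cauchySymbol ht x,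
    ← integral_exp_mul_cauchySymbol ht (-x)]
  have i1 := integrable_exp_mul (integrable_ofReal_cauchySymbol ht) x
  have i2 := integrable_exp_mul (integrable_ofReal_cauchySymbol ht) (-x)
  rw [← integral_neg_eq_self (fun ξ : ℝ =>
    Complex.exp (2 * Real.pi * Complex.I * ξ * (-x : ℝ)) * (cauchySymbol t ξ : ℂ)), ← integral_add i1
    i2.comp_neg]
  refine integral_congr_ae ((poissonSymbol_ae_eq t).mono fun ξ h => ?_)
  simp only [h]
  push_cast
  rw [mul_add]
  congr 3
  ring

open FourierTransform in
-- Fourier inversion for the continuous integrable symbol, whose inverse transform is already known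
-- to be the Poisson kernel. Evenness of that kernel makes the direct and inverse transforms of the
-- symbol coincide.
theorem fourier_poissonKer {t : ℝ} (ht : 0 < t) (ξ : ℝ) :
    𝓕 (fun x => (poissonKer t x : ℂ)) ξ = poissonSymbol t ξ := by
  set e : ℝ → ℂ := fun ξ => (poissonSymbol t ξ : ℂ) with he
  have h1 : 𝓕⁻ e = fun x => (poissonKer t x : ℂ) := funext fun x => fourierInv_poissonSymbol ht x
  have h2 : 𝓕 e = fun x => (poissonKer t x : ℂ) := by
    ext x
    have : 𝓕 e x = 𝓕⁻ e (-x) := by rw [Real.fourierInv_eq_fourier_neg, neg_neg]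
    rw [this, h1]
    simp only [poissonKer_neg]
  have hi : Integrable (fun x => (poissonKer t x : ℂ)) volume := by
    have := (integrable_poissonKer ht 0).ofReal (𝕜 := ℂ)
    simpa [poissonKer_neg] using this
  have h3 := Continuous.fourier_fourierInv_eq (f := e)
    (by rw [he]; unfold poissonSymbol; fun_prop) (integrable_poissonSymbol ht).ofReal
    (by rw [h2]; exact hi)
  rw [h1] at h3
  rw [h3]

theorem cauchySymbol_mul_poissonSymbol (s t ξ : ℝ) :
    cauchySymbol s ξ * poissonSymbol t ξ = cauchySymbol (t + s) ξ := by
  unfold cauchySymbol poissonSymbol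
  split_ifs with h
  · rw [← Real.exp_add, abs_of_pos h]; congr 1; ring
  · exact zero_mul _

/-- On the Fourier side this is multiplication of symbols, since |ξ| = ξ on the support of the
Cauchy symbol. The Fourier integral of the Cauchy kernel converges absolutely, so Fubini applies. -/
theorem integral_poissonKer_mul_cauchyKer {s t : ℝ} (hs : 0 < s) (ht : 0 < t) (x : ℝ) :
    ∫ y, (poissonKer t (x - y) : ℂ) * cauchyKer (pt s y) = cauchyKer (pt (t + s) x) := by
  have hint : Integrable (fun z : ℝ × ℝ => (poissonKer t (x - z.1) : ℂ) *
      (Complex.exp (2 * Real.pi * Complex.I * z.2 * z.1) * cauchySymbol s z.2))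
      (volume.prod volume) := by
    have h0 : Integrable (fun y => (poissonKer t (x - y) : ℂ)) volume :=
      (integrable_poissonKer ht x).ofReal
    refine (h0.mul_prod (integrable_ofReal_cauchySymbol hs)).mono ?_ (ae_of_all _ fun z => ?_)
    · have h1 := measurable_poissonKer t
      have h2 := measurable_cauchySymbol s
      exact (by fun_prop : Measurable _).aestronglyMeasurable
    · have : (2 * Real.pi * Complex.I * z.2 * z.1 : ℂ) =
          ((2 * Real.pi * z.2 * z.1 : ℝ) : ℂ) * Complex.I := by push_cast; ring
      rw [this, norm_mul, norm_mul, norm_mul, Complex.norm_exp_ofReal_mul_I, one_mul]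
  have hswap := integral_integral_swap (f := fun y ξ : ℝ => (poissonKer t (x - y) : ℂ) *
      (Complex.exp (2 * Real.pi * Complex.I * ξ * y) * cauchySymbol s ξ)) hint
  calc _ = ∫ y : ℝ, ∫ ξ : ℝ, (poissonKer t (x - y) : ℂ) *
      (Complex.exp (2 * Real.pi * Complex.I * ξ * y) * cauchySymbol s ξ) := by
        refine integral_congr_ae (ae_of_all _ fun y => ?_)
        simp only
        rw [integral_const_mul, integral_exp_mul_cauchySymbol hs]
    _ = _ := hswap
    _ = ∫ ξ : ℝ, Complex.exp (2 * Real.pi * Complex.I * ξ * x) * cauchySymbol (t + s) ξ := by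
        refine integral_congr_ae (ae_of_all _ fun ξ => ?_)
        simp only
        rw [← cauchySymbol_mul_poissonSymbol, Complex.ofReal_mul, ← fourier_poissonKer ht,
          fourier_eq_integral, ← integral_sub_left_eq_self _ volume x, ← integral_const_mul,
          ← integral_const_mul]
        refine integral_congr_ae (ae_of_all _ fun y => ?_)
        simp only [sub_sub_cancel]
        have : Complex.exp (2 * Real.pi * Complex.I * ξ * ((x - y : ℝ) : ℂ)) =
            Complex.exp (2 * Real.pi * Complex.I * ξ * x) *
            Complex.exp (-(2 * Real.pi * Complex.I * y * ξ)) := by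
          rw [← Complex.exp_add]; congr 1; push_cast; ring
        rw [this]
        ring
    _ = _ := integral_exp_mul_cauchySymbol (by linarith) x

/-- Young's inequality without its weights. It serves to split a triple product in the semigroup
identities into two terms, each integrable on the plane as a product or a convolution integrand. -/
theorem norm_mul_le_rpow_add {r s : ℝ} (h : r.HolderConjugate s) (a b : ℂ) :
    ‖a * b‖ ≤ ‖a‖ ^ s + ‖b‖ ^ r := by
  rw [norm_mul]
  refine (Real.young_inequality_of_nonneg (norm_nonneg a) (norm_nonneg b) h.symm).trans ?_
  gcongr
  · exact div_le_self (by positivity) h.symm.lt.le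
  · exact div_le_self (by positivity) h.lt.le

theorem toReal_holderConjugate {p q : ℝ≥0∞} (hp : 1 < p) (hp' : p ≠ ⊤) (hq : 1 < q)
    (hpq : p.HolderConjugate q) : p.toReal.HolderConjugate q.toReal := by
  have hp0 : p ≠ 0 := (zero_lt_one.trans hp).ne'
  have hq0 : q ≠ 0 := (zero_lt_one.trans hq).ne'
  rw [Real.holderConjugate_iff]
  refine ⟨one_lt_toReal hp hp', ?_⟩
  have h := (ENNReal.holderConjugate_iff).1 hpq
  have h2 := congrArg ENNReal.toReal h
  rwa [ENNReal.toReal_add (by simp [hp0]) (by simp [hq0]), ENNReal.toReal_inv, ENNReal.toReal_inv,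
    ENNReal.toReal_one] at h2

/-- `P_t C_s = C_{t+s}`. -/
theorem poissonInt_cauchyInt {p : ℝ≥0∞} (hp : 1 < p) (hp' : p ≠ ⊤) {f : ℝ → ℂ}
    (hf : MemLp f p volume) {s t : ℝ} (hs : 0 < s) (ht : 0 < t) (x : ℝ) :
    poissonInt t (fun y => cauchyInt f (pt s y)) x = cauchyInt f (pt (t + s) x) := by
  obtain ⟨q, hpq, hq, hq'⟩ := exists_holderConjugate hp hp'
  have hrs := toReal_holderConjugate hp hp' hq hpq
  have hp0 : p ≠ 0 := (zero_lt_one.trans hp).ne'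
  have hq0 : q ≠ 0 := (zero_lt_one.trans hq).ne'
  have hint : Integrable (fun z : ℝ × ℝ => (poissonKer t (x - z.1) : ℂ) *
      (cauchyKer (pt s z.1 - z.2) * f z.2)) (volume.prod volume) := by
    have e1 : Integrable (fun z : ℝ × ℝ => poissonKer t (x - z.1) * ‖f z.2‖ ^ p.toReal)
        (volume.prod volume) :=
      (integrable_poissonKer ht x).mul_prod (hf.integrable_norm_rpow hp0 hp')
    have e2 : Integrable (fun z : ℝ × ℝ => poissonKer t (x - z.1) *
        ‖cauchyKer (pt s z.1 - z.2)‖ ^ q.toReal) (volume.prod volume) := by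
      have h1 := (memLp_cauchyKer hs hq hq' 0).integrable_norm_rpow hq0 hq'
      have h2 := (Integrable.convolution_integrand (ContinuousLinearMap.mul ℝ ℝ)
        (integrable_poissonKer ht x) h1).swap
      refine h2.congr (ae_of_all _ fun z => ?_)
      simp only [Function.comp_apply, Prod.fst_swap, Prod.snd_swap, ContinuousLinearMap.mul_apply']
      rw [pt_sub, pt_sub, zero_sub, neg_sub]
    refine (e2.add e1).mono' ?_ (ae_of_all _ fun z => ?_)
    · have h1 := measurable_poissonKer t
      refine AEStronglyMeasurable.mul (by fun_prop : Measurable _).aestronglyMeasurable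
        (AEStronglyMeasurable.mul ?_ hf.1.comp_snd)
      have := (continuous_pt s).measurable
      exact (measurable_cauchyKer.comp (by fun_prop)).aestronglyMeasurable
    · rw [norm_mul, Complex.norm_real, Real.norm_of_nonneg (poissonKer_pos ht _).le, Pi.add_apply,
        ← mul_add]
      exact mul_le_mul_of_nonneg_left (norm_mul_le_rpow_add hrs _ _) (poissonKer_pos ht _).le
  have hswap := integral_integral_swap (f := fun y u : ℝ => (poissonKer t (x - y) : ℂ) *
      (cauchyKer (pt s y - u) * f u)) hint
  calc _ = ∫ y : ℝ, ∫ u : ℝ, (poissonKer t (x - y) : ℂ) * (cauchyKer (pt s y - u) * f u) := by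
        refine integral_congr_ae (ae_of_all _ fun y => ?_)
        simp only
        rw [integral_const_mul, cauchyInt]
    _ = _ := hswap
    _ = _ := by
        refine integral_congr_ae (ae_of_all _ fun u => ?_)
        simp only
        rw [pt_sub, ← integral_poissonKer_mul_cauchyKer hs ht, ← integral_mul_const,
          ← integral_add_right_eq_self _ u]
        refine integral_congr_ae (ae_of_all _ fun y => ?_)
        simp only
        rw [pt_sub, add_sub_cancel_right, ← mul_assoc, sub_add_eq_sub_sub_swap]

/-- `C_s P_t = C_{t+s}`. -/
theorem cauchyInt_poissonInt {p : ℝ≥0∞} (hp : 1 < p) (hp' : p ≠ ⊤) {f : ℝ → ℂ}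
    (hf : MemLp f p volume) {s t : ℝ} (hs : 0 < s) (ht : 0 < t) (x : ℝ) :
    cauchyInt (poissonInt t f) (pt s x) = cauchyInt f (pt (t + s) x) := by
  obtain ⟨q, hpq, hq, hq'⟩ := exists_holderConjugate hp hp'
  have hrs := toReal_holderConjugate hp hp' hq hpq
  have hp0 : p ≠ 0 := (zero_lt_one.trans hp).ne'
  have hq0 : q ≠ 0 := (zero_lt_one.trans hq).ne'
  have hP : Integrable (poissonKer t) volume := by
    simpa [poissonKer_neg] using integrable_poissonKer ht 0
  have hint : Integrable (fun z : ℝ × ℝ => cauchyKer (pt s x - z.1) *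
      ((poissonKer t (z.1 - z.2) : ℂ) * f z.2)) (volume.prod volume) := by
    have e1 : Integrable (fun z : ℝ × ℝ => ‖f z.2‖ ^ p.toReal * poissonKer t (z.1 - z.2))
        (volume.prod volume) :=
      Integrable.convolution_integrand (ContinuousLinearMap.mul ℝ ℝ)
        (hf.integrable_norm_rpow hp0 hp') hP
    have e2 : Integrable (fun z : ℝ × ℝ => ‖cauchyKer (pt s x - z.1)‖ ^ q.toReal *
        poissonKer t (z.1 - z.2)) (volume.prod volume) := by
      have h1 := (memLp_cauchyKer hs hq hq' x).integrable_norm_rpow hq0 hq'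
      have h2 := (Integrable.convolution_integrand (ContinuousLinearMap.mul ℝ ℝ) h1 hP).swap
      refine h2.congr (ae_of_all _ fun z => ?_)
      simp only [Function.comp_apply, Prod.fst_swap, Prod.snd_swap, ContinuousLinearMap.mul_apply']
      rw [← poissonKer_neg, neg_sub]
    refine (e2.add e1).mono' ?_ (ae_of_all _ fun z => ?_)
    · have h1 := measurable_poissonKer t
      refine AEStronglyMeasurable.mul ?_ (AEStronglyMeasurable.mul
        (by fun_prop : Measurable _).aestronglyMeasurable hf.1.comp_snd)
      exact (measurable_cauchyKer.comp (by fun_prop)).aestronglyMeasurable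
    · rw [mul_left_comm, norm_mul, Complex.norm_real, Real.norm_of_nonneg (poissonKer_pos ht _).le,
        Pi.add_apply, ← add_mul, mul_comm]
      exact mul_le_mul_of_nonneg_right (norm_mul_le_rpow_add hrs _ _) (poissonKer_pos ht _).le
  have hswap := integral_integral_swap (f := fun y u : ℝ => cauchyKer (pt s x - y) *
      ((poissonKer t (y - u) : ℂ) * f u)) hint
  calc _ = ∫ y : ℝ, ∫ u : ℝ, cauchyKer (pt s x - y) * ((poissonKer t (y - u) : ℂ) * f u) := by
        refine integral_congr_ae (ae_of_all _ fun y => ?_)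
        simp only
        rw [integral_const_mul, poissonInt]
    _ = _ := hswap
    _ = _ := by
        refine integral_congr_ae (ae_of_all _ fun u => ?_)
        simp only
        rw [pt_sub, ← integral_poissonKer_mul_cauchyKer hs ht, ← integral_mul_const,
          ← integral_sub_left_eq_self _ volume x]
        refine integral_congr_ae (ae_of_all _ fun y => ?_)
        simp only
        rw [pt_sub, sub_sub_cancel, sub_right_comm]
        ring


/-! ### Operators on `L_p` and the Hilbert transform -/

/-- A bounded operator on `L_p` from a linear operation on functions. -/
theorem exists_clm_of_eLpNorm_le {p : ℝ≥0∞} [Fact (1 ≤ p)] (T : (ℝ → ℂ) → ℝ → ℂ) (M : NNReal)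
    (hm : ∀ f, MemLp f p volume → AEStronglyMeasurable (T f) volume)
    (hb : ∀ f, MemLp f p volume → eLpNorm (T f) p volume ≤ M * eLpNorm f p volume)
    (hc : ∀ f g, f =ᵐ[volume] g → T f =ᵐ[volume] T g)
    (ha : ∀ f g, MemLp f p volume → MemLp g p volume → T (f + g) =ᵐ[volume] T f + T g)
    (hs : ∀ (c : ℂ) f, T (c • f) =ᵐ[volume] c • T f) :
    ∃ A : Lp ℂ p (volume : Measure ℝ) →L[ℂ] Lp ℂ p (volume : Measure ℝ),
      (∀ f, A f =ᵐ[volume] T f) ∧ ∀ f, ‖A f‖ ≤ M * ‖f‖ := by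
  have hL : ∀ f : Lp ℂ p (volume : Measure ℝ), MemLp (T f) p volume := fun f =>
    ⟨hm f (Lp.memLp f), (hb f (Lp.memLp f)).trans_lt
      (ENNReal.mul_lt_top ENNReal.coe_lt_top (Lp.memLp f).2)⟩
  let A₀ : Lp ℂ p (volume : Measure ℝ) →ₗ[ℂ] Lp ℂ p (volume : Measure ℝ) :=
    { toFun := fun f => (hL f).toLp _
      map_add' := fun f g => by
        apply Lp.ext
        refine (MemLp.coeFn_toLp _).trans ((hc _ _ (Lp.coeFn_add f g)).trans
          ((ha _ _ (Lp.memLp f) (Lp.memLp g)).trans ?_))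
        refine EventuallyEq.trans ?_ (Lp.coeFn_add _ _).symm
        exact ((hL f).coeFn_toLp.add (hL g).coeFn_toLp).symm
      map_smul' := fun c f => by
        apply Lp.ext
        refine (MemLp.coeFn_toLp _).trans ((hc _ _ (Lp.coeFn_smul c f)).trans ((hs c _).trans ?_))
        refine EventuallyEq.trans ?_ (Lp.coeFn_smul _ _).symm
        exact ((hL f).coeFn_toLp.const_smul c).symm }
  have hA : ∀ f, ‖A₀ f‖ ≤ M * ‖f‖ := fun f => by
    have h1 : ‖A₀ f‖ = (eLpNorm (T f) p volume).toReal := Lp.norm_toLp _ (hL f)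
    rw [h1, Lp.norm_def, ← ENNReal.coe_toReal, ← ENNReal.toReal_mul]
    exact ENNReal.toReal_mono (ENNReal.mul_ne_top ENNReal.coe_ne_top (Lp.memLp f).2.ne)
      (hb f (Lp.memLp f))
  exact ⟨A₀.mkContinuous M hA, fun f => (hL f).coeFn_toLp, hA⟩

theorem exists_cauchyOperator {p : ℝ≥0∞} [Fact (1 ≤ p)] (hp : 1 < p) (hp' : p ≠ ⊤) :
    ∃ (C : ℝ → Lp ℂ p (volume : Measure ℝ) →L[ℂ] Lp ℂ p (volume : Measure ℝ)) (M : ℝ),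
      ∀ t : ℝ, 0 < t → (∀ f, C t f =ᵐ[volume] fun x => cauchyInt f (pt t x)) ∧
        ∀ f, ‖C t f‖ ≤ M * ‖f‖ := by
  obtain ⟨M, hM⟩ := exists_eLpNorm_cauchyInt_le hp hp'
  have key : ∀ t : ℝ, 0 < t → ∃ A : Lp ℂ p (volume : Measure ℝ) →L[ℂ] Lp ℂ p (volume : Measure ℝ),
      (∀ f, A f =ᵐ[volume] fun x => cauchyInt f (pt t x)) ∧ ∀ f, ‖A f‖ ≤ M * ‖f‖ := by
    intro t ht
    refine exists_clm_of_eLpNorm_le (fun f x => cauchyInt f (pt t x)) M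
      (fun f hf => (continuous_cauchyInt_pt hp hp' hf ht).aestronglyMeasurable) (hM t ht)
      (fun f g h => ae_of_all _ fun x => cauchyInt_congr_ae h _)
      (fun f g hf hg => ae_of_all _ fun x => cauchyInt_add hp hp' hf hg (by simpa using ht))
      (fun c f => ae_of_all _ fun x => cauchyInt_smul c f _)
  refine ⟨fun t => if ht : 0 < t then (key t ht).choose else 0, M, fun t ht => ?_⟩
  simp only [dif_pos ht]
  exact (key t ht).choose_spec

theorem exists_poissonOperator {p : ℝ≥0∞} [Fact (1 ≤ p)] (hp : 1 < p) (hp' : p ≠ ⊤) {t : ℝ}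
    (ht : 0 < t) : ∃ A : Lp ℂ p (volume : Measure ℝ) →L[ℂ] Lp ℂ p (volume : Measure ℝ),
      (∀ f, A f =ᵐ[volume] poissonInt t f) ∧ ∀ f, ‖A f‖ ≤ ‖f‖ := by
  have := exists_clm_of_eLpNorm_le (p := p) (poissonInt t) 1
      (fun f hf => (continuous_poissonInt hp hp' hf ht).aestronglyMeasurable) (fun f hf => by
        refine eLpNorm_le_of_le_poissonKer ht hp.le hp' hf.1 1 fun x => ?_
        rw [one_mul]
        refine (enorm_integral_le_lintegral_enorm _).trans_eq (lintegral_congr fun y => ?_)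
        rw [enorm_mul, ← ofReal_norm (Complex.ofReal _), Complex.norm_real,
          Real.norm_of_nonneg (poissonKer_pos ht _).le])
      (fun f g h => ae_of_all _ fun x => integral_congr_ae (h.mono fun y hy => by simp only [hy]))
      (fun f g hf hg => ae_of_all _ fun x => by
        simp only [Pi.add_apply, poissonInt, mul_add]
        exact integral_add (integrable_poissonKer_mul hp hp' hf ht x)
          (integrable_poissonKer_mul hp hp' hg ht x))
      (fun c f => ae_of_all _ fun x => by
        simp only [Pi.smul_apply, poissonInt, smul_eq_mul]
        rw [← integral_const_mul]
        refine integral_congr_ae (ae_of_all _ fun y => ?_)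
        simp only
        ring)
  simpa using this

/-- The difference of the two kernels is t/(2π) divided by the product of the two points, and the
moduli of both points are at least √(s² + x²). Hence C_{t+s} → C_s in operator norm as t → 0, at
rate t/(2s). -/
theorem norm_cauchyKer_sub_cauchyKer_le {s t : ℝ} (hs : 0 < s) (ht : 0 < t) (x : ℝ) :
    ‖cauchyKer (pt (t + s) x) - cauchyKer (pt s x)‖ ≤ t / (2 * s) * poissonKer s x := by
  have hz : pt (t + s) x ≠ 0 := fun h => by have := congrArg Complex.im h; simp at this; linarith
  have hw : pt s x ≠ 0 := fun h => by have := congrArg Complex.im h; simp at this; linarith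
  have hπ : (Real.pi : ℂ) ≠ 0 := by exact_mod_cast Real.pi_ne_zero
  have h1 : cauchyKer (pt (t + s) x) - cauchyKer (pt s x) =
      ((t / (2 * Real.pi) : ℝ) : ℂ) / (pt (t + s) x * pt s x) := by
    have h2 : pt (t + s) x = pt s x + t * Complex.I := by unfold pt; push_cast; ring
    unfold cauchyKer
    push_cast
    field_simp
    rw [h2]
    linear_combination (-(t : ℂ)) * Complex.I_mul_I
  have hns : ∀ u : ℝ, ‖pt u x‖ = Real.sqrt (u ^ 2 + x ^ 2) := fun u => by
    rw [Complex.norm_def, Complex.normSq_apply, pt_re, pt_im]; congr 1; ring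
  have h3 : s ^ 2 + x ^ 2 ≤ ‖pt (t + s) x‖ * ‖pt s x‖ := by
    rw [hns, hns]
    calc s ^ 2 + x ^ 2 = Real.sqrt (s ^ 2 + x ^ 2) * Real.sqrt (s ^ 2 + x ^ 2) :=
          (Real.mul_self_sqrt (by positivity)).symm
      _ ≤ _ := by gcongr; linarith
  rw [h1, norm_div, norm_mul, Complex.norm_real, Real.norm_of_nonneg (by positivity)]
  have h4 : t / (2 * s) * poissonKer s x = t / (2 * Real.pi) / (s ^ 2 + x ^ 2) := by
    unfold poissonKer; field_simp
  rw [h4]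
  gcongr

theorem norm_cauchyInt_sub_le {p : ℝ≥0∞} (hp : 1 < p) (hp' : p ≠ ⊤) {f : ℝ → ℂ}
    (hf : MemLp f p volume) {s t : ℝ} (hs : 0 < s) (ht : 0 < t) :
    eLpNorm (fun x => cauchyInt f (pt (t + s) x) - cauchyInt f (pt s x)) p volume ≤
      (t / (2 * s)).toNNReal * eLpNorm f p volume := by
  refine eLpNorm_le_of_le_poissonKer hs hp.le hp' hf.1 _ fun x => ?_
  have i1 := integrable_cauchyKer_mul hp hp' hf (z := pt (t + s) x) (by simp; linarith)
  have i2 := integrable_cauchyKer_mul hp hp' hf (z := pt s x) (by simpa using hs)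
  have hm : AEMeasurable (fun y => ENNReal.ofReal (poissonKer s (x - y)) * ‖f y‖ₑ) volume :=
    (((measurable_poissonKer s).comp (by fun_prop)).ennreal_ofReal.aemeasurable).mul hf.1.enorm
  rw [cauchyInt, cauchyInt, ← integral_sub i1 i2, ← lintegral_const_mul'' _ hm]
  refine (enorm_integral_le_lintegral_enorm _).trans (lintegral_mono fun y => ?_)
  rw [← sub_mul, enorm_mul, ← mul_assoc]
  gcongr
  rw [pt_sub, pt_sub, ← ofReal_norm, ← ENNReal.ofReal, ← ENNReal.ofReal_mul (by positivity)]
  exact ENNReal.ofReal_le_ofReal (norm_cauchyKer_sub_cauchyKer_le hs ht _)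

/-- Near the support use that the kernel has mass 1; far away use 2t|u| ≤ t² + u², which bounds the
kernel by a multiple of 1/|x| independently of t. The bound is a majorant in L_p for all heights at
once. -/
theorem IsNice.exists_norm_poissonInt_le {f : ℝ → ℂ} (hf : IsNice f) :
    ∃ B : ℝ, ∀ t : ℝ, 0 < t → ∀ x, ‖poissonInt t f x‖ ≤ B * (1 + |x|)⁻¹ := by
  obtain ⟨M, hM⟩ := hf.bdd
  obtain ⟨R, hR⟩ := hf.supp
  have hM0 : 0 ≤ M := (norm_nonneg _).trans (hM 0)
  set J := ∫ y, ‖f y‖ with hJ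
  have hJ0 : 0 ≤ J := integral_nonneg fun _ => norm_nonneg _
  refine ⟨M * (2 + 2 * |R|) + 2 * J, fun t ht x => ?_⟩
  rw [← div_eq_mul_inv, le_div_iff₀ (by positivity)]
  rcases le_or_gt |x| (1 + 2 * |R|) with h | h
  · have h1 : ‖poissonInt t f x‖ ≤ M := by
      calc ‖poissonInt t f x‖ ≤ ∫ y, poissonKer t (x - y) * M := by
            refine norm_integral_le_of_norm_le ((integrable_poissonKer ht x).mul_const M)
              (ae_of_all _ fun y => ?_)
            rw [norm_mul, Complex.norm_real, Real.norm_of_nonneg (poissonKer_pos ht _).le]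
            exact mul_le_mul_of_nonneg_left (hM y) (poissonKer_pos ht _).le
        _ = M := by rw [integral_mul_const, integral_poissonKer ht, one_mul]
    calc ‖poissonInt t f x‖ * (1 + |x|) ≤ M * (2 + 2 * |R|) :=
          mul_le_mul h1 (by linarith) (by positivity) hM0
      _ ≤ _ := by linarith
  · have h1 : ‖poissonInt t f x‖ ≤ |x|⁻¹ * J := by
      rw [hJ, ← integral_const_mul]
      refine norm_integral_le_of_norm_le (hf.integrable.norm.const_mul _) (ae_of_all _ fun y => ?_)
      by_cases hy : R < |y|
      · simp [hR y hy]
      · rw [norm_mul, Complex.norm_real, Real.norm_of_nonneg (poissonKer_pos ht _).le]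
        gcongr
        have hy' : |y| ≤ |R| := (not_lt.1 hy).trans (le_abs_self _)
        have h2 : |x| / 2 ≤ |x - y| := by
          have := abs_sub_abs_le_abs_sub x y
          linarith [abs_nonneg R]
        have hx : 0 < |x| := by linarith [abs_nonneg R]
        unfold poissonKer
        rw [← sq_abs (x - y), inv_eq_one_div, div_le_div_iff₀ (by positivity) hx]
        have h3 : 2 * t * |x - y| ≤ t ^ 2 + |x - y| ^ 2 := by nlinarith [sq_nonneg (t - |x - y|)]
        have h4 : t * |x| ≤ 2 * t * |x - y| := by nlinarith
        have h5 := Real.pi_gt_three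
        nlinarith [sq_nonneg t, sq_nonneg |x - y|]
    have hx : 1 < |x| := by linarith [abs_nonneg R]
    calc ‖poissonInt t f x‖ * (1 + |x|) ≤ |x|⁻¹ * J * (1 + |x|) := by gcongr
      _ = J * (|x|⁻¹ + 1) := by field_simp
      _ ≤ J * (1 + 1) := by
          gcongr
          exact inv_le_one_of_one_le₀ hx.le
      _ ≤ _ := by nlinarith [mul_nonneg hM0 (by positivity : 0 ≤ 2 + 2 * |R|)]

theorem IsNice.tendsto_poissonInt {f : ℝ → ℂ} (hf : IsNice f) (hfc : Continuous f) {p : ℝ≥0∞}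
    (hp : 1 < p) (hp' : p ≠ ⊤) :
    Tendsto (fun t : ℝ => eLpNorm (fun x => poissonInt t f x - f x) p volume) (𝓝[>] 0) (𝓝 0) := by
  have hfL := hf.memLp hp hp'
  obtain ⟨B, hB⟩ := hf.exists_norm_poissonInt_le
  have hp0 : p ≠ 0 := (zero_lt_one.trans hp).ne'
  have hr := one_lt_toReal hp hp'
  have hr0 : 0 < p.toReal := by linarith
  have hj : MemLp (fun x : ℝ => B * (1 + |x|)⁻¹) p volume :=
    memLp_of_decay (B := |B|) (by fun_prop) (fun x => by
      rw [norm_mul, Real.norm_eq_abs, Real.norm_of_nonneg (by positivity)]) hp hp'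
  have hbd : MemLp (fun x => (B * (1 + |x|)⁻¹) + ‖f x‖) p volume := hj.add hfL.norm
  simp_rw [eLpNorm_eq_lintegral_rpow_enorm_toReal hp0 hp']
  have h0 : (0 : ℝ≥0∞) = (∫⁻ _ : ℝ, 0) ^ (1 / p.toReal) := by
    rw [lintegral_zero, ENNReal.zero_rpow_of_pos (by positivity)]
  rw [h0]
  refine (ENNReal.continuous_rpow_const.tendsto _).comp ?_
  refine tendsto_lintegral_filter_of_dominated_convergence
    (fun x => ‖(B * (1 + |x|)⁻¹) + ‖f x‖‖ₑ ^ p.toReal) ?_ ?_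
    (lintegral_rpow_enorm_lt_top_of_eLpNorm_lt_top hp0 hp' hbd.2).ne ?_
  · filter_upwards [self_mem_nhdsWithin] with t ht
    have h1 := continuous_poissonInt hp hp' hfL ht
    exact ((h1.sub hfc).enorm.measurable.pow_const _)
  · filter_upwards [self_mem_nhdsWithin] with t ht
    refine ae_of_all _ fun x => ENNReal.rpow_le_rpow ?_ hr0.le
    rw [← ofReal_norm, ← ofReal_norm]
    refine ENNReal.ofReal_le_ofReal ((norm_sub_le _ _).trans ?_)
    refine le_trans ?_ (le_abs_self _)
    gcongr
    exact hB t ht x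
  · filter_upwards [ae_tendsto_poissonInt hp hp' hfL] with x hx
    have h1 : Tendsto (fun t : ℝ => ‖poissonInt t f x - f x‖ₑ) (𝓝[>] 0) (𝓝 0) := by
      simpa [edist_eq_enorm_sub] using (tendsto_iff_edist_tendsto_0.1 hx)
    have h2 := (ENNReal.continuous_rpow_const (y := p.toReal)).tendsto 0 |>.comp h1
    rwa [ENNReal.zero_rpow_of_pos hr0] at h2

theorem exists_isNice_eLpNorm_sub_le {p : ℝ≥0∞} (hp' : p ≠ ⊤) {f : ℝ → ℂ} (hf : MemLp f p volume)
    {ε : ℝ≥0∞} (hε : ε ≠ 0) : ∃ g, IsNice g ∧ Continuous g ∧ eLpNorm (f - g) p volume ≤ ε := by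
  obtain ⟨g, h1, h2, h3, -⟩ := hf.exists_hasCompactSupport_eLpNorm_sub_le hp' hε
  refine ⟨g, ⟨h3.aestronglyMeasurable, ?_, ?_⟩, h3, h2⟩
  · obtain ⟨M, hM⟩ := h1.exists_bound_of_continuous h3
    exact ⟨M, hM⟩
  · obtain ⟨R, hR⟩ := h1.isCompact.isBounded.subset_closedBall 0
    refine ⟨R, fun x hx => ?_⟩
    by_contra h
    have := hR (subset_tsupport g h)
    rw [Metric.mem_closedBall, Real.dist_eq, sub_zero] at this
    linarith

/-- The ranges of the Poisson operators are together dense. On them the Cauchy operators converge at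
the boundary for an algebraic reason, the semigroup identity. -/
theorem exists_poissonInt_eLpNorm_sub_le {p : ℝ≥0∞} (hp : 1 < p) (hp' : p ≠ ⊤) {f : ℝ → ℂ}
    (hf : MemLp f p volume) {ε : ℝ≥0∞} (hε : ε ≠ 0) : ∃ g, MemLp g p volume ∧ ∃ s : ℝ, 0 < s ∧
      eLpNorm (f - poissonInt s g) p volume ≤ ε := by
  have hε2 : ε / 2 ≠ 0 := by simp [hε]
  obtain ⟨g, hg, hgc, hfg⟩ := exists_isNice_eLpNorm_sub_le hp' hf hε2
  have h1 := (ENNReal.tendsto_nhds_zero.1 (hg.tendsto_poissonInt hgc hp hp')) (ε / 2)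
    (pos_iff_ne_zero.2 hε2)
  obtain ⟨s, hs, hs0⟩ := (h1.and self_mem_nhdsWithin).exists
  have hgL := hg.memLp hp hp'
  have hc := continuous_poissonInt hp hp' hgL hs0
  refine ⟨g, hgL, s, hs0, ?_⟩
  have h2 : f - poissonInt s g = (f - g) + (g - poissonInt s g) := by abel
  rw [h2]
  refine (eLpNorm_add_le (hf.1.sub hg.meas) (hg.meas.sub hc.aestronglyMeasurable) hp.le).trans ?_
  rw [eLpNorm_sub_comm g]
  refine (add_le_add hfg hs).trans_eq (ENNReal.add_halves ε)

/-- The Cauchy extension operators converge strongly at the boundary. -/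
theorem exists_tendsto_cauchyOperator {p : ℝ≥0∞} [Fact (1 ≤ p)] (hp : 1 < p) (hp' : p ≠ ⊤)
    {C : ℝ → Lp ℂ p (volume : Measure ℝ) →L[ℂ] Lp ℂ p (volume : Measure ℝ)} {M : ℝ}
    (hC : ∀ t : ℝ, 0 < t → (∀ f, C t f =ᵐ[volume] fun x => cauchyInt f (pt t x)) ∧
        ∀ f, ‖C t f‖ ≤ M * ‖f‖) (f : Lp ℂ p (volume : Measure ℝ)) :
    ∃ g, Tendsto (fun t => C t f) (𝓝[>] 0) (𝓝 g) := by
  -- No sign is assumed for M; a negative bound would force the whole space to vanish.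
  have hM : 0 ≤ M ∨ ∀ f : Lp ℂ p (volume : Measure ℝ), f = 0 := by
    by_contra! h
    obtain ⟨h1, f, hf⟩ := h
    have := (norm_nonneg _).trans ((hC 1 one_pos).2 f)
    have h2 := norm_pos_iff.2 hf
    nlinarith
  rcases hM with hM | hM
  swap
  · exact ⟨0, tendsto_const_nhds.congr fun t => (hM _).symm⟩
  -- Here C_t P_s g = C_{t+s} g, which tends to C_s g by the norm estimate for two heights.
  have hdense : ∀ (g : Lp ℂ p (volume : Measure ℝ)) (s : ℝ), 0 < s →
      ∃ P : Lp ℂ p (volume : Measure ℝ), P =ᵐ[volume] poissonInt s g ∧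
        Tendsto (fun t => C t P) (𝓝[>] 0) (𝓝 (C s g)) := by
    intro g s hs
    obtain ⟨A, hA, -⟩ := exists_poissonOperator hp hp' hs
    refine ⟨A g, hA g, ?_⟩
    rw [tendsto_iff_norm_sub_tendsto_zero]
    have h0 : Tendsto (fun t : ℝ => t / (2 * s) * ‖g‖) (𝓝[>] 0) (𝓝 0) := by
      have : Tendsto (fun t : ℝ => t / (2 * s) * ‖g‖) (𝓝 0) (𝓝 (0 / (2 * s) * ‖g‖)) :=
        (tendsto_id.div_const _).mul_const _
      rw [zero_div, zero_mul] at this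
      exact this.mono_left nhdsWithin_le_nhds
    refine squeeze_zero' (Eventually.of_forall fun _ => norm_nonneg _) ?_ h0
    filter_upwards [self_mem_nhdsWithin] with t ht
    have ht : 0 < t := ht
    have h1 : (C t (A g) - C s g : Lp ℂ p (volume : Measure ℝ)) =ᵐ[volume]
        fun x => cauchyInt g (pt (t + s) x) - cauchyInt g (pt s x) := by
      refine (Lp.coeFn_sub _ _).trans (((hC t ht).1 _).sub ((hC s hs).1 _) |>.trans ?_)
      refine ae_of_all _ fun x => ?_
      simp only [Pi.sub_apply]
      rw [cauchyInt_congr_ae (hA g), cauchyInt_poissonInt hp hp' (Lp.memLp g) ht hs, add_comm s t]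
    rw [Lp.norm_def, eLpNorm_congr_ae h1]
    refine (ENNReal.toReal_mono (ENNReal.mul_ne_top ENNReal.coe_ne_top (Lp.memLp g).2.ne)
      (norm_cauchyInt_sub_le hp hp' (Lp.memLp g) hs ht)).trans_eq ?_
    rw [ENNReal.toReal_mul, ENNReal.coe_toReal, Real.coe_toNNReal _ (by positivity), Lp.norm_def]
  suffices Cauchy (map (fun t => C t f) (𝓝[>] 0)) from CompleteSpace.complete this
  rw [Metric.cauchy_iff]
  refine ⟨inferInstance, fun ε hε => ?_⟩
  set η := ε / (4 * (M + 1)) with hη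
  have hη0 : 0 < η := by positivity
  obtain ⟨g, hg, s, hs, hfs⟩ := exists_poissonInt_eLpNorm_sub_le hp hp' (Lp.memLp f)
    (ε := ENNReal.ofReal η) (by simpa using hη0)
  obtain ⟨P, hP, hlim⟩ := hdense (hg.toLp g) s hs
  have hfP : ‖f - P‖ ≤ η := by
    rw [Lp.norm_def]
    have h1 : (f - P : Lp ℂ p (volume : Measure ℝ)) =ᵐ[volume] (f : ℝ → ℂ) - poissonInt s g := by
      refine (Lp.coeFn_sub _ _).trans (EventuallyEq.rfl.sub (hP.trans ?_))
      exact ae_of_all _ fun x => integral_congr_ae (hg.coeFn_toLp.mono fun y hy => by simp only [hy])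
    rw [eLpNorm_congr_ae h1]
    refine (ENNReal.toReal_mono ENNReal.ofReal_ne_top hfs).trans_eq ?_
    exact ENNReal.toReal_ofReal hη0.le
  set c := C s (hg.toLp g)
  have hev : ∀ᶠ t in 𝓝[>] (0 : ℝ), dist (C t f) c < ε / 2 := by
    filter_upwards [Metric.tendsto_nhds.1 hlim (ε / 4) (by positivity), self_mem_nhdsWithin]
      with t h1 ht
    have h2 : dist (C t f) (C t P) ≤ M * η := by
      rw [dist_eq_norm, ← map_sub]
      exact ((hC t ht).2 _).trans (by gcongr)
    have h3 : M * η ≤ ε / 4 := by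
      rw [hη, mul_div_assoc', div_le_div_iff₀ (by positivity) (by positivity)]
      nlinarith
    linarith [dist_triangle (C t f) (C t P) c]
  refine ⟨_, image_mem_map hev, ?_⟩
  rintro _ ⟨t, ht, rfl⟩ _ ⟨t', ht', rfl⟩
  have ht : dist (C t f) c < ε / 2 := ht
  have ht' : dist (C t' f) c < ε / 2 := ht'
  linarith [dist_triangle_right (C t f) (C t' f) c]

/-- The Cauchy operators, their boundary values, and the Hilbert transform `H` on `L_p`. -/
theorem exists_hilbertTransform {p : ℝ≥0∞} [Fact (1 ≤ p)] (hp : 1 < p) (hp' : p ≠ ⊤) :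
    ∃ (C : ℝ → Lp ℂ p (volume : Measure ℝ) →L[ℂ] Lp ℂ p (volume : Measure ℝ))
      (H : Lp ℂ p (volume : Measure ℝ) →L[ℂ] Lp ℂ p (volume : Measure ℝ)) (M : ℝ),
      (∀ t : ℝ, 0 < t → ∀ f, C t f =ᵐ[volume] fun x => cauchyInt f (pt t x)) ∧
      (∀ t : ℝ, 0 < t → ∀ f, ‖C t f‖ ≤ M * ‖f‖) ∧
      (∀ f : Lp ℂ p (volume : Measure ℝ), Tendsto (fun t => C t f) (𝓝[>] 0) (𝓝 ((1 / 2 : ℂ) • (f + Complex.I • H f)))) ∧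
      ∀ f : Lp ℂ p (volume : Measure ℝ), ∀ᵐ x, HasPV f x (Real.pi * H f x) := by
  obtain ⟨C, M, hC⟩ := exists_cauchyOperator hp hp'
  have hlim := exists_tendsto_cauchyOperator hp hp' hC
  choose C0 hC0 using hlim
  let C0L := continuousLinearMapOfTendsto (l := 𝓝[>] (0 : ℝ)) C (tendsto_pi_nhds.2 hC0)
  have hC0L : ∀ f, C0L f = C0 f := fun f => rfl
  -- H is defined by solving (I + iH)/2 = C₀ for the strong boundary limit C₀.
  refine ⟨C, -Complex.I • ((2 : ℂ) • C0L - ContinuousLinearMap.id ℂ _), M,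
    fun t ht => (hC t ht).1, fun t ht => (hC t ht).2, fun f => ?_, fun f => ?_⟩
  · convert hC0 f using 2
    simp only [_root_.smul_apply, _root_.sub_apply,
      ContinuousLinearMap.id_apply, hC0L, smul_smul]
    rw [mul_neg, Complex.I_mul_I, neg_neg, one_smul, add_sub_cancel, smul_smul]
    norm_num
  -- The Cauchy integral is the Poisson integral of its own boundary value: P_t C_s f = C_{s+t} f,
  -- and s → 0. Both sides are continuous in x, so equality holds everywhere. The almost everywhere
  -- convergence of Poisson integrals thus upgrades the L_p limit to a pointwise one, as the
  -- principal value requires.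
  · have hP : ∀ t : ℝ, 0 < t → ∀ x, poissonInt t (C0 f) x = cauchyInt f (pt t x) := by
      intro t ht
      obtain ⟨A, hA, hA'⟩ := exists_poissonOperator hp hp' ht
      have h1 : Tendsto (fun s => A (C s f)) (𝓝[>] 0) (𝓝 (A (C0 f))) :=
        (A.continuous.tendsto _).comp (hC0 f)
      have h2 : Tendsto (fun s => A (C s f)) (𝓝[>] 0) (𝓝 (C t f)) := by
        rw [tendsto_iff_norm_sub_tendsto_zero]
        have h0 : Tendsto (fun s : ℝ => s / (2 * t) * ‖f‖) (𝓝[>] 0) (𝓝 0) := by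
          have : Tendsto (fun s : ℝ => s / (2 * t) * ‖f‖) (𝓝 0) (𝓝 (0 / (2 * t) * ‖f‖)) :=
            (tendsto_id.div_const _).mul_const _
          rw [zero_div, zero_mul] at this
          exact this.mono_left nhdsWithin_le_nhds
        refine squeeze_zero' (Eventually.of_forall fun _ => norm_nonneg _) ?_ h0
        filter_upwards [self_mem_nhdsWithin] with s hs
        have hs : 0 < s := hs
        have h3 : (A (C s f) - C t f : Lp ℂ p (volume : Measure ℝ)) =ᵐ[volume]
            fun x => cauchyInt f (pt (s + t) x) - cauchyInt f (pt t x) := by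
          refine (Lp.coeFn_sub _ _).trans ((hA _).sub ((hC t ht).1 _) |>.trans ?_)
          refine ae_of_all _ fun x => ?_
          simp only [Pi.sub_apply]
          have : poissonInt t (C s f) x = poissonInt t (fun y => cauchyInt f (pt s y)) x :=
            integral_congr_ae (((hC s hs).1 f).mono fun y hy => by simp only [hy])
          rw [this, poissonInt_cauchyInt hp hp' (Lp.memLp f) hs ht, add_comm s t]
        rw [Lp.norm_def, eLpNorm_congr_ae h3]
        refine (ENNReal.toReal_mono (ENNReal.mul_ne_top ENNReal.coe_ne_top (Lp.memLp f).2.ne)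
          (norm_cauchyInt_sub_le hp hp' (Lp.memLp f) ht hs)).trans_eq ?_
        rw [ENNReal.toReal_mul, ENNReal.coe_toReal, Real.coe_toNNReal _ (by positivity),
          Lp.norm_def]
      have h3 := tendsto_nhds_unique h1 h2
      have h4 : poissonInt t (C0 f) =ᵐ[volume] fun x => cauchyInt f (pt t x) :=
        (hA _).symm.trans (by rw [h3]; exact (hC t ht).1 f)
      have h5 := (Continuous.ae_eq_iff_eq volume (continuous_poissonInt hp hp' (Lp.memLp _) ht)
        (continuous_cauchyInt_pt hp hp' (Lp.memLp f) ht)).1 h4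
      exact fun x => congrFun h5 x
    filter_upwards [ae_tendsto_lintegral_poissonKer hp hp' (Lp.memLp f),
      ae_tendsto_poissonInt hp hp' (Lp.memLp f), ae_tendsto_poissonInt hp hp' (Lp.memLp (C0 f)),
      Lp.coeFn_smul (-Complex.I) ((2 : ℂ) • C0 f - f),
      Lp.coeFn_sub ((2 : ℂ) • C0 f) f, Lp.coeFn_smul (2 : ℂ) (C0 f)] with x h1 h2 h3 h4 h5 h6
    have h7 : Tendsto (fun t : ℝ => cauchyInt f (pt t x)) (𝓝[>] 0) (𝓝 (C0 f x)) := by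
      refine h3.congr' ?_
      filter_upwards [self_mem_nhdsWithin] with t ht using hP t ht x
    have h8 := hasPV_of_tendsto hp hp' (Lp.memLp f) h1 h2 h7
    convert h8 using 2
    change (-Complex.I • ((2 : ℂ) • C0 f - f) : Lp ℂ p (volume : Measure ℝ)) x = _
    rw [h4, Pi.smul_apply, smul_eq_mul, h5, Pi.sub_apply, h6, Pi.smul_apply, smul_eq_mul]

/-! ### The Fourier transform on `L₂` -/

open scoped FourierTransform SchwartzMap

theorem integral_fourier_mul (u : Lp ℂ 2 (volume : Measure ℝ)) (g : 𝓢(ℝ, ℂ)) :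
    ∫ x, (𝓕 u : Lp ℂ 2 (volume : Measure ℝ)) x * g x = ∫ x, u x * (𝓕 g) x := by
  have h := congrArg (fun T => T g) (Lp.fourier_toTemperedDistribution_eq u)
  simp only [TemperedDistribution.fourier_apply, Lp.toTemperedDistribution_apply,
    smul_eq_mul] at h
  simp_rw [mul_comm _ (g _), mul_comm _ ((𝓕 g) _)]
  exact h.symm

theorem locallyIntegrable_coe_Lp (u : Lp ℂ 2 (volume : Measure ℝ)) :
    LocallyIntegrable u volume := (Lp.memLp u).locallyIntegrable one_le_two

theorem ae_eq_of_forall_schwartz {f g : ℝ → ℂ} (hf : LocallyIntegrable f volume)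
    (hg : LocallyIntegrable g volume) (h : ∀ φ : 𝓢(ℝ, ℂ), ∫ x, f x * φ x = ∫ x, g x * φ x) :
    f =ᵐ[volume] g := by
  refine ae_eq_of_integral_contDiff_smul_eq hf hg fun η h1 h2 => ?_
  have h3 : HasCompactSupport fun x => (η x : ℂ) := h2.comp_left (g := Complex.ofReal) rfl
  have h4 : ∫ x, f x * (η x : ℂ) = ∫ x, g x * (η x : ℂ) :=
    h (h3.toSchwartzMap (Complex.ofRealCLM.contDiff.comp h1))
  simpa [mul_comm] using h4

theorem integrable_mul_schwartz (u : Lp ℂ 2 (volume : Measure ℝ)) (φ : 𝓢(ℝ, ℂ)) :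
    Integrable (fun x => u x * φ x) volume :=
  (Lp.memLp u).integrable_mul (φ.memLp 2 volume)

theorem exists_symbolOperator {m : ℝ → ℝ} (hm : Measurable m) (hm' : ∀ ξ, |m ξ| ≤ 1) :
    ∃ A : Lp ℂ 2 (volume : Measure ℝ) →L[ℂ] Lp ℂ 2 (volume : Measure ℝ),
      ∀ f, A f =ᵐ[volume] fun ξ => (m ξ : ℂ) * f ξ := by
  obtain ⟨A, hA, -⟩ := exists_clm_of_eLpNorm_le (p := 2) (fun f ξ => (m ξ : ℂ) * f ξ) 1
    (fun f hf => (Complex.measurable_ofReal.comp hm).aestronglyMeasurable.mul hf.1)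
    (fun f hf => by
      rw [ENNReal.coe_one, one_mul]
      refine eLpNorm_mono fun ξ => ?_
      rw [norm_mul, Complex.norm_real]
      exact mul_le_of_le_one_left (norm_nonneg _) (hm' ξ))
    (fun f g h => h.mono fun ξ hξ => by simp only [hξ])
    (fun f g _ _ => ae_of_all _ fun ξ => by simp only [Pi.add_apply]; ring)
    (fun c f => ae_of_all _ fun ξ => by simp only [Pi.smul_apply, smul_eq_mul]; ring)
  exact ⟨A, hA⟩

theorem cauchyInt_eq_integral_fourier {f : ℝ → ℂ} (hf : Integrable f volume) {t : ℝ} (ht : 0 < t)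
    (x : ℝ) : cauchyInt f (pt t x) =
      ∫ ξ : ℝ, Complex.exp (2 * Real.pi * Complex.I * ξ * x) * (cauchySymbol t ξ * 𝓕 f ξ) := by
  have hm := integrable_ofReal_cauchySymbol ht
  have h1 : Integrable (Function.uncurry fun y ξ : ℝ =>
      Complex.exp (2 * Real.pi * Complex.I * ξ * (x - y : ℝ)) * (f y * cauchySymbol t ξ))
      (volume.prod volume) := by
    refine (hf.mul_prod hm).bdd_mul (c := 1) ?_ (ae_of_all _ fun z => ?_)
    · exact (by fun_prop : Continuous fun z : ℝ × ℝ =>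
        Complex.exp (2 * Real.pi * Complex.I * z.2 * (x - z.1 : ℝ))).aestronglyMeasurable
    · rw [Complex.norm_exp]
      simp
  calc cauchyInt f (pt t x)
      = ∫ y, ∫ ξ : ℝ, Complex.exp (2 * Real.pi * Complex.I * ξ * (x - y : ℝ)) *
          (f y * cauchySymbol t ξ) := by
        refine integral_congr_ae (ae_of_all _ fun y => ?_)
        simp only
        rw [pt_sub, ← integral_exp_mul_cauchySymbol ht, ← integral_mul_const]
        refine integral_congr_ae (ae_of_all _ fun ξ => ?_)
        simp only
        ring
    _ = ∫ ξ : ℝ, ∫ y, Complex.exp (2 * Real.pi * Complex.I * ξ * (x - y : ℝ)) *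
          (f y * cauchySymbol t ξ) := integral_integral_swap h1
    _ = _ := by
        refine integral_congr_ae (ae_of_all _ fun ξ => ?_)
        simp only
        rw [fourier_eq_integral, ← integral_const_mul, ← integral_const_mul]
        refine integral_congr_ae (ae_of_all _ fun y => ?_)
        simp only
        rw [show (2 * Real.pi * Complex.I * ξ * (x - y : ℝ) : ℂ) = 2 * Real.pi * Complex.I * ξ * x +
          (-(2 * Real.pi * Complex.I * y * ξ)) by push_cast; ring, Complex.exp_add]
        ring

theorem integral_exp_mul_mul_fourier {G : ℝ → ℂ} (hG : Integrable G volume) (ψ : 𝓢(ℝ, ℂ)) :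
    ∫ x : ℝ, (∫ ξ : ℝ, Complex.exp (2 * Real.pi * Complex.I * ξ * x) * G ξ) * (𝓕 ψ) x =
      ∫ ξ, G ξ * ψ ξ := by
  have h1 : Integrable (Function.uncurry fun x ξ : ℝ =>
      Complex.exp (2 * Real.pi * Complex.I * ξ * x) * ((𝓕 ψ) x * G ξ))
      (volume.prod volume) := by
    refine ((𝓕 ψ).integrable.mul_prod hG).bdd_mul (c := 1) ?_ (ae_of_all _ fun z => ?_)
    · exact (by fun_prop : Continuous fun z : ℝ × ℝ =>
        Complex.exp (2 * Real.pi * Complex.I * z.2 * z.1)).aestronglyMeasurable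
    · rw [Complex.norm_exp]
      simp
  calc _ = ∫ x : ℝ, ∫ ξ : ℝ, Complex.exp (2 * Real.pi * Complex.I * ξ * x) * ((𝓕 ψ) x * G ξ) := by
        refine integral_congr_ae (ae_of_all _ fun x => ?_)
        simp only
        rw [← integral_mul_const]
        refine integral_congr_ae (ae_of_all _ fun ξ => ?_)
        simp only
        ring
    _ = ∫ ξ : ℝ, ∫ x : ℝ, Complex.exp (2 * Real.pi * Complex.I * ξ * x) * ((𝓕 ψ) x * G ξ) :=
        integral_integral_swap h1
    _ = _ := by
        refine integral_congr_ae (ae_of_all _ fun ξ => ?_)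
        simp only
        have h2 : ψ ξ = 𝓕⁻ ((𝓕 ψ : 𝓢(ℝ, ℂ)) : ℝ → ℂ) ξ := by
          rw [← SchwartzMap.fourierInv_coe, FourierTransform.fourierInv_fourier_eq]
        rw [h2, fourierInv_eq_integral, ← integral_const_mul]
        refine integral_congr_ae (ae_of_all _ fun x => ?_)
        simp only
        rw [show (2 * Real.pi * Complex.I * ξ * x : ℂ) = 2 * Real.pi * Complex.I * x * ξ by ring]
        ring

/-- On `L₂`, the Cauchy operator is the Fourier multiplier with symbol `cauchySymbol t`. -/
theorem fourier_cauchyOperator {t : ℝ} (ht : 0 < t)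
    {C : Lp ℂ 2 (volume : Measure ℝ) →L[ℂ] Lp ℂ 2 (volume : Measure ℝ)}
    (hC : ∀ f, C f =ᵐ[volume] fun x => cauchyInt f (pt t x)) (f : Lp ℂ 2 (volume : Measure ℝ)) :
    (𝓕 (C f) : Lp ℂ 2 (volume : Measure ℝ)) =ᵐ[volume]
      fun ξ => (cauchySymbol t ξ : ℂ) * (𝓕 f : Lp ℂ 2 (volume : Measure ℝ)) ξ := by
  have hmb : ∀ ξ, |cauchySymbol t ξ| ≤ 1 := fun ξ => by
    rw [abs_of_nonneg (cauchySymbol_nonneg t ξ)]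
    exact cauchySymbol_le_one ht ξ
  obtain ⟨A, hA⟩ := exists_symbolOperator (measurable_cauchySymbol t) hmb
  suffices h : ∀ f : Lp ℂ 2 (volume : Measure ℝ), 𝓕 (C f) = A (𝓕 f) by
    rw [h]
    exact hA _
  intro f
  -- Both sides are continuous in f, so Schwartz functions suffice; there the Cauchy integral is an
  -- absolutely convergent Fourier integral, and the two sides are compared by testing.
  refine DenseRange.induction_on (p := fun f : Lp ℂ 2 (volume : Measure ℝ) => 𝓕 (C f) = A (𝓕 f))
    (SchwartzMap.denseRange_toLpCLM (p := 2) ENNReal.ofNat_ne_top) f ?_ ?_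
  · exact isClosed_eq ((Lp.fourierTransformₗᵢ ℝ ℂ).continuous.comp C.continuous)
      (A.continuous.comp (Lp.fourierTransformₗᵢ ℝ ℂ).continuous)
  intro φ
  rw [SchwartzMap.toLpCLM_apply]
  apply Lp.ext
  refine ae_eq_of_forall_schwartz (locallyIntegrable_coe_Lp _) (locallyIntegrable_coe_Lp _)
    fun ψ => ?_
  have hG : Integrable (fun ξ => (cauchySymbol t ξ : ℂ) * 𝓕 (φ : ℝ → ℂ) ξ) volume := by
    have := (𝓕 φ).integrable (μ := volume)
    rw [SchwartzMap.fourier_coe] at this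
    refine this.bdd_mul (c := 1) (integrable_ofReal_cauchySymbol ht).1 (ae_of_all _ fun ξ => ?_)
    rw [Complex.norm_real]
    exact hmb ξ
  have h1 : C (φ.toLp 2) =ᵐ[volume] fun x : ℝ => ∫ ξ : ℝ,
      Complex.exp (2 * Real.pi * Complex.I * ξ * x) * (cauchySymbol t ξ * 𝓕 (φ : ℝ → ℂ) ξ) := by
    refine (hC _).trans (ae_of_all _ fun x => ?_)
    simp only
    rw [cauchyInt_congr_ae (φ.coeFn_toLp 2 volume), cauchyInt_eq_integral_fourier φ.integrable ht]
  have h2 : A (𝓕 (φ.toLp 2)) =ᵐ[volume] fun ξ => (cauchySymbol t ξ : ℂ) * 𝓕 (φ : ℝ → ℂ) ξ := by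
    refine (hA _).trans ?_
    rw [SchwartzMap.toLp_fourier_eq]
    filter_upwards [(𝓕 φ).coeFn_toLp 2 volume] with ξ hξ
    rw [hξ, SchwartzMap.fourier_coe]
  rw [integral_fourier_mul]
  refine (integral_congr_ae (h1.mul EventuallyEq.rfl)).trans
    ((integral_exp_mul_mul_fourier hG ψ).trans ?_)
  exact integral_congr_ae (h2.symm.mul EventuallyEq.rfl)

/-! ### Weak derivatives in `L₂` -/

/-- The derivative of 𝓕ψ is the transform of -2πi x ψ(x), and the transform is moved from ψ to v. -/
theorem integral_mul_deriv_fourier (v : Lp ℂ 2 (volume : Measure ℝ)) (ψ : 𝓢(ℝ, ℂ)) :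
    ∫ x, v x * deriv (𝓕 ψ : 𝓢(ℝ, ℂ)) x =
      -∫ ξ, (2 * Real.pi * Complex.I * ξ) * (𝓕 v : Lp ℂ 2 (volume : Measure ℝ)) ξ * ψ ξ := by
  have ht : (inner ℝ · (1 : ℝ)).HasTemperateGrowth := by fun_prop
  have h1 : ∀ x, deriv (𝓕 ψ : 𝓢(ℝ, ℂ)) x =
      (𝓕 (-(2 * Real.pi * Complex.I) • SchwartzMap.smulLeftCLM ℂ (inner ℝ · (1 : ℝ)) ψ)) x := by
    intro x
    rw [← SchwartzMap.lineDerivOp_fourier_eq, SchwartzMap.lineDerivOp_apply_eq_fderiv,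
      fderiv_apply_one_eq_deriv]
  simp_rw [h1]
  rw [← integral_fourier_mul, ← integral_neg]
  refine integral_congr_ae (ae_of_all _ fun ξ => ?_)
  have h2 : (SchwartzMap.smulLeftCLM ℂ (inner ℝ · (1 : ℝ)) ψ) ξ = ξ * ψ ξ := by
    rw [SchwartzMap.smulLeftCLM_apply_apply ht]
    simp
  beta_reduce
  rw [show (-(2 * Real.pi * Complex.I) • SchwartzMap.smulLeftCLM ℂ (inner ℝ · (1 : ℝ)) ψ) ξ =
    -(2 * Real.pi * Complex.I) * (ξ * ψ ξ) by rw [← h2]; rfl]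
  ring

/-- A weak derivative can be tested with Schwartz functions. -/
theorem IsWeakDeriv.integral_schwartz {v w : Lp ℂ 2 (volume : Measure ℝ)} (h : IsWeakDeriv v w)
    (φ : 𝓢(ℝ, ℂ)) : ∫ x, v x * deriv φ x = -∫ x, w x * φ x := by
  -- Cut-offs χ(x/(n + 1)): they tend to 1, and their derivatives are O(1/n), so the commutator term
  -- disappears in the limit.
  let χ : ContDiffBump (0 : ℝ) := ⟨1, 2, one_pos, one_lt_two⟩
  have hχ0 : ∀ x, χ x ≤ 1 := fun x => χ.le_one
  obtain ⟨B, hB⟩ : ∃ B, ∀ x, ‖deriv χ x‖ ≤ B :=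
    (χ.hasCompactSupport.deriv).exists_bound_of_continuous
      (χ.contDiff.continuous_deriv (n := 1) le_rfl)
  have hχd : ∀ x, HasDerivAt χ (deriv χ x) x := fun x =>
    ((χ.contDiff (n := 1)).differentiable one_ne_zero x).hasDerivAt
  have hlim1 : ∀ x : ℝ, Tendsto (fun n : ℕ => χ (x / (n + 1 : ℝ))) atTop (𝓝 1) := by
    intro x
    have h1 : Tendsto (fun n : ℕ => x / (n + 1 : ℝ)) atTop (𝓝 0) :=
      tendsto_const_nhds.div_atTop (tendsto_natCast_atTop_atTop.atTop_add tendsto_const_nhds)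
    have h2 := (χ.continuous.tendsto 0).comp h1
    rwa [χ.one_of_mem_closedBall (by simp [χ])] at h2
  -- Test functions in `IsWeakDeriv` are real, so the argument runs for a real ρ dominated by φ and
  -- is applied to Re φ and Im φ.
  have key : ∀ ρ : ℝ → ℝ, ContDiff ℝ ∞ ρ → (∀ x, |ρ x| ≤ ‖φ x‖) → (∀ x, |deriv ρ x| ≤ ‖deriv φ x‖) →
      ∫ x, v x * ((deriv ρ x : ℝ) : ℂ) = -∫ x, w x * (ρ x : ℂ) := by
    intro ρ hρ hb hb'
    have hρd : ∀ x, HasDerivAt ρ (deriv ρ x) x := fun x =>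
      (hρ.differentiable (by simp) x).hasDerivAt
    have hcd : Continuous (deriv ρ) := hρ.continuous_deriv (by simp)
    have hd : ∀ (n : ℕ) (x : ℝ), HasDerivAt (fun x => χ (x / (n + 1 : ℝ)) * ρ x)
        (deriv χ (x / (n + 1 : ℝ)) / (n + 1 : ℝ) * ρ x + χ (x / (n + 1 : ℝ)) * deriv ρ x) x := by
      intro n x
      refine (HasDerivAt.mul ?_ (hρd x))
      have := (hχd (x / (n + 1 : ℝ))).comp x ((hasDerivAt_id x).div_const (n + 1 : ℝ))
      simpa [div_eq_mul_inv, Function.comp_def] using this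
    have e : ∀ n : ℕ, ∫ x, v x * ((deriv χ (x / (n + 1 : ℝ)) / (n + 1 : ℝ) * ρ x +
        χ (x / (n + 1 : ℝ)) * deriv ρ x : ℝ) : ℂ) =
        -∫ x, w x * ((χ (x / (n + 1 : ℝ)) * ρ x : ℝ) : ℂ) := by
      intro n
      have hc : HasCompactSupport fun x : ℝ => χ (x / (n + 1 : ℝ)) := by
        have := χ.hasCompactSupport.comp_homeomorph
          (Homeomorph.mulRight₀ ((n + 1 : ℝ)⁻¹) (by positivity))
        exact this
      have := h (fun x => χ (x / (n + 1 : ℝ)) * ρ x)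
        ((χ.contDiff.comp (contDiff_id.div_const _)).mul hρ) hc.mul_right
      rw [← this]
      refine integral_congr_ae (ae_of_all _ fun x => ?_)
      simp only
      rw [(hd n x).deriv]
    have hφ1 := (integrable_mul_schwartz w φ).norm
    have hφ2 := (integrable_mul_schwartz v φ).norm
    have hφ3 := (integrable_mul_schwartz v (SchwartzMap.derivCLM ℂ ℂ φ)).norm
    have hB0 : 0 ≤ B := (norm_nonneg _).trans (hB 0)
    have L1 : Tendsto (fun n : ℕ => ∫ x, v x * ((deriv χ (x / (n + 1 : ℝ)) / (n + 1 : ℝ) * ρ x +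
        χ (x / (n + 1 : ℝ)) * deriv ρ x : ℝ) : ℂ)) atTop (𝓝 (∫ x, v x * ((deriv ρ x : ℝ) : ℂ))) := by
      refine tendsto_integral_of_dominated_convergence
        (fun x => B * ‖v x * φ x‖ + ‖v x * deriv φ x‖) (fun n => ?_)
        ((hφ2.const_mul B).add hφ3) (fun n => ae_of_all _ fun x => ?_) (ae_of_all _ fun x => ?_)
      · refine (Lp.memLp v).1.mul (Continuous.aestronglyMeasurable ?_)
        have h1 : Continuous (deriv χ) := χ.contDiff.continuous_deriv (n := 1) le_rfl
        have h2 := χ.continuous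
        have h3 := hρ.continuous
        fun_prop
      · rw [norm_mul, norm_mul, norm_mul, Complex.norm_real, mul_left_comm, ← mul_add]
        gcongr
        refine (norm_add_le _ _).trans (add_le_add ?_ ?_)
        · rw [norm_mul, norm_div, Real.norm_of_nonneg (by positivity : (0 : ℝ) ≤ n + 1)]
          have h1 : ‖deriv χ (x / (n + 1 : ℝ))‖ / (n + 1 : ℝ) ≤ B :=
            (div_le_self (norm_nonneg _) (by linarith [n.cast_nonneg (α := ℝ)])).trans (hB _)
          gcongr
          exact hb x
        · rw [norm_mul, Real.norm_of_nonneg χ.nonneg]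
          exact (mul_le_of_le_one_left (norm_nonneg _) (hχ0 _)).trans (hb' x)
      · refine tendsto_const_nhds.mul ((Complex.continuous_ofReal.tendsto _).comp ?_)
        have h1 : Tendsto (fun n : ℕ => deriv χ (x / (n + 1 : ℝ)) / (n + 1 : ℝ)) atTop (𝓝 0) := by
          have h0 : Tendsto (fun n : ℕ => B / (n + 1 : ℝ)) atTop (𝓝 0) :=
            tendsto_const_nhds.div_atTop (tendsto_natCast_atTop_atTop.atTop_add tendsto_const_nhds)
          refine squeeze_zero_norm (fun n => ?_) h0
          rw [norm_div, Real.norm_of_nonneg (by positivity : (0 : ℝ) ≤ n + 1)]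
          gcongr
          exact hB _
        simpa using (h1.mul_const (ρ x)).add ((hlim1 x).mul_const (deriv ρ x))
    have L2 : Tendsto (fun n : ℕ => -∫ x, w x * ((χ (x / (n + 1 : ℝ)) * ρ x : ℝ) : ℂ)) atTop
        (𝓝 (-∫ x, w x * (ρ x : ℂ))) := by
      refine (tendsto_integral_of_dominated_convergence
        (fun x => ‖w x * φ x‖) (fun n => ?_) hφ1 (fun n => ae_of_all _ fun x => ?_)
        (ae_of_all _ fun x => ?_)).neg
      · refine (Lp.memLp w).1.mul (Continuous.aestronglyMeasurable ?_)
        have h2 := χ.continuous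
        have h3 := hρ.continuous
        fun_prop
      · rw [norm_mul, norm_mul, Complex.norm_real]
        gcongr
        rw [norm_mul, Real.norm_of_nonneg χ.nonneg]
        exact (mul_le_of_le_one_left (norm_nonneg _) (hχ0 _)).trans (hb x)
      · refine tendsto_const_nhds.mul ((Complex.continuous_ofReal.tendsto _).comp ?_)
        simpa using (hlim1 x).mul_const (ρ x)
    simp_rw [e] at L1
    exact tendsto_nhds_unique L1 L2
  have hre : ∀ x, HasDerivAt (fun x => (φ x).re) (deriv φ x).re x := fun x =>
    Complex.reCLM.hasFDerivAt.comp_hasDerivAt x (φ.hasDerivAt x)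
  have him : ∀ x, HasDerivAt (fun x => (φ x).im) (deriv φ x).im x := fun x =>
    Complex.imCLM.hasFDerivAt.comp_hasDerivAt x (φ.hasDerivAt x)
  have k1 := key (fun x => (φ x).re) (Complex.reCLM.contDiff.comp φ.smooth')
    (fun x => Complex.abs_re_le_norm _) (fun x => by rw [(hre x).deriv]; exact Complex.abs_re_le_norm _)
  have k2 := key (fun x => (φ x).im) (Complex.imCLM.contDiff.comp φ.smooth')
    (fun x => Complex.abs_im_le_norm _) (fun x => by rw [(him x).deriv]; exact Complex.abs_im_le_norm _)
  have hdec : ∀ (u : Lp ℂ 2 (volume : Measure ℝ)) (g : 𝓢(ℝ, ℂ)), ∫ x, u x * g x =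
      (∫ x, u x * ((g x).re : ℂ)) + Complex.I * ∫ x, u x * ((g x).im : ℂ) := by
    intro u g
    have i1 : Integrable (fun x => u x * ((g x).re : ℂ)) volume :=
      (Lp.memLp u).integrable_mul ((g.memLp 2 volume).re.ofReal)
    have i2 : Integrable (fun x => u x * ((g x).im : ℂ)) volume :=
      (Lp.memLp u).integrable_mul ((g.memLp 2 volume).im.ofReal)
    rw [← integral_const_mul, ← integral_add i1 (i2.const_mul _)]
    refine integral_congr_ae (ae_of_all _ fun x => ?_)
    simp only
    conv_lhs => rw [← Complex.re_add_im (g x)]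
    ring
  have d1 := hdec v (SchwartzMap.derivCLM ℂ ℂ φ)
  simp only [SchwartzMap.derivCLM_apply] at d1
  rw [d1, hdec w φ]
  simp only [(hre _).deriv, (him _).deriv] at k1 k2
  rw [k1, k2]
  ring

/-- Parseval with test functions of the form 𝓕ψ, which are all Schwartz functions. It makes weak
differentiation linear and turns D into a multiplication operator. -/
theorem isWeakDeriv_iff_fourier (v w : Lp ℂ 2 (volume : Measure ℝ)) :
    IsWeakDeriv v w ↔ ∀ᵐ ξ : ℝ, (𝓕 w : Lp ℂ 2 (volume : Measure ℝ)) ξ =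
      (2 * Real.pi * Complex.I * ξ) * (𝓕 v : Lp ℂ 2 (volume : Measure ℝ)) ξ := by
  constructor
  · intro h
    refine ae_eq_of_forall_schwartz (locallyIntegrable_coe_Lp _) ?_ fun ψ => ?_
    · have := (locallyIntegrableOn_univ.2 (locallyIntegrable_coe_Lp (𝓕 v))).continuousOn_mul
        (g := fun ξ : ℝ => (2 * Real.pi * Complex.I * ξ : ℂ)) (by fun_prop)
        isOpen_univ.isLocallyClosed
      exact locallyIntegrableOn_univ.1 this
    · rw [integral_fourier_mul, ← neg_inj, ← integral_mul_deriv_fourier]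
      exact (h.integral_schwartz _).symm
  · intro h η h1 h2
    have h3 : HasCompactSupport fun x => (η x : ℂ) := h2.comp_left (g := Complex.ofReal) rfl
    set φ := h3.toSchwartzMap (Complex.ofRealCLM.contDiff.comp h1) with hφ
    have hφ' : ∀ x, φ x = η x := fun x => rfl
    have hψ : 𝓕 (𝓕⁻ φ) = φ := FourierTransform.fourier_fourierInv_eq φ
    have hd : ∀ x, deriv φ x = ((deriv η x : ℝ) : ℂ) := fun x =>
      ((h1.differentiable (by simp) x).hasDerivAt.ofReal_comp).deriv
    have k := integral_mul_deriv_fourier v (𝓕⁻ φ)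
    rw [hψ] at k
    simp_rw [hd] at k
    rw [k, neg_inj]
    have k2 := integral_fourier_mul w (𝓕⁻ φ)
    rw [hψ] at k2
    simp_rw [← hφ']
    rw [← k2]
    exact integral_congr_ae (h.mono fun ξ hξ => by simp only [hξ])

theorem IsWeakDeriv.add {v w v' w' : Lp ℂ 2 (volume : Measure ℝ)} (h : IsWeakDeriv v w)
    (h' : IsWeakDeriv v' w') : IsWeakDeriv (v + v' : Lp ℂ 2 (volume : Measure ℝ))
      (w + w' : Lp ℂ 2 (volume : Measure ℝ)) := by
  rw [isWeakDeriv_iff_fourier] at *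
  have e1 : 𝓕 (v + v') = 𝓕 v + 𝓕 v' := FourierAdd.fourier_add v v'
  have e2 : 𝓕 (w + w') = 𝓕 w + 𝓕 w' := FourierAdd.fourier_add w w'
  rw [e1, e2]
  filter_upwards [h, h', Lp.coeFn_add (𝓕 v) (𝓕 v'), Lp.coeFn_add (𝓕 w) (𝓕 w')] with ξ h1 h2 h3 h4
  rw [h3, h4, Pi.add_apply, Pi.add_apply, h1, h2]
  ring

theorem IsWeakDeriv.smul {v w : Lp ℂ 2 (volume : Measure ℝ)} (c : ℂ) (h : IsWeakDeriv v w) :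
    IsWeakDeriv (c • v : Lp ℂ 2 (volume : Measure ℝ))
      (c • w : Lp ℂ 2 (volume : Measure ℝ)) := by
  rw [isWeakDeriv_iff_fourier] at *
  have e1 : 𝓕 (c • v) = c • 𝓕 v := FourierSMul.fourier_smul c v
  have e2 : 𝓕 (c • w) = c • 𝓕 w := FourierSMul.fourier_smul c w
  rw [e1, e2]
  filter_upwards [h, Lp.coeFn_smul c (𝓕 v), Lp.coeFn_smul c (𝓕 w)] with ξ h1 h3 h4
  rw [h3, h4, Pi.smul_apply, Pi.smul_apply, h1, smul_eq_mul, smul_eq_mul]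
  ring

theorem IsWeakDeriv.congr {v w v' w' : ℝ → ℂ} (h : IsWeakDeriv v w) (hv : v =ᵐ[volume] v')
    (hw : w =ᵐ[volume] w') : IsWeakDeriv v' w' := by
  intro η h1 h2
  have e1 : ∫ x, v x * ((deriv η x : ℝ) : ℂ) = ∫ x, v' x * ((deriv η x : ℝ) : ℂ) :=
    integral_congr_ae (hv.mono fun x hx => by simp only [hx])
  have e2 : ∫ x, w x * (η x : ℂ) = ∫ x, w' x * (η x : ℂ) :=
    integral_congr_ae (hw.mono fun x hx => by simp only [hx])
  rw [← e1, ← e2, h η h1 h2]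

theorem IsWeakDeriv.comp_neg {v w : ℝ → ℂ} (h : IsWeakDeriv v w) :
    IsWeakDeriv (fun x => v (-x)) (fun x => -w (-x)) := by
  intro η h1 h2
  have hd : ∀ x, deriv (fun x => η (-x)) x = -deriv η (-x) := fun x => deriv_comp_neg η x
  have := h (fun x => η (-x)) (h1.comp contDiff_neg) (h2.comp_homeomorph (Homeomorph.neg ℝ))
  rw [← integral_neg_eq_self, ← integral_neg_eq_self (fun x => w x * _)] at this
  simp only [hd, neg_neg, Complex.ofReal_neg, mul_neg, integral_neg, neg_mul] at this ⊢
  rw [neg_inj] at this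
  exact this

/-- The odd-even symmetry allows to differentiate across the jump of `sgn`. -/
theorem IsWeakDeriv.sgn_mul {v w : ℝ → ℂ} (h : IsWeakDeriv v w) (hv : LocallyIntegrable v volume)
    (hw : LocallyIntegrable w volume) (hodd : ∀ᵐ x, v (-x) = -v x) :
    IsWeakDeriv (fun x => sgn x * v x) (fun x => sgn x * w x) := by
  intro η h1 h2
  -- A smooth approximation of the sign. Its derivative is an even bump of height 1/ε, the only term
  -- that could produce a point mass at 0.
  let s : ℝ → ℝ → ℝ := fun ε x => x / Real.sqrt (x ^ 2 + ε ^ 2)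
  let s' : ℝ → ℝ → ℝ := fun ε x => ε ^ 2 / ((x ^ 2 + ε ^ 2) * Real.sqrt (x ^ 2 + ε ^ 2))
  have hpos : ∀ ε : ℝ, 0 < ε → ∀ x : ℝ, 0 < x ^ 2 + ε ^ 2 := fun ε hε x => by positivity
  have hs : ∀ ε : ℝ, 0 < ε → ContDiff ℝ ∞ (s ε) := fun ε hε =>
    contDiff_id.div (((contDiff_id.pow 2).add contDiff_const).sqrt fun x => (hpos ε hε x).ne')
      fun x => (Real.sqrt_pos.2 (hpos ε hε x)).ne'
  have hsd : ∀ ε : ℝ, 0 < ε → ∀ x, HasDerivAt (s ε) (s' ε x) x := by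
    intro ε hε x
    have hp := hpos ε hε x
    have hq := Real.sqrt_pos.2 hp
    have hq2 := Real.sq_sqrt hp.le
    have h3 : HasDerivAt (fun x : ℝ => x ^ 2 + ε ^ 2) (2 * x) x := by
      simpa using (hasDerivAt_pow 2 x).add_const (ε ^ 2)
    refine ((hasDerivAt_id x).div (h3.sqrt hp.ne') hq.ne').congr_deriv (Eq.symm ?_)
    change ε ^ 2 / ((x ^ 2 + ε ^ 2) * Real.sqrt (x ^ 2 + ε ^ 2)) = (1 * Real.sqrt (x ^ 2 + ε ^ 2) -
      x * (2 * x / (2 * Real.sqrt (x ^ 2 + ε ^ 2)))) / Real.sqrt (x ^ 2 + ε ^ 2) ^ 2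
    set r := Real.sqrt (x ^ 2 + ε ^ 2) with hr
    rw [← hq2]
    field_simp
    linear_combination -hq2
  have hsb : ∀ ε : ℝ, 0 < ε → ∀ x, |s ε x| ≤ 1 := by
    intro ε hε x
    simp only [s]
    rw [abs_div, abs_of_nonneg (Real.sqrt_nonneg _), div_le_one (Real.sqrt_pos.2 (hpos ε hε x))]
    exact Real.abs_le_sqrt (by nlinarith [sq_nonneg ε])
  have hsb' : ∀ ε : ℝ, 0 < ε → ∀ x, s' ε x * |x| ≤ 1 := by
    intro ε hε x
    have hp := hpos ε hε x
    have hq := Real.sqrt_pos.2 hp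
    simp only [s']
    rw [div_mul_eq_mul_div, div_le_one (mul_pos hp hq)]
    have h3 : |x| ≤ Real.sqrt (x ^ 2 + ε ^ 2) := Real.abs_le_sqrt (by nlinarith [sq_nonneg ε])
    exact mul_le_mul (by nlinarith [sq_nonneg x]) h3 (abs_nonneg _) hp.le
  have hs0 : ∀ x, Tendsto (fun ε => s ε x) (𝓝[>] 0) (𝓝 (Real.sign x)) := by
    intro x
    rcases eq_or_ne x 0 with rfl | hx
    · simp [s]
    · have h3 : ContinuousAt (fun ε => s ε x) 0 := by
        refine continuousAt_const.div (by fun_prop) ?_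
        have : 0 < x ^ 2 := by positivity
        rw [zero_pow two_ne_zero, add_zero]
        exact (Real.sqrt_pos.2 this).ne'
      have h4 : s 0 x = Real.sign x := by
        simp only [s]
        rw [zero_pow two_ne_zero, add_zero, Real.sqrt_sq_eq_abs]
        rcases hx.lt_or_gt with h5 | h5
        · rw [abs_of_neg h5, Real.sign_of_neg h5]; field_simp
        · rw [abs_of_pos h5, Real.sign_of_pos h5]; field_simp
      rw [← h4]
      exact h3.tendsto.mono_left nhdsWithin_le_nhds
  have hs0' : ∀ x, x ≠ 0 → Tendsto (fun ε => s' ε x) (𝓝[>] 0) (𝓝 0) := by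
    intro x hx
    have h3 : ContinuousAt (fun ε => s' ε x) 0 := by
      have : 0 < x ^ 2 := by positivity
      refine ContinuousAt.div (by fun_prop) (by fun_prop) ?_
      rw [zero_pow two_ne_zero, add_zero]
      exact (mul_pos this (Real.sqrt_pos.2 this)).ne'
    have h4 : s' 0 x = 0 := by simp [s']
    have := h3.tendsto.mono_left (nhdsWithin_le_nhds (s := Set.Ioi 0))
    rwa [h4] at this
  have hdη : ∀ x, HasDerivAt η (deriv η x) x := fun x => (h1.differentiable (by simp) x).hasDerivAt
  have hcη : Continuous (deriv η) := h1.continuous_deriv (by simp)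
  have hcs : ∀ ε : ℝ, 0 < ε → Continuous (s ε) := fun ε hε => (hs ε hε).continuous
  have hcs' : ∀ ε : ℝ, 0 < ε → Continuous (s' ε) := fun ε hε => by
    have : s' ε = deriv (s ε) := funext fun x => (hsd ε hε x).deriv.symm
    rw [this]
    exact (hs ε hε).continuous_deriv (by simp)
  have hint : ∀ {u : ℝ → ℂ}, LocallyIntegrable u volume → ∀ {g : ℝ → ℝ}, Continuous g →
      HasCompactSupport g → Integrable (fun x => u x * (g x : ℂ)) volume := by
    intro u hu g hg hg'
    have := hu.integrable_smul_left_of_hasCompactSupport hg hg'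
    refine this.congr (ae_of_all _ fun x => ?_)
    simp [mul_comm]
  -- the odd part of the test function
  let o : ℝ → ℝ := fun x => η x - η (-x)
  obtain ⟨B, hB⟩ := (h2.deriv).exists_bound_of_continuous hcη
  have ho : ∀ x, |o x| ≤ 2 * B * |x| := by
    intro x
    have := Convex.norm_image_sub_le_of_norm_deriv_le (f := η) (s := Set.univ) (x := -x) (y := x)
      (C := B) (fun y _ => (hdη y).differentiableAt) (fun y _ => hB y) convex_univ trivial trivial
    rw [Real.norm_eq_abs, Real.norm_eq_abs] at this
    refine this.trans_eq ?_
    rw [sub_neg_eq_add, ← two_mul, abs_mul, abs_two]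
    ring
  have ho2 : HasCompactSupport o := h2.sub (h2.comp_homeomorph (Homeomorph.neg ℝ))
  have hoc : Continuous o := by have := h1.continuous; fun_prop
  have key : ∀ ε : ℝ, 0 < ε → (∫ x, v x * ((s ε x * deriv η x : ℝ) : ℂ)) +
      (1 / 2 : ℂ) * (∫ x, v x * ((s' ε x * o x : ℝ) : ℂ)) =
      -∫ x, w x * ((s ε x * η x : ℝ) : ℂ) := by
    intro ε hε
    have k := h (fun x => s ε x * η x) ((hs ε hε).mul h1) h2.mul_left
    rw [← k]
    have hc1 := hcs ε hε
    have hc2 := hcs' ε hε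
    have hc3 := h1.continuous
    have i1 : Integrable (fun x => v x * ((s ε x * deriv η x : ℝ) : ℂ)) volume :=
      hint hv (hc1.mul hcη) h2.deriv.mul_left
    have i2 : Integrable (fun x => v x * ((s' ε x * η x : ℝ) : ℂ)) volume :=
      hint hv (hc2.mul hc3) h2.mul_left
    have i3 : Integrable (fun x => v x * ((s' ε x * η (-x) : ℝ) : ℂ)) volume :=
      hint hv (hc2.mul (by fun_prop)) (h2.comp_homeomorph (Homeomorph.neg ℝ)).mul_left
    have e1 : ∫ x, v x * ((s' ε x * η (-x) : ℝ) : ℂ) = -∫ x, v x * ((s' ε x * η x : ℝ) : ℂ) := by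
      rw [← integral_neg_eq_self, ← integral_neg]
      refine integral_congr_ae (hodd.mono fun x hx => ?_)
      simp only [hx, neg_neg, s', neg_sq]
      ring
    have e2 : ∫ x, v x * ((s' ε x * o x : ℝ) : ℂ) = 2 * ∫ x, v x * ((s' ε x * η x : ℝ) : ℂ) := by
      have : ∀ x, v x * ((s' ε x * o x : ℝ) : ℂ) =
          v x * ((s' ε x * η x : ℝ) : ℂ) - v x * ((s' ε x * η (-x) : ℝ) : ℂ) := fun x => by
        simp only [o]; push_cast; ring
      simp_rw [this]
      rw [integral_sub i2 i3, e1]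
      ring
    rw [e2, ← mul_assoc, one_div, inv_mul_cancel₀ two_ne_zero, one_mul, ← integral_add i1 i2]
    refine integral_congr_ae (ae_of_all _ fun x => ?_)
    simp only
    have hd : HasDerivAt (fun x => s ε x * η x) (s' ε x * η x + s ε x * deriv η x) x :=
      (hsd ε hε x).mul (hdη x)
    rw [hd.deriv]
    push_cast
    ring
  have L1 : ∀ {u : ℝ → ℂ}, LocallyIntegrable u volume → ∀ {g : ℝ → ℝ}, Continuous g →
      HasCompactSupport g → Tendsto (fun ε => ∫ x, u x * ((s ε x * g x : ℝ) : ℂ)) (𝓝[>] 0)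
        (𝓝 (∫ x, sgn x * u x * (g x : ℂ))) := by
    intro u hu g hg hg'
    refine tendsto_integral_filter_of_dominated_convergence (fun x => ‖u x * (g x : ℂ)‖) ?_ ?_
      (hint hu hg hg').norm (ae_of_all _ fun x => ?_)
    · filter_upwards [self_mem_nhdsWithin] with ε hε
      exact (hint hu ((hcs ε hε).mul hg) hg'.mul_left).1
    · filter_upwards [self_mem_nhdsWithin] with ε hε
      refine ae_of_all _ fun x => ?_
      rw [norm_mul, norm_mul, Complex.norm_real, Complex.norm_real, norm_mul]
      gcongr
      exact mul_le_of_le_one_left (norm_nonneg _) (hsb ε hε x)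
    · have : Tendsto (fun ε => u x * ((s ε x * g x : ℝ) : ℂ)) (𝓝[>] 0)
          (𝓝 (u x * ((Real.sign x * g x : ℝ) : ℂ))) :=
        tendsto_const_nhds.mul ((Complex.continuous_ofReal.tendsto _).comp ((hs0 x).mul_const _))
      convert this using 2
      simp only [sgn]
      push_cast
      ring
  -- Dominated convergence: s' tends to 0 off the origin, and s'·o stays bounded with fixed compact
  -- support. No continuity of v at 0 is used.
  have L2 : Tendsto (fun ε => ∫ x, v x * ((s' ε x * o x : ℝ) : ℂ)) (𝓝[>] 0) (𝓝 0) := by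
    have hK : IsCompact (tsupport o) := ho2
    have hI : Integrable ((tsupport o).indicator fun x => 2 * B * ‖v x‖) volume :=
      (integrable_indicator_iff hK.measurableSet).2 ((hv.integrableOn_isCompact hK).norm.const_mul _)
    have h0 : (0 : ℂ) = ∫ _ : ℝ, (0 : ℂ) := by simp
    rw [h0]
    refine tendsto_integral_filter_of_dominated_convergence _ ?_ ?_ hI ?_
    · filter_upwards [self_mem_nhdsWithin] with ε hε
      exact (hint hv ((hcs' ε hε).mul hoc) ho2.mul_left).1
    · filter_upwards [self_mem_nhdsWithin] with ε hε
      refine ae_of_all _ fun x => ?_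
      by_cases hx : x ∈ tsupport o
      · rw [Set.indicator_of_mem hx, norm_mul, Complex.norm_real, norm_mul, mul_comm (2 * B)]
        have hs'0 : 0 ≤ s' ε x := by simp only [s']; positivity
        rw [Real.norm_of_nonneg hs'0, Real.norm_eq_abs]
        refine mul_le_mul_of_nonneg_left ?_ (norm_nonneg _)
        have hB0 : 0 ≤ B := (norm_nonneg _).trans (hB 0)
        calc s' ε x * |o x| ≤ s' ε x * (2 * B * |x|) := by gcongr; exact ho x
          _ = 2 * B * (s' ε x * |x|) := by ring
          _ ≤ 2 * B * 1 := by gcongr; exact hsb' ε hε x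
          _ = 2 * B := mul_one _
      · rw [Set.indicator_of_notMem hx, image_eq_zero_of_notMem_tsupport hx]
        simp
    · have : ∀ᵐ x : ℝ, x ≠ 0 := by simp [ae_iff]
      filter_upwards [this] with x hx
      have : Tendsto (fun ε => v x * ((s' ε x * o x : ℝ) : ℂ)) (𝓝[>] 0)
          (𝓝 (v x * ((0 * o x : ℝ) : ℂ))) :=
        tendsto_const_nhds.mul
          ((Complex.continuous_ofReal.tendsto _).comp ((hs0' x hx).mul_const _))
      simpa using this
  have T1 := (L1 hv hcη h2.deriv).add (L2.const_mul (1 / 2 : ℂ))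
  have T2 := (L1 hw h1.continuous h2).neg
  rw [mul_zero, add_zero] at T1
  refine tendsto_nhds_unique (T1.congr' ?_) T2
  filter_upwards [self_mem_nhdsWithin] with ε hε using key ε hε

/-! ### Weak gradients on the upper half plane -/

/-- `V`, locally bounded on the upper half plane, has the weak gradient `(V₀, V₁)` there. -/
structure HasWeakGrad (V V₀ V₁ : ℝ × ℝ → ℂ) : Prop where
  meas : AEStronglyMeasurable V (volume.restrict upperHalf)
  meas_zero : AEStronglyMeasurable V₀ (volume.restrict upperHalf)
  meas_one : AEStronglyMeasurable V₁ (volume.restrict upperHalf)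
  bdd : ∀ S, IsCompact S → S ⊆ upperHalf → ∃ M : ℝ, ∀ z ∈ S, ‖V z‖ ≤ M ∧ ‖V₀ z‖ ≤ M ∧ ‖V₁ z‖ ≤ M
  weak_zero : ∀ η, IsTest η →
    ∫ z, V z * ((partialD 0 η z : ℝ) : ℂ) = -∫ z, V₀ z * (η z : ℂ)
  weak_one : ∀ η, IsTest η →
    ∫ z, V z * ((partialD 1 η z : ℝ) : ℂ) = -∫ z, V₁ z * (η z : ℂ)

theorem isOpen_upperHalf : IsOpen upperHalf := isOpen_lt continuous_const continuous_fst

theorem IsTest.partialD {η : ℝ × ℝ → ℝ} (h : IsTest η) (i : Fin 2) : IsTest (partialD i η) := by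
  obtain ⟨h1, h2, h3⟩ := h
  refine ⟨?_, ?_, ?_⟩
  · exact (h1.fderiv_right (m := ∞) (by simp)).clm_apply contDiff_const
  · exact h2.fderiv_apply ℝ _
  · exact (tsupport_fderiv_apply_subset ℝ _).trans h3

theorem IsTest.partialD_comm {η : ℝ × ℝ → ℝ} (h : IsTest η) (z : ℝ × ℝ) :
    JumpBVP.partialD 0 (JumpBVP.partialD 1 η) z = JumpBVP.partialD 1 (JumpBVP.partialD 0 η) z := by
  have h1 : Differentiable ℝ (fderiv ℝ η) :=
    (h.1.fderiv_right (m := ∞) (by simp)).differentiable (by simp)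
  have h2 : ∀ v : ℝ × ℝ, ∀ z, fderiv ℝ (fun y => fderiv ℝ η y v) z =
      (ContinuousLinearMap.apply ℝ ℝ v).comp (fderiv ℝ (fderiv ℝ η) z) := fun v z =>
    ((ContinuousLinearMap.apply ℝ ℝ v).hasFDerivAt.comp z (h1 z).hasFDerivAt).fderiv
  have h3 : IsSymmSndFDerivAt ℝ η z := h.1.contDiffAt.isSymmSndFDerivAt
    (by
      rw [minSmoothness_of_isRCLikeNormedField]
      exact ENat.LEInfty.out)
  unfold JumpBVP.partialD
  rw [h2, h2]
  exact h3 _ _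

/-- Products of a locally bounded function with a test function are integrable. -/
theorem integrable_mul_of_isTest {V : ℝ × ℝ → ℂ}
    (hm : AEStronglyMeasurable V (volume.restrict upperHalf))
    (hb : ∀ S, IsCompact S → S ⊆ upperHalf → ∃ M : ℝ, ∀ z ∈ S, ‖V z‖ ≤ M) {η : ℝ × ℝ → ℝ}
    (hη : IsTest η) : Integrable (fun z => V z * (η z : ℂ)) volume := by
  obtain ⟨h1, h2, h3⟩ := hη
  obtain ⟨M, hM⟩ := hb (tsupport η) h2 h3
  obtain ⟨B, hB⟩ := h2.exists_bound_of_continuous h1.continuous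
  have hs : Function.support (fun z => V z * (η z : ℂ)) ⊆ tsupport η := by
    intro z hz
    by_contra h
    exact hz (by simp [image_eq_zero_of_notMem_tsupport h])
  rw [← integrableOn_iff_integrable_of_support_subset hs]
  have hfin : volume (tsupport η) < ⊤ := h2.measure_lt_top
  have : IsFiniteMeasure (volume.restrict (tsupport η)) := ⟨by simpa using hfin⟩
  refine Integrable.of_bound (C := M * B) ?_ ?_
  · exact (hm.mono_measure (Measure.restrict_mono h3 le_rfl)).mul
      (Complex.continuous_ofReal.comp h1.continuous).aestronglyMeasurable
  · refine (ae_restrict_iff' (isClosed_tsupport η).measurableSet).2 (ae_of_all _ fun z hz => ?_)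
    rw [norm_mul, Complex.norm_real]
    exact mul_le_mul (hM z hz) (hB z) (norm_nonneg _) ((norm_nonneg _).trans (hM z hz))

namespace HasWeakGrad

variable {V V₀ V₁ W W₀ W₁ : ℝ × ℝ → ℂ}

theorem integrable (h : HasWeakGrad V V₀ V₁) {η : ℝ × ℝ → ℝ} (hη : IsTest η) :
    Integrable (fun z => V z * (η z : ℂ)) volume :=
  integrable_mul_of_isTest h.meas
    (fun S hS hS' => (h.bdd S hS hS').imp fun _ hM z hz => (hM z hz).1) hη

theorem integrable_zero (h : HasWeakGrad V V₀ V₁) {η : ℝ × ℝ → ℝ} (hη : IsTest η) :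
    Integrable (fun z => V₀ z * (η z : ℂ)) volume :=
  integrable_mul_of_isTest h.meas_zero
    (fun S hS hS' => (h.bdd S hS hS').imp fun _ hM z hz => (hM z hz).2.1) hη

theorem integrable_one (h : HasWeakGrad V V₀ V₁) {η : ℝ × ℝ → ℝ} (hη : IsTest η) :
    Integrable (fun z => V₁ z * (η z : ℂ)) volume :=
  integrable_mul_of_isTest h.meas_one
    (fun S hS hS' => (h.bdd S hS hS').imp fun _ hM z hz => (hM z hz).2.2) hη

theorem add (h : HasWeakGrad V V₀ V₁) (h' : HasWeakGrad W W₀ W₁) :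
    HasWeakGrad (fun z => V z + W z) (fun z => V₀ z + W₀ z) (fun z => V₁ z + W₁ z) where
  meas := h.meas.add h'.meas
  meas_zero := h.meas_zero.add h'.meas_zero
  meas_one := h.meas_one.add h'.meas_one
  bdd S hS hS' := by
    obtain ⟨M, hM⟩ := h.bdd S hS hS'
    obtain ⟨M', hM'⟩ := h'.bdd S hS hS'
    refine ⟨M + M', fun z hz => ⟨?_, ?_, ?_⟩⟩
    · exact (norm_add_le _ _).trans (add_le_add (hM z hz).1 (hM' z hz).1)
    · exact (norm_add_le _ _).trans (add_le_add (hM z hz).2.1 (hM' z hz).2.1)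
    · exact (norm_add_le _ _).trans (add_le_add (hM z hz).2.2 (hM' z hz).2.2)
  weak_zero η hη := by
    simp_rw [add_mul]
    rw [integral_add (h.integrable (hη.partialD 0)) (h'.integrable (hη.partialD 0)),
      integral_add (h.integrable_zero hη) (h'.integrable_zero hη), h.weak_zero η hη,
      h'.weak_zero η hη, neg_add]
  weak_one η hη := by
    simp_rw [add_mul]
    rw [integral_add (h.integrable (hη.partialD 1)) (h'.integrable (hη.partialD 1)),
      integral_add (h.integrable_one hη) (h'.integrable_one hη), h.weak_one η hη,
      h'.weak_one η hη, neg_add]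

theorem const_mul (c : ℂ) (h : HasWeakGrad V V₀ V₁) :
    HasWeakGrad (fun z => c * V z) (fun z => c * V₀ z) (fun z => c * V₁ z) where
  meas := h.meas.const_mul c
  meas_zero := h.meas_zero.const_mul c
  meas_one := h.meas_one.const_mul c
  bdd S hS hS' := by
    obtain ⟨M, hM⟩ := h.bdd S hS hS'
    refine ⟨‖c‖ * M, fun z hz => ⟨?_, ?_, ?_⟩⟩ <;> rw [norm_mul]
    · exact mul_le_mul_of_nonneg_left (hM z hz).1 (norm_nonneg _)
    · exact mul_le_mul_of_nonneg_left (hM z hz).2.1 (norm_nonneg _)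
    · exact mul_le_mul_of_nonneg_left (hM z hz).2.2 (norm_nonneg _)
  weak_zero η hη := by
    simp_rw [mul_assoc]
    rw [integral_const_mul, integral_const_mul, h.weak_zero η hη, mul_neg]
  weak_one η hη := by
    simp_rw [mul_assoc]
    rw [integral_const_mul, integral_const_mul, h.weak_one η hη, mul_neg]

end HasWeakGrad

/-- The fundamental theorem of calculus with one exceptional point, tailored to functions with a
corner on the axis x = 0. -/
theorem integral_eq_zero_of_hasDerivAt {P P' : ℝ → ℂ} (hc : Continuous P)
    (hs : HasCompactSupport P) (hd : ∀ x, x ≠ 0 → HasDerivAt P (P' x) x) : ∫ x, P' x = 0 := by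
  by_cases hi : Integrable P' volume
  swap
  -- The integral of a non-integrable function is 0 by convention, so integrability need not be
  -- assumed.
  · exact integral_undef hi
  obtain ⟨R, hR⟩ := hs.isCompact.isBounded.subset_closedBall 0
  set r := |R| + 1 with hr
  have hr0 : 0 < r := by positivity
  have hz : ∀ x, r ≤ |x| → x ∉ tsupport P := fun x hx h => by
    have := hR h
    rw [Metric.mem_closedBall, Real.dist_eq, sub_zero] at this
    linarith [le_abs_self R]
  have hP : ∀ x, r ≤ |x| → P x = 0 := fun x hx => image_eq_zero_of_notMem_tsupport (hz x hx)
  have hP' : ∀ x, r ≤ |x| → P' x = 0 := fun x hx => by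
    have h0 : x ≠ 0 := by rintro rfl; simp at hx; linarith
    have h1 : P =ᶠ[𝓝 x] fun _ => 0 := notMem_tsupport_iff_eventuallyEq.1 (hz x hx)
    exact (hd x h0).unique ((hasDerivAt_const x (0 : ℂ)).congr_of_eventuallyEq h1)
  have h1 := integral_eq_of_hasDerivAt_off_countable_of_le P P' (a := -r) (b := r) (by linarith)
    (Set.countable_singleton 0) hc.continuousOn (fun x hx => hd x hx.2) hi.intervalIntegrable
  rw [hP r (le_abs_self _), hP (-r) (by rw [abs_neg]; exact le_abs_self _), sub_zero,
    intervalIntegral.integral_of_le (by linarith)] at h1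
  rw [← h1]
  refine (setIntegral_eq_integral_of_forall_compl_eq_zero fun x hx => hP' x ?_).symm
  by_contra h
  rw [not_le, abs_lt] at h
  exact hx ⟨h.1, h.2.le⟩

theorem hasDerivAt_fst_of_isTest {η : ℝ × ℝ → ℝ} (hη : IsTest η) (t x : ℝ) :
    HasDerivAt (fun τ => (η (τ, x) : ℂ)) (partialD 0 η (t, x) : ℝ) t := by
  have h1 := (hη.1.differentiable (by simp) (t, x)).hasFDerivAt
  have h2 : HasDerivAt (fun τ : ℝ => ((τ, x) : ℝ × ℝ)) (1, 0) t :=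
    (hasDerivAt_id t).prodMk (hasDerivAt_const t x)
  have h3 := (h1.comp_hasDerivAt t h2).ofReal_comp
  simpa [partialD, Function.comp_def] using h3

theorem hasDerivAt_snd_of_isTest {η : ℝ × ℝ → ℝ} (hη : IsTest η) (t x : ℝ) :
    HasDerivAt (fun y => (η (t, y) : ℂ)) (partialD 1 η (t, x) : ℝ) x := by
  have h1 := (hη.1.differentiable (by simp) (t, x)).hasFDerivAt
  have h2 : HasDerivAt (fun y : ℝ => ((t, y) : ℝ × ℝ)) (0, 1) x :=
    (hasDerivAt_const x t).prodMk (hasDerivAt_id x)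
  have h3 := (h1.comp_hasDerivAt x h2).ofReal_comp
  simpa [partialD, Function.comp_def] using h3

/-- A function which is differentiable in `t`, and continuous in `x` and differentiable in `x`
off the vertical axis, has its classical derivatives as weak gradient. -/
theorem hasWeakGrad_of_hasDerivAt {V V₀ V₁ : ℝ × ℝ → ℂ}
    (hm : AEStronglyMeasurable V (volume.restrict upperHalf))
    (hm0 : AEStronglyMeasurable V₀ (volume.restrict upperHalf))
    (hm1 : AEStronglyMeasurable V₁ (volume.restrict upperHalf))
    (hb : ∀ S, IsCompact S → S ⊆ upperHalf →
      ∃ M : ℝ, ∀ z ∈ S, ‖V z‖ ≤ M ∧ ‖V₀ z‖ ≤ M ∧ ‖V₁ z‖ ≤ M)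
    (h0 : ∀ t x : ℝ, 0 < t → HasDerivAt (fun τ => V (τ, x)) (V₀ (t, x)) t)
    (hc : ∀ t : ℝ, 0 < t → Continuous fun x => V (t, x))
    (h1 : ∀ t x : ℝ, 0 < t → x ≠ 0 → HasDerivAt (fun y => V (t, y)) (V₁ (t, x)) x) :
    HasWeakGrad V V₀ V₁ := by
  have hbV : ∀ S, IsCompact S → S ⊆ upperHalf → ∃ M : ℝ, ∀ z ∈ S, ‖V z‖ ≤ M :=
    fun S hS hS' => (hb S hS hS').imp fun _ hM z hz => (hM z hz).1
  have hb0 : ∀ S, IsCompact S → S ⊆ upperHalf → ∃ M : ℝ, ∀ z ∈ S, ‖V₀ z‖ ≤ M :=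
    fun S hS hS' => (hb S hS hS').imp fun _ hM z hz => (hM z hz).2.1
  have hb1 : ∀ S, IsCompact S → S ⊆ upperHalf → ∃ M : ℝ, ∀ z ∈ S, ‖V₁ z‖ ≤ M :=
    fun S hS hS' => (hb S hS hS').imp fun _ hM z hz => (hM z hz).2.2
  have hne : ∀ {η : ℝ × ℝ → ℝ}, IsTest η → ∀ z : ℝ × ℝ, z.1 ≤ 0 → η =ᶠ[𝓝 z] fun _ => 0 :=
    fun hη z hz => notMem_tsupport_iff_eventuallyEq.1 fun h => (not_lt.2 hz) (hη.2.2 h)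
  refine ⟨hm, hm0, hm1, hb, fun η hη => ?_, fun η hη => ?_⟩
  · have i1 := integrable_mul_of_isTest hm hbV (hη.partialD 0)
    have i2 := integrable_mul_of_isTest hm0 hb0 hη
    rw [← add_eq_zero_iff_eq_neg, ← integral_add i1 i2, Measure.volume_eq_prod,
      integral_prod_symm _ (by rw [← Measure.volume_eq_prod]; exact i1.add i2)]
    refine integral_eq_zero_of_ae (ae_of_all _ fun x => ?_)
    have hd : ∀ t, HasDerivAt (fun τ => V (τ, x) * (η (τ, x) : ℂ))
        (V (t, x) * ((partialD 0 η (t, x) : ℝ) : ℂ) + V₀ (t, x) * (η (t, x) : ℂ)) t := by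
      intro t
      rcases lt_or_ge 0 t with ht | ht
      · rw [add_comm]
        exact (h0 t x ht).mul (hasDerivAt_fst_of_isTest hη t x)
      · have e := hne hη (t, x) ht
        have e' := hne (hη.partialD 0) (t, x) ht
        have e2 : (fun τ => V (τ, x) * (η (τ, x) : ℂ)) =ᶠ[𝓝 t] fun _ => 0 := by
          have : Tendsto (fun τ : ℝ => ((τ, x) : ℝ × ℝ)) (𝓝 t) (𝓝 (t, x)) :=
            (by fun_prop : Continuous fun τ : ℝ => ((τ, x) : ℝ × ℝ)).tendsto t
          filter_upwards [this.eventually e] with τ hτ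
          simp [hτ]
        rw [e.eq_of_nhds, e'.eq_of_nhds]
        simpa using (hasDerivAt_const t (0 : ℂ)).congr_of_eventuallyEq e2
    refine integral_eq_zero_of_hasDerivAt
      (continuous_iff_continuousAt.2 fun t => (hd t).continuousAt) ?_ fun t _ => hd t
    have : HasCompactSupport fun τ => (η (τ, x) : ℂ) := by
      have h2 : HasCompactSupport fun τ => η (τ, x) :=
        HasCompactSupport.of_support_subset_isCompact (hη.2.1.isCompact.image continuous_fst)
          fun τ hτ => ⟨(τ, x), subset_tsupport _ hτ, rfl⟩
      exact h2.comp_left (g := Complex.ofReal) rfl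
    exact this.mul_left
  · have i1 := integrable_mul_of_isTest hm hbV (hη.partialD 1)
    have i2 := integrable_mul_of_isTest hm1 hb1 hη
    rw [← add_eq_zero_iff_eq_neg, ← integral_add i1 i2, Measure.volume_eq_prod,
      integral_prod _ (by rw [← Measure.volume_eq_prod]; exact i1.add i2)]
    refine integral_eq_zero_of_ae (ae_of_all _ fun t => ?_)
    rcases lt_or_ge 0 t with ht | ht
    swap
    · simp [(hne hη (t, _) ht).eq_of_nhds, (hne (hη.partialD 1) (t, _) ht).eq_of_nhds]
    have hηc : Continuous fun x => (η (t, x) : ℂ) := by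
      have := hη.1.continuous
      fun_prop
    refine integral_eq_zero_of_hasDerivAt (P := fun x => V (t, x) * (η (t, x) : ℂ))
      ((hc t ht).mul hηc) ?_ fun x hx => ?_
    · have : HasCompactSupport fun x => (η (t, x) : ℂ) := by
        have h2 : HasCompactSupport fun x => η (t, x) :=
          HasCompactSupport.of_support_subset_isCompact (hη.2.1.isCompact.image continuous_snd)
            fun x hx => ⟨(t, x), subset_tsupport _ hx, rfl⟩
        exact h2.comp_left (g := Complex.ofReal) rfl
      exact this.mul_left
    · rw [add_comm]
      exact (h1 t x ht hx).mul (hasDerivAt_snd_of_isTest hη t x)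

/-- A function with a stream function is a weak solution. -/
theorem isWeakSolution_of_stream (k : ℝ) {V V₀ V₁ W W₀ W₁ : ℝ × ℝ → ℂ}
    (h : HasWeakGrad V V₀ V₁) (h' : HasWeakGrad W W₀ W₁)
    (hW0 : ∀ᵐ z : ℝ × ℝ, W₀ z = k * sgn z.2 * V₀ z - V₁ z)
    (hW1 : ∀ᵐ z : ℝ × ℝ, W₁ z = V₀ z + k * sgn z.2 * V₁ z) :
    IsWeakSolution (coeff k) V (fun z => !₂[V₀ z, V₁ z]) where
  memLp_potential S hS hS' := by
    obtain ⟨M, hM⟩ := h.bdd S hS hS'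
    have : IsFiniteMeasure (volume.restrict S) := ⟨by simpa using hS.measure_lt_top⟩
    refine MemLp.of_bound (h.meas.mono_measure (Measure.restrict_mono hS' le_rfl)) M ?_
    exact (ae_restrict_iff' hS.measurableSet).2 (ae_of_all _ fun z hz => (hM z hz).1)
  memLp_gradient S hS hS' := by
    obtain ⟨M, hM⟩ := h.bdd S hS hS'
    have : IsFiniteMeasure (volume.restrict S) := ⟨by simpa using hS.measure_lt_top⟩
    rw [memLp_piLp_iff]
    intro i
    fin_cases i
    · refine MemLp.of_bound (h.meas_zero.mono_measure (Measure.restrict_mono hS' le_rfl)) M ?_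
      exact (ae_restrict_iff' hS.measurableSet).2 (ae_of_all _ fun z hz => (hM z hz).2.1)
    · refine MemLp.of_bound (h.meas_one.mono_measure (Measure.restrict_mono hS' le_rfl)) M ?_
      exact (ae_restrict_iff' hS.measurableSet).2 (ae_of_all _ fun z hz => (hM z hz).2.2)
  gradient η hη i := by
    fin_cases i
    · exact h.weak_zero η hη
    · exact h.weak_one η hη
  equation η hη := by
    -- The flux is the rotated gradient (∂ₓW, -∂ₜW), so the weak equation reduces to the equality of
    -- mixed second derivatives of the test function.
    have e : (fun z : ℝ × ℝ => ∑ i : Fin 2, (coeff k z.2 *ᵥ (!₂[V₀ z, V₁ z] : C2).ofLp) i *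
        ((partialD i η z : ℝ) : ℂ)) =ᵐ[volume] fun z =>
        W₁ z * ((partialD 0 η z : ℝ) : ℂ) - W₀ z * ((partialD 1 η z : ℝ) : ℂ) := by
      filter_upwards [hW0, hW1] with z h0 h1
      rw [h0, h1]
      simp [coeff, Matrix.mulVec, dotProduct, Fin.sum_univ_two]
      ring
    rw [integral_congr_ae e, integral_sub (h'.integrable_one (hη.partialD 0))
      (h'.integrable_zero (hη.partialD 1)), ← neg_inj, neg_sub, neg_zero, sub_eq_zero,
      ← neg_inj, ← h'.weak_zero _ (hη.partialD 1), ← h'.weak_one _ (hη.partialD 0)]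
    simp_rw [hη.partialD_comm]

/-! ### Weak solutions from holomorphic functions -/

/-- The even part in `x` of the function `(t, x) ↦ Φ (x + i t)`. -/
def evenPart (Φ : ℂ → ℂ) (z : ℝ × ℝ) : ℂ := (Φ (pt z.1 z.2) + Φ (pt z.1 (-z.2))) / 2

/-- The odd part in `x` of the function `(t, x) ↦ Φ (x + i t)`. -/
def oddPart (Φ : ℂ → ℂ) (z : ℝ × ℝ) : ℂ := (Φ (pt z.1 z.2) - Φ (pt z.1 (-z.2))) / 2

theorem hasDerivAt_comp_pt_fst {Φ : ℂ → ℂ} {a : ℂ} {t x : ℝ} (h : HasDerivAt Φ a (pt t x)) :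
    HasDerivAt (fun τ => Φ (pt τ x)) (Complex.I * a) t := by
  have h1 : HasDerivAt (fun τ => pt τ x) Complex.I t := by
    have := ((hasDerivAt_id t).ofReal_comp.mul_const Complex.I).const_add (x : ℂ)
    simpa [pt] using this
  rw [mul_comm]
  exact h.comp t h1

theorem hasDerivAt_comp_pt_snd {Φ : ℂ → ℂ} {a : ℂ} {t x : ℝ} (h : HasDerivAt Φ a (pt t x)) :
    HasDerivAt (fun y => Φ (pt t y)) a x := by
  have h1 : HasDerivAt (fun y => pt t y) 1 x := by
    have := ((hasDerivAt_id x).ofReal_comp).add_const ((t : ℂ) * Complex.I)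
    simpa [pt] using this
  have := h.comp x h1
  rwa [mul_one] at this

theorem hasDerivAt_comp_pt_neg {Φ : ℂ → ℂ} {a : ℂ} {t x : ℝ} (h : HasDerivAt Φ a (pt t (-x))) :
    HasDerivAt (fun y => Φ (pt t (-y))) (-a) x := by
  have := (hasDerivAt_comp_pt_snd h).scomp x (hasDerivAt_neg x)
  simpa [Function.comp_def] using this

section Holomorphic

variable {Φ A : ℂ → ℂ}

theorem continuousOn_comp_pt (hA : ContinuousOn A {z | 0 < z.im}) :
    ContinuousOn (fun z : ℝ × ℝ => A (pt z.1 z.2)) upperHalf :=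
  hA.comp (continuous_pt_prod.continuousOn) fun z hz => by
    simpa [upperHalf] using hz

theorem continuousOn_comp_pt_neg (hA : ContinuousOn A {z | 0 < z.im}) :
    ContinuousOn (fun z : ℝ × ℝ => A (pt z.1 (-z.2))) upperHalf :=
  hA.comp ((continuous_pt_prod.comp (by fun_prop : Continuous fun z : ℝ × ℝ =>
    (z.1, -z.2))).continuousOn) fun z hz => by
    simpa [upperHalf] using hz

theorem continuousOn_evenPart (hA : ContinuousOn A {z | 0 < z.im}) :
    ContinuousOn (evenPart A) upperHalf :=
  ((continuousOn_comp_pt hA).add (continuousOn_comp_pt_neg hA)).div_const 2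

theorem continuousOn_oddPart (hA : ContinuousOn A {z | 0 < z.im}) :
    ContinuousOn (oddPart A) upperHalf :=
  ((continuousOn_comp_pt hA).sub (continuousOn_comp_pt_neg hA)).div_const 2

theorem exists_bound_of_continuousOn {V V₀ V₁ : ℝ × ℝ → ℂ} (h : ContinuousOn V upperHalf)
    (h0 : ContinuousOn V₀ upperHalf) (h1 : ContinuousOn V₁ upperHalf) (S : Set (ℝ × ℝ))
    (hS : IsCompact S) (hS' : S ⊆ upperHalf) :
    ∃ M : ℝ, ∀ z ∈ S, ‖V z‖ ≤ M ∧ ‖V₀ z‖ ≤ M ∧ ‖V₁ z‖ ≤ M := by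
  obtain ⟨M, hM⟩ := hS.exists_bound_of_continuousOn (h.mono hS')
  obtain ⟨M0, hM0⟩ := hS.exists_bound_of_continuousOn (h0.mono hS')
  obtain ⟨M1, hM1⟩ := hS.exists_bound_of_continuousOn (h1.mono hS')
  exact ⟨max M (max M0 M1), fun z hz => ⟨(hM z hz).trans (le_max_left _ _),
    (hM0 z hz).trans ((le_max_left _ _).trans (le_max_right _ _)),
    (hM1 z hz).trans ((le_max_right _ _).trans (le_max_right _ _))⟩⟩

theorem continuousOn_of_hasDerivAt (hΦ : ∀ z : ℂ, 0 < z.im → HasDerivAt Φ (A z) z) :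
    ContinuousOn Φ {z | 0 < z.im} := fun z hz => (hΦ z hz).continuousAt.continuousWithinAt

theorem continuousOn_deriv_of_hasDerivAt (hΦ : ∀ z : ℂ, 0 < z.im → HasDerivAt Φ (A z) z) :
    ContinuousOn A {z | 0 < z.im} := by
  have ho : IsOpen {z : ℂ | 0 < z.im} := isOpen_lt continuous_const Complex.continuous_im
  have h1 : DifferentiableOn ℂ Φ {z | 0 < z.im} := fun z hz =>
    (hΦ z hz).differentiableAt.differentiableWithinAt
  exact (h1.deriv ho).continuousOn.congr fun z hz => (hΦ z hz).deriv.symm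

theorem hasDerivAt_evenPart_fst (hΦ : ∀ z : ℂ, 0 < z.im → HasDerivAt Φ (A z) z) {t : ℝ}
    (ht : 0 < t) (x : ℝ) :
    HasDerivAt (fun τ => evenPart Φ (τ, x)) (Complex.I * evenPart A (t, x)) t := by
  have := ((hasDerivAt_comp_pt_fst (hΦ (pt t x) (by simpa))).add
    (hasDerivAt_comp_pt_fst (hΦ (pt t (-x)) (by simpa)))).div_const 2
  refine this.congr_deriv ?_
  simp only [evenPart]
  ring

theorem hasDerivAt_oddPart_fst (hΦ : ∀ z : ℂ, 0 < z.im → HasDerivAt Φ (A z) z) {t : ℝ}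
    (ht : 0 < t) (x : ℝ) :
    HasDerivAt (fun τ => oddPart Φ (τ, x)) (Complex.I * oddPart A (t, x)) t := by
  have := ((hasDerivAt_comp_pt_fst (hΦ (pt t x) (by simpa))).sub
    (hasDerivAt_comp_pt_fst (hΦ (pt t (-x)) (by simpa)))).div_const 2
  refine this.congr_deriv ?_
  simp only [oddPart]
  ring

theorem hasDerivAt_evenPart_snd (hΦ : ∀ z : ℂ, 0 < z.im → HasDerivAt Φ (A z) z) {t : ℝ}
    (ht : 0 < t) (x : ℝ) :
    HasDerivAt (fun y => evenPart Φ (t, y)) (oddPart A (t, x)) x := by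
  have := ((hasDerivAt_comp_pt_snd (hΦ (pt t x) (by simpa))).add
    (hasDerivAt_comp_pt_neg (hΦ (pt t (-x)) (by simpa)))).div_const 2
  refine this.congr_deriv ?_
  simp only [oddPart]
  ring

theorem hasDerivAt_oddPart_snd (hΦ : ∀ z : ℂ, 0 < z.im → HasDerivAt Φ (A z) z) {t : ℝ}
    (ht : 0 < t) (x : ℝ) :
    HasDerivAt (fun y => oddPart Φ (t, y)) (evenPart A (t, x)) x := by
  have := ((hasDerivAt_comp_pt_snd (hΦ (pt t x) (by simpa))).sub
    (hasDerivAt_comp_pt_neg (hΦ (pt t (-x)) (by simpa)))).div_const 2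
  refine this.congr_deriv ?_
  simp only [evenPart]
  ring

theorem hasWeakGrad_evenPart (hΦ : ∀ z : ℂ, 0 < z.im → HasDerivAt Φ (A z) z) :
    HasWeakGrad (evenPart Φ) (fun z => Complex.I * evenPart A z) (oddPart A) := by
  have hms := isOpen_upperHalf.measurableSet
  have c := continuousOn_evenPart (continuousOn_of_hasDerivAt hΦ)
  have c0 : ContinuousOn (fun z => Complex.I * evenPart A z) upperHalf :=
    continuousOn_const.mul (continuousOn_evenPart (continuousOn_deriv_of_hasDerivAt hΦ))
  have c1 := continuousOn_oddPart (continuousOn_deriv_of_hasDerivAt hΦ)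
  exact hasWeakGrad_of_hasDerivAt (c.aestronglyMeasurable hms) (c0.aestronglyMeasurable hms)
    (c1.aestronglyMeasurable hms) (exists_bound_of_continuousOn c c0 c1)
    (fun t x ht => hasDerivAt_evenPart_fst hΦ ht x)
    (fun t ht => continuous_iff_continuousAt.2 fun x => (hasDerivAt_evenPart_snd hΦ ht x).continuousAt)
    (fun t x ht _ => hasDerivAt_evenPart_snd hΦ ht x)

theorem hasWeakGrad_oddPart (hΦ : ∀ z : ℂ, 0 < z.im → HasDerivAt Φ (A z) z) :
    HasWeakGrad (oddPart Φ) (fun z => Complex.I * oddPart A z) (evenPart A) := by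
  have hms := isOpen_upperHalf.measurableSet
  have c := continuousOn_oddPart (continuousOn_of_hasDerivAt hΦ)
  have c0 : ContinuousOn (fun z => Complex.I * oddPart A z) upperHalf :=
    continuousOn_const.mul (continuousOn_oddPart (continuousOn_deriv_of_hasDerivAt hΦ))
  have c1 := continuousOn_evenPart (continuousOn_deriv_of_hasDerivAt hΦ)
  exact hasWeakGrad_of_hasDerivAt (c.aestronglyMeasurable hms) (c0.aestronglyMeasurable hms)
    (c1.aestronglyMeasurable hms) (exists_bound_of_continuousOn c c0 c1)
    (fun t x ht => hasDerivAt_oddPart_fst hΦ ht x)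
    (fun t ht => continuous_iff_continuousAt.2 fun x => (hasDerivAt_oddPart_snd hΦ ht x).continuousAt)
    (fun t x ht _ => hasDerivAt_oddPart_snd hΦ ht x)

theorem hasDerivAt_sgn {x : ℝ} (hx : x ≠ 0) : HasDerivAt sgn 0 x := by
  have : sgn =ᶠ[𝓝 x] fun _ => sgn x := by
    rcases hx.lt_or_gt with h | h
    · filter_upwards [Iio_mem_nhds h] with y hy
      simp [sgn, Real.sign_of_neg h, Real.sign_of_neg hy]
    · filter_upwards [Ioi_mem_nhds h] with y hy
      simp [sgn, Real.sign_of_pos h, Real.sign_of_pos hy]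
  exact (hasDerivAt_const x (sgn x)).congr_of_eventuallyEq this

/-- Odd parts vanish on the axis, so the product with sgn is continuous across it and its
distributional derivative has no singular part. -/
theorem hasWeakGrad_sgn_mul_oddPart (hΦ : ∀ z : ℂ, 0 < z.im → HasDerivAt Φ (A z) z) :
    HasWeakGrad (fun z => sgn z.2 * oddPart Φ z) (fun z => sgn z.2 * (Complex.I * oddPart A z))
      (fun z => sgn z.2 * evenPart A z) := by
  have h := hasWeakGrad_oddPart hΦ
  have hs : ∀ μ : Measure (ℝ × ℝ), AEStronglyMeasurable (fun z : ℝ × ℝ => sgn z.2) μ := fun μ =>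
    (measurable_sgn.comp measurable_snd).aestronglyMeasurable
  have hle : ∀ (x : ℝ) (w : ℂ) (M : ℝ), ‖w‖ ≤ M → ‖sgn x * w‖ ≤ M := fun x w M hw => by
    rw [norm_mul]
    exact (mul_le_of_le_one_left (norm_nonneg _) (norm_sgn_le x)).trans hw
  refine hasWeakGrad_of_hasDerivAt ((hs _).mul h.meas) ((hs _).mul h.meas_zero)
    ((hs _).mul h.meas_one) (fun S hS hS' => ?_) (fun t x ht => ?_) (fun t ht => ?_)
    (fun t x ht hx => ?_)
  · obtain ⟨M, hM⟩ := h.bdd S hS hS'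
    exact ⟨M, fun z hz => ⟨hle _ _ _ (hM z hz).1, hle _ _ _ (hM z hz).2.1, hle _ _ _ (hM z hz).2.2⟩⟩
  · exact (hasDerivAt_oddPart_fst hΦ ht x).const_mul (sgn x)
  · refine continuous_iff_continuousAt.2 fun x => ?_
    have hc := (hasDerivAt_oddPart_snd hΦ ht x).continuousAt
    rcases eq_or_ne x 0 with rfl | hx
    · have h0 : oddPart Φ (t, 0) = 0 := by simp [oddPart]
      rw [ContinuousAt, h0] at hc
      rw [ContinuousAt, h0, mul_zero]
      refine squeeze_zero_norm (fun x => hle x _ _ le_rfl) ?_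
      simpa using hc.norm
    · exact (hasDerivAt_sgn hx).continuousAt.mul hc
  · have := (hasDerivAt_sgn hx).mul (hasDerivAt_oddPart_snd hΦ ht x)
    rw [zero_mul, zero_add] at this
    exact this

theorem sgn_mul_self {x : ℝ} (hx : x ≠ 0) : sgn x * sgn x = 1 := by
  rcases hx.lt_or_gt with h | h
  · simp [sgn, Real.sign_of_neg h]
  · simp [sgn, Real.sign_of_pos h]

/-- Two holomorphic functions on the upper half plane give a solution of the equation with
coefficients `coeff k`. -/
theorem isWeakSolution_of_hasDerivAt (k : ℝ) {Ψ B : ℂ → ℂ}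
    (hΦ : ∀ z : ℂ, 0 < z.im → HasDerivAt Φ (A z) z)
    (hΨ : ∀ z : ℂ, 0 < z.im → HasDerivAt Ψ (B z) z) :
    IsWeakSolution (coeff k)
      (fun z => -Complex.I * (evenPart Φ z + Complex.I * k * (sgn z.2 * oddPart Φ z) + oddPart Ψ z))
      (fun z => !₂[evenPart A z + Complex.I * k * (sgn z.2 * oddPart A z) + oddPart B z,
        -Complex.I * (oddPart A z + Complex.I * k * (sgn z.2 * evenPart A z) + evenPart B z)]) := by
  have hae : ∀ᵐ z : ℝ × ℝ, z.2 ≠ 0 := by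
    have : ∀ᵐ x : ℝ, x ≠ 0 := by simp [ae_iff]
    rw [Measure.volume_eq_prod]
    exact Measure.quasiMeasurePreserving_snd.ae this
  have h1 := (((hasWeakGrad_evenPart hΦ).add ((hasWeakGrad_sgn_mul_oddPart hΦ).const_mul
    (Complex.I * k))).add (hasWeakGrad_oddPart hΨ)).const_mul (-Complex.I)
  -- The stream function W, with ∂ₜW = k sgn ∂ₜU - ∂ₓU and ∂ₓW = ∂ₜU + k sgn ∂ₓU; off the axis these
  -- relations follow from sgn² = 1 and i² = -1.
  have h2 := (((hasWeakGrad_oddPart hΦ).const_mul (1 + k ^ 2)).add (hasWeakGrad_evenPart hΨ)).add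
    ((hasWeakGrad_sgn_mul_oddPart hΨ).const_mul (-(Complex.I * k)))
  have := isWeakSolution_of_stream k h1 h2 ?_ ?_
  · convert this using 2 with z
    ext i
    fin_cases i
    · simp
      linear_combination (evenPart A z + Complex.I * k * (sgn z.2 * oddPart A z) + oddPart B z) *
        Complex.I_mul_I
    · simp
  · filter_upwards [hae] with z hz
    have hs := sgn_mul_self hz
    linear_combination (k ^ 2 * Complex.I * oddPart A z) * Complex.I_mul_I +
      (k ^ 2 * Complex.I ^ 3 * oddPart A z) * hs
  · filter_upwards [hae] with z hz
    have hs := sgn_mul_self hz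
    linear_combination (k * Complex.I * sgn z.2 * oddPart A z + evenPart A z + oddPart B z +
      k ^ 2 * evenPart A z * sgn z.2 ^ 2) * Complex.I_mul_I - (k ^ 2 * evenPart A z) * hs

end Holomorphic

/-- A holomorphic function on the upper half plane has a primitive. -/
theorem exists_primitive {A : ℂ → ℂ} (hA : DifferentiableOn ℂ A {z | 0 < z.im}) :
    ∃ Φ : ℂ → ℂ, ∀ z : ℂ, 0 < z.im → HasDerivAt Φ (A z) z := by
  have ho : IsOpen {z : ℂ | 0 < z.im} := isOpen_lt continuous_const Complex.continuous_im
  obtain ⟨Φ, hΦ⟩ := (convex_halfSpace_im_gt 0).exists_forall_hasDerivWithinAt hA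
  exact ⟨Φ, fun z hz => (hΦ z hz).hasDerivAt (ho.mem_nhds hz)⟩

/-! ### Reflection, multiplication by `sgn`, and the parity projections -/

/-- The scalar space `L_p(ℝ; ℂ)`. -/
abbrev LpC (p : ℝ≥0∞) : Type := Lp ℂ p (volume : Measure ℝ)

/-- The vector-valued space `L_p(ℝ; ℂ²)`. -/
abbrev LpV (p : ℝ≥0∞) : Type := Lp C2 p (volume : Measure ℝ)

section Operators

variable {p : ℝ≥0∞} [Fact (1 ≤ p)]

/-- The reflection `f ↦ f(-x)`. -/
def reflect (p : ℝ≥0∞) [Fact (1 ≤ p)] : LpC p →L[ℂ] LpC p :=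
  (Lp.compMeasurePreservingₗᵢ ℂ (fun x : ℝ => -x)
    (Measure.measurePreserving_neg volume)).toContinuousLinearMap

theorem coeFn_reflect (f : LpC p) : reflect p f =ᵐ[volume] fun x => f (-x) :=
  Lp.coeFn_compMeasurePreserving f (Measure.measurePreserving_neg volume)

theorem norm_reflect (f : LpC p) : ‖reflect p f‖ = ‖f‖ :=
  (Lp.compMeasurePreservingₗᵢ ℂ (fun x : ℝ => -x)
    (Measure.measurePreserving_neg volume)).norm_map f

omit [Fact (1 ≤ p)] in
theorem coeFn_sgnMul (f : LpC p) : sgnMul f =ᵐ[volume] fun x => sgn x * f x := by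
  refine (MemLp.coeFn_toLp _).trans (ae_of_all _ fun x => ?_)
  simp

theorem ae_ne_zero : ∀ᵐ x : ℝ, x ≠ 0 := by simp [ae_iff]

theorem norm_sgnMul (f : LpC p) : ‖sgnMul f‖ = ‖f‖ := by
  rw [Lp.norm_def, Lp.norm_def]
  congr 1
  refine eLpNorm_congr_norm_ae ?_
  filter_upwards [coeFn_sgnMul f, ae_ne_zero] with x hx h0
  have h1 : ‖sgn x‖ = 1 := by
    rcases h0.lt_or_gt with h | h
    · simp [sgn, Real.sign_of_neg h]
    · simp [sgn, Real.sign_of_pos h]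
  rw [hx, norm_mul, h1, one_mul]

/-- Multiplication by `sgn` as a bounded operator. -/
def sgnOp (p : ℝ≥0∞) [Fact (1 ≤ p)] : LpC p →L[ℂ] LpC p :=
  LinearMap.mkContinuous
    { toFun := sgnMul
      map_add' := fun f g => by
        apply Lp.ext
        filter_upwards [coeFn_sgnMul (f + g), coeFn_sgnMul f, coeFn_sgnMul g, Lp.coeFn_add f g,
          Lp.coeFn_add (sgnMul f) (sgnMul g)] with x h1 h2 h3 h4 h5
        rw [h1, h5, Pi.add_apply, h2, h3, h4, Pi.add_apply, mul_add]
      map_smul' := fun c f => by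
        apply Lp.ext
        filter_upwards [coeFn_sgnMul (c • f), coeFn_sgnMul f, Lp.coeFn_smul c f,
          Lp.coeFn_smul c (sgnMul f)] with x h1 h2 h3 h4
        rw [h1, RingHom.id_apply, h4, Pi.smul_apply, h2, h3, Pi.smul_apply, smul_eq_mul,
          smul_eq_mul, mul_left_comm] } 1
    fun f => by rw [one_mul]; exact (norm_sgnMul f).le

theorem sgnOp_apply (f : LpC p) : sgnOp p f = sgnMul f := rfl

theorem coeFn_sgnOp (f : LpC p) : sgnOp p f =ᵐ[volume] fun x => sgn x * f x := coeFn_sgnMul f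

theorem ae_comp_neg {P : ℝ → Prop} (h : ∀ᵐ x, P x) : ∀ᵐ x, P (-x) :=
  (Measure.measurePreserving_neg (volume : Measure ℝ)).quasiMeasurePreserving.ae h

theorem sgn_neg (x : ℝ) : sgn (-x) = -sgn x := by simp [sgn, Real.sign_neg]

@[simp]
theorem reflect_reflect (f : LpC p) : reflect p (reflect p f) = f := by
  apply Lp.ext
  filter_upwards [coeFn_reflect (reflect p f), ae_comp_neg (coeFn_reflect f)] with x h1 h2
  rw [h1, h2, neg_neg]

@[simp]
theorem sgnOp_sgnOp (f : LpC p) : sgnOp p (sgnOp p f) = f := by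
  apply Lp.ext
  filter_upwards [coeFn_sgnOp (sgnOp p f), coeFn_sgnOp f, ae_ne_zero] with x h1 h2 h3
  rw [h1, h2, ← mul_assoc, sgn_mul_self h3, one_mul]

@[simp]
theorem reflect_sgnOp (f : LpC p) : reflect p (sgnOp p f) = -sgnOp p (reflect p f) := by
  apply Lp.ext
  filter_upwards [coeFn_reflect (sgnOp p f), ae_comp_neg (coeFn_sgnOp f), coeFn_reflect f,
    coeFn_sgnOp (reflect p f), Lp.coeFn_neg (sgnOp p (reflect p f))] with x h1 h2 h3 h4 h5
  rw [h1, h2, h5, Pi.neg_apply, h4, h3, sgn_neg, neg_mul]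

/-- The projection onto even functions. -/
def evenOp (p : ℝ≥0∞) [Fact (1 ≤ p)] : LpC p →L[ℂ] LpC p :=
  (1 / 2 : ℂ) • (ContinuousLinearMap.id ℂ _ + reflect p)

/-- The projection onto odd functions. -/
def oddOp (p : ℝ≥0∞) [Fact (1 ≤ p)] : LpC p →L[ℂ] LpC p :=
  (1 / 2 : ℂ) • (ContinuousLinearMap.id ℂ _ - reflect p)

/-- Multiplication by `1 + c sgn`. -/
def affineOp (c : ℂ) (p : ℝ≥0∞) [Fact (1 ≤ p)] : LpC p →L[ℂ] LpC p :=
  ContinuousLinearMap.id ℂ _ + c • sgnOp p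

theorem evenOp_apply (f : LpC p) : evenOp p f = (1 / 2 : ℂ) • (f + reflect p f) := rfl

theorem oddOp_apply (f : LpC p) : oddOp p f = (1 / 2 : ℂ) • (f - reflect p f) := rfl

theorem affineOp_apply (c : ℂ) (f : LpC p) : affineOp c p f = f + c • sgnOp p f := rfl

/-- The coordinate `h ↦ e_i · h`. -/
def coord (i : Fin 2) (p : ℝ≥0∞) [Fact (1 ≤ p)] : LpV p →L[ℂ] LpC p :=
  (EuclideanSpace.proj i : C2 →L[ℂ] ℂ).compLpL p volume

theorem coeFn_coord (i : Fin 2) (h : LpV p) : coord i p h =ᵐ[volume] fun x => h x i :=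
  ContinuousLinearMap.coeFn_compLp _ h

/-- The embedding `f ↦ f e_i`. -/
def inc (i : Fin 2) (p : ℝ≥0∞) [Fact (1 ≤ p)] : LpC p →L[ℂ] LpV p :=
  (ContinuousLinearMap.toSpanSingleton ℂ (EuclideanSpace.single i (1 : ℂ) : C2)).compLpL p volume

theorem coeFn_inc (i : Fin 2) (f : LpC p) :
    inc i p f =ᵐ[volume] fun x => f x • (EuclideanSpace.single i (1 : ℂ) : C2) :=
  ContinuousLinearMap.coeFn_compLp _ f

@[simp]
theorem coord_inc (i : Fin 2) (f : LpC p) : coord i p (inc i p f) = f := by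
  apply Lp.ext
  filter_upwards [coeFn_coord i (inc i p f), coeFn_inc i f] with x h1 h2
  rw [h1, h2]
  simp

theorem coord_inc_of_ne {i j : Fin 2} (hij : i ≠ j) (f : LpC p) : coord i p (inc j p f) = 0 := by
  apply Lp.ext
  filter_upwards [coeFn_coord i (inc j p f), coeFn_inc j f, Lp.coeFn_zero ℂ p volume] with x h1 h2 h3
  rw [h1, h2, h3]
  simp [hij]

@[simp]
theorem coord_zero_inc_one (f : LpC p) : coord 0 p (inc 1 p f) = 0 := coord_inc_of_ne (by decide) f

@[simp]
theorem coord_one_inc_zero (f : LpC p) : coord 1 p (inc 0 p f) = 0 := coord_inc_of_ne (by decide) f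

theorem inc_add_inc (h : LpV p) : inc 0 p (coord 0 p h) + inc 1 p (coord 1 p h) = h := by
  apply Lp.ext
  filter_upwards [Lp.coeFn_add (inc 0 p (coord 0 p h)) (inc 1 p (coord 1 p h)),
    coeFn_inc 0 (coord 0 p h), coeFn_inc 1 (coord 1 p h), coeFn_coord 0 h, coeFn_coord 1 h]
    with x h1 h2 h3 h4 h5
  rw [h1, Pi.add_apply, h2, h3, h4, h5]
  ext i
  fin_cases i <;> simp

theorem ext_coord {h h' : LpV p} (h0 : coord 0 p h = coord 0 p h') (h1 : coord 1 p h = coord 1 p h') :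
    h = h' := by
  rw [← inc_add_inc h, h0, h1, inc_add_inc]

/-! ### The diagonalization of `T_k` -/

/-- The first scalar component of the transformation which diagonalizes `T_k`. -/
def fwdZero (k : ℝ) (p : ℝ≥0∞) [Fact (1 ≤ p)] : LpV p →L[ℂ] LpC p :=
  affineOp (-(Complex.I * k)) p ∘L (evenOp p ∘L coord 0 p + Complex.I • (oddOp p ∘L coord 1 p))

/-- The second scalar component of the transformation which diagonalizes `T_k`. -/
def fwdOne (p : ℝ≥0∞) [Fact (1 ≤ p)] : LpV p →L[ℂ] LpC p :=
  oddOp p ∘L coord 0 p + Complex.I • (evenOp p ∘L coord 1 p)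

/-- The first part of the inverse transformation. -/
def bwdZero (k : ℝ) (p : ℝ≥0∞) [Fact (1 ≤ p)] : LpC p →L[ℂ] LpV p :=
  ((1 + k ^ 2 : ℂ)⁻¹) • ((inc 0 p ∘L evenOp p - Complex.I • (inc 1 p ∘L oddOp p)) ∘L
    affineOp (Complex.I * k) p)

/-- The second part of the inverse transformation. -/
def bwdOne (p : ℝ≥0∞) [Fact (1 ≤ p)] : LpC p →L[ℂ] LpV p :=
  inc 0 p ∘L oddOp p - Complex.I • (inc 1 p ∘L evenOp p)

theorem fwdZero_apply (k : ℝ) (h : LpV p) : fwdZero k p h = affineOp (-(Complex.I * k)) p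
    (evenOp p (coord 0 p h) + Complex.I • oddOp p (coord 1 p h)) := rfl

theorem fwdOne_apply (h : LpV p) :
    fwdOne p h = oddOp p (coord 0 p h) + Complex.I • evenOp p (coord 1 p h) := rfl

theorem bwdZero_apply (k : ℝ) (f : LpC p) : bwdZero k p f = ((1 + k ^ 2 : ℂ)⁻¹) •
    (inc 0 p (evenOp p (affineOp (Complex.I * k) p f)) -
      Complex.I • inc 1 p (oddOp p (affineOp (Complex.I * k) p f))) := rfl

theorem bwdOne_apply (f : LpC p) :
    bwdOne p f = inc 0 p (oddOp p f) - Complex.I • inc 1 p (evenOp p f) := rfl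

theorem one_add_sq_ne_zero (k : ℝ) : (1 + k ^ 2 : ℂ) ≠ 0 := by
  have : (1 + k ^ 2 : ℝ) ≠ 0 := by positivity
  exact_mod_cast this

@[simp]
-- This rests on (1 - ik sgn)(1 + ik sgn) = 1 + k² and on E and O being complementary projections.
-- Like its three companions it is formal in R² = sgn² = 1 and R sgn = -sgn R. Only the composition
-- in this order is needed: on L₂, injectivity of the forward map comes from its norm identity.
theorem fwdZero_bwdZero (k : ℝ) (f : LpC p) : fwdZero k p (bwdZero k p f) = f := by
  have hk := one_add_sq_ne_zero k
  have hI := Complex.I_sq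
  simp only [fwdZero_apply, bwdZero_apply, affineOp_apply, evenOp_apply, oddOp_apply, map_add,
    map_sub, map_smul, map_neg, coord_inc, coord_zero_inc_one, coord_one_inc_zero, reflect_reflect,
    sgnOp_sgnOp, reflect_sgnOp, map_zero]
  match_scalars <;> grobner

@[simp]
theorem fwdZero_bwdOne (k : ℝ) (f : LpC p) : fwdZero k p (bwdOne p f) = 0 := by
  have hI := Complex.I_sq
  simp only [fwdZero_apply, bwdOne_apply, affineOp_apply, evenOp_apply, oddOp_apply, map_add,
    map_sub, map_smul, coord_inc, coord_zero_inc_one, coord_one_inc_zero, reflect_reflect,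
    map_zero]
  match_scalars <;> grobner

@[simp]
theorem fwdOne_bwdZero (k : ℝ) (f : LpC p) : fwdOne p (bwdZero k p f) = 0 := by
  have hI := Complex.I_sq
  simp only [fwdOne_apply, bwdZero_apply, affineOp_apply, evenOp_apply, oddOp_apply, map_add,
    map_sub, map_smul, map_neg, coord_inc, coord_zero_inc_one, coord_one_inc_zero, reflect_reflect,
    reflect_sgnOp, map_zero]
  match_scalars <;> grobner

@[simp]
theorem fwdOne_bwdOne (f : LpC p) : fwdOne p (bwdOne p f) = f := by
  have hI := Complex.I_sq
  simp only [fwdOne_apply, bwdOne_apply, evenOp_apply, oddOp_apply, map_add,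
    map_sub, map_smul, coord_inc, coord_zero_inc_one, coord_one_inc_zero, reflect_reflect,
    map_zero]
  match_scalars <;> grobner

/-- The extension of a scalar operator to vector fields, through the diagonalization. -/
def extend (k : ℝ) (C : LpC p →L[ℂ] LpC p) : LpV p →L[ℂ] LpV p :=
  bwdZero k p ∘L C ∘L fwdZero k p + bwdOne p ∘L C ∘L fwdOne p

theorem extend_apply (k : ℝ) (C : LpC p →L[ℂ] LpC p) (h : LpV p) :
    extend k C h = bwdZero k p (C (fwdZero k p h)) + bwdOne p (C (fwdOne p h)) := rfl

theorem fwdZero_extend (k : ℝ) (C : LpC p →L[ℂ] LpC p) (h : LpV p) :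
    fwdZero k p (extend k C h) = C (fwdZero k p h) := by
  rw [extend_apply, map_add, fwdZero_bwdZero, fwdZero_bwdOne, add_zero]

theorem fwdOne_extend (k : ℝ) (C : LpC p →L[ℂ] LpC p) (h : LpV p) :
    fwdOne p (extend k C h) = C (fwdOne p h) := by
  rw [extend_apply, map_add, fwdOne_bwdZero, fwdOne_bwdOne, zero_add]

end Operators

/-! ### Compatibility of operators on `L_p` and `L₂` -/

/-- Two operators, on `L_p` and on `L₂`, agree on `L_p ∩ L₂`. -/
def Compatible {E F : Type} [NormedAddCommGroup E] [NormedAddCommGroup F] [NormedSpace ℂ E]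
    [NormedSpace ℂ F] {p : ℝ≥0∞} [Fact (1 ≤ p)]
    (A : Lp E p (volume : Measure ℝ) →L[ℂ] Lp F p (volume : Measure ℝ))
    (B : Lp E 2 (volume : Measure ℝ) →L[ℂ] Lp F 2 (volume : Measure ℝ)) : Prop :=
  ∀ (f : Lp E p (volume : Measure ℝ)) (g : Lp E 2 (volume : Measure ℝ)), f =ᵐ[volume] g →
    A f =ᵐ[volume] B g

namespace Compatible

variable {E F G : Type} [NormedAddCommGroup E] [NormedAddCommGroup F] [NormedAddCommGroup G]
  [NormedSpace ℂ E] [NormedSpace ℂ F] [NormedSpace ℂ G] {p : ℝ≥0∞} [Fact (1 ≤ p)]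
  {A A' : Lp E p (volume : Measure ℝ) →L[ℂ] Lp F p (volume : Measure ℝ)}
  {B B' : Lp E 2 (volume : Measure ℝ) →L[ℂ] Lp F 2 (volume : Measure ℝ)}

theorem comp {A₁ : Lp F p (volume : Measure ℝ) →L[ℂ] Lp G p (volume : Measure ℝ)}
    {B₁ : Lp F 2 (volume : Measure ℝ) →L[ℂ] Lp G 2 (volume : Measure ℝ)}
    (h₁ : Compatible A₁ B₁) (h : Compatible A B) : Compatible (A₁ ∘L A) (B₁ ∘L B) :=
  fun f g hfg => h₁ _ _ (h f g hfg)

theorem add (h : Compatible A B) (h' : Compatible A' B') : Compatible (A + A') (B + B') :=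
  fun f g hfg => (Lp.coeFn_add _ _).trans (((h f g hfg).add (h' f g hfg)).trans
    (Lp.coeFn_add _ _).symm)

theorem sub (h : Compatible A B) (h' : Compatible A' B') : Compatible (A - A') (B - B') :=
  fun f g hfg => (Lp.coeFn_sub _ _).trans (((h f g hfg).sub (h' f g hfg)).trans
    (Lp.coeFn_sub _ _).symm)

theorem smul (c : ℂ) (h : Compatible A B) : Compatible (c • A) (c • B) :=
  fun f g hfg => (Lp.coeFn_smul _ _).trans (((h f g hfg).const_smul c).trans
    (Lp.coeFn_smul _ _).symm)

theorem id : Compatible (ContinuousLinearMap.id ℂ (Lp E p (volume : Measure ℝ)))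
    (ContinuousLinearMap.id ℂ (Lp E 2 (volume : Measure ℝ))) := fun _ _ h => h

theorem compLpL (L : E →L[ℂ] F) : Compatible (L.compLpL p volume) (L.compLpL 2 volume) :=
  fun f g hfg => by
    filter_upwards [hfg, ContinuousLinearMap.coeFn_compLpL (p := p) L f,
      ContinuousLinearMap.coeFn_compLpL (p := 2) L g] with x h1 h2 h3
    rw [h2, h3, h1]

theorem reflect : Compatible (reflect p) (JumpBVP.reflect 2) := fun f g hfg => by
  filter_upwards [ae_comp_neg hfg, coeFn_reflect f, coeFn_reflect g] with x h1 h2 h3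
  rw [h2, h3, h1]

theorem sgnOp : Compatible (sgnOp p) (JumpBVP.sgnOp 2) := fun f g hfg => by
  filter_upwards [hfg, coeFn_sgnOp f, coeFn_sgnOp g] with x h1 h2 h3
  rw [h2, h3, h1]

theorem evenOp : Compatible (evenOp p) (JumpBVP.evenOp 2) := (id.add reflect).smul _

theorem oddOp : Compatible (oddOp p) (JumpBVP.oddOp 2) := (id.sub reflect).smul _

theorem affineOp (c : ℂ) : Compatible (affineOp c p) (JumpBVP.affineOp c 2) :=
  id.add (sgnOp.smul c)

/-- Apart from C, only coordinates, reflection and multiplication by sgn enter, and these are given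
by the same formula on every L_p. -/
theorem extend (k : ℝ) {C : LpC p →L[ℂ] LpC p} {C₂ : LpC 2 →L[ℂ] LpC 2} (h : Compatible C C₂) :
    Compatible (extend k C) (JumpBVP.extend k C₂) := by
  have c : ∀ i, Compatible (coord i p) (coord i 2) := fun i => compLpL _
  have j : ∀ i, Compatible (inc i p) (inc i 2) := fun i => compLpL _
  have f0 : Compatible (fwdZero k p) (fwdZero k 2) :=
    (affineOp _).comp ((evenOp.comp (c 0)).add ((oddOp.comp (c 1)).smul _))
  have f1 : Compatible (fwdOne p) (fwdOne 2) :=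
    (oddOp.comp (c 0)).add ((evenOp.comp (c 1)).smul _)
  have b0 : Compatible (bwdZero k p) (bwdZero k 2) :=
    ((((j 0).comp evenOp).sub (((j 1).comp oddOp).smul _)).comp (affineOp _)).smul _
  have b1 : Compatible (bwdOne p) (bwdOne 2) :=
    ((j 0).comp oddOp).sub (((j 1).comp evenOp).smul _)
  exact (b0.comp (h.comp f0)).add (b1.comp (h.comp f1))

end Compatible

/-! ### The spectral representation of `T_k` -/

open scoped FourierTransform

theorem ofReal_norm_sq_Lp {X E : Type} [MeasurableSpace X] {μ : Measure X} [NormedAddCommGroup E]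
    (f : Lp E 2 μ) : ENNReal.ofReal (‖f‖ ^ 2) = ∫⁻ x, ‖f x‖ₑ ^ 2 ∂μ := by
  have h := eLpNorm_eq_lintegral_rpow_enorm_toReal (μ := μ) two_ne_zero ENNReal.ofNat_ne_top
    (f := (f : X → E)) (p := 2)
  simp only [ENNReal.toReal_ofNat, ENNReal.rpow_ofNat] at h
  rw [ENNReal.ofReal_pow (norm_nonneg _), Lp.norm_def, ENNReal.ofReal_toReal (Lp.memLp f).2.ne, h,
    ← ENNReal.rpow_natCast, ← ENNReal.rpow_mul]
  norm_num

theorem norm_sq_coord (h : LpV 2) : ‖h‖ ^ 2 = ‖coord 0 2 h‖ ^ 2 + ‖coord 1 2 h‖ ^ 2 := by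
  have e : ENNReal.ofReal (‖h‖ ^ 2) =
      ENNReal.ofReal (‖coord 0 2 h‖ ^ 2 + ‖coord 1 2 h‖ ^ 2) := by
    rw [ENNReal.ofReal_add (by positivity) (by positivity), ofReal_norm_sq_Lp, ofReal_norm_sq_Lp,
      ofReal_norm_sq_Lp, ← lintegral_add_left' ((Lp.memLp _).1.enorm.pow_const 2)]
    refine lintegral_congr_ae ?_
    filter_upwards [coeFn_coord 0 h, coeFn_coord 1 h] with x h0 h1
    rw [h0, h1, ← ofReal_norm, ← ofReal_norm, ← ofReal_norm, ← ENNReal.ofReal_pow (norm_nonneg _),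
      ← ENNReal.ofReal_pow (norm_nonneg _), ← ENNReal.ofReal_pow (norm_nonneg _),
      ← ENNReal.ofReal_add (by positivity) (by positivity), EuclideanSpace.norm_sq_eq,
      Fin.sum_univ_two]
  exact (ENNReal.ofReal_eq_ofReal_iff (by positivity) (by positivity)).1 e

/-- The multiplier 1 - ik sgn has constant modulus √(1 + k²) off the origin. -/
theorem norm_affineOp (k : ℝ) (f : LpC 2) :
    ‖affineOp (-(Complex.I * k)) 2 f‖ ^ 2 = (1 + k ^ 2) * ‖f‖ ^ 2 := by
  have e : ‖affineOp (-(Complex.I * k)) 2 f‖ = ‖((Real.sqrt (1 + k ^ 2) : ℝ) : ℂ) • f‖ := by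
    rw [Lp.norm_def, Lp.norm_def]
    congr 1
    refine eLpNorm_congr_norm_ae ?_
    rw [affineOp_apply]
    filter_upwards [Lp.coeFn_add f (-(Complex.I * k) • sgnOp 2 f),
      Lp.coeFn_smul (-(Complex.I * k)) (sgnOp 2 f), coeFn_sgnOp f, ae_ne_zero,
      Lp.coeFn_smul ((Real.sqrt (1 + k ^ 2) : ℝ) : ℂ) f] with x h1 h2 h3 h4 h5
    rw [h1, h5, Pi.add_apply, h2, Pi.smul_apply, Pi.smul_apply, h3, smul_eq_mul, smul_eq_mul]
    have h6 : f x + -(Complex.I * k) * (sgn x * f x) =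
        (((1 : ℝ) : ℂ) + ((-(k * Real.sign x) : ℝ) : ℂ) * Complex.I) * f x := by
      simp only [sgn]
      push_cast
      ring
    have h7 : Real.sign x ^ 2 = 1 := by
      rcases h4.lt_or_gt with h | h
      · rw [Real.sign_of_neg h]; norm_num
      · rw [Real.sign_of_pos h]; norm_num
    rw [h6, norm_mul, norm_mul, Complex.norm_add_mul_I, Complex.norm_real,
      Real.norm_of_nonneg (Real.sqrt_nonneg _), neg_sq, mul_pow, h7, mul_one, one_pow]
  rw [e, norm_smul, mul_pow, Complex.norm_real, Real.norm_of_nonneg (Real.sqrt_nonneg _),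
    Real.sq_sqrt (by positivity)]

/-- With a = (x + iy)/2 and b = R(x - iy)/2 the two combinations are a + b and a - b; apply the
parallelogram law twice, together with the isometry of R. -/
theorem norm_sq_parity (x y : LpC 2) :
    ‖evenOp 2 x + Complex.I • oddOp 2 y‖ ^ 2 + ‖oddOp 2 x + Complex.I • evenOp 2 y‖ ^ 2 =
      ‖x‖ ^ 2 + ‖y‖ ^ 2 := by
  set a := (1 / 2 : ℂ) • (x + Complex.I • y) with ha
  set b := reflect 2 ((1 / 2 : ℂ) • (x - Complex.I • y)) with hb
  have e1 : evenOp 2 x + Complex.I • oddOp 2 y = a + b := by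
    simp only [evenOp_apply, oddOp_apply, ha, hb, map_smul, map_sub]
    module
  have e2 : oddOp 2 x + Complex.I • evenOp 2 y = a - b := by
    simp only [evenOp_apply, oddOp_apply, ha, hb, map_smul, map_sub]
    module
  have p1 := parallelogram_law_with_norm ℂ a b
  have p2 := parallelogram_law_with_norm ℂ x (Complex.I • y)
  have n1 : ‖a‖ = 1 / 2 * ‖x + Complex.I • y‖ := by rw [ha, norm_smul]; norm_num
  have n2 : ‖b‖ = 1 / 2 * ‖x - Complex.I • y‖ := by rw [hb, norm_reflect, norm_smul]; norm_num
  have n3 : ‖Complex.I • y‖ = ‖y‖ := by rw [norm_smul, Complex.norm_I, one_mul]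
  rw [n3] at p2
  rw [n1, n2] at p1
  rw [e1, e2]
  linarith

theorem norm_sq_fwd (k : ℝ) (h : LpV 2) :
    (1 + k ^ 2)⁻¹ * ‖fwdZero k 2 h‖ ^ 2 + ‖fwdOne 2 h‖ ^ 2 = ‖h‖ ^ 2 := by
  rw [fwdZero_apply, norm_affineOp, ← mul_assoc, inv_mul_cancel₀ (by positivity), one_mul,
    fwdOne_apply, norm_sq_parity, norm_sq_coord]

/-! ### The space L₂ over two copies of the line. -/

theorem measurableEmbedding_inl : MeasurableEmbedding (Sum.inl : ℝ → ℝ ⊕ ℝ) :=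
  ⟨Sum.inl_injective, measurable_inl, fun _ h => measurableSet_inl_image.2 h⟩

theorem measurableEmbedding_inr : MeasurableEmbedding (Sum.inr : ℝ → ℝ ⊕ ℝ) :=
  ⟨Sum.inr_injective, measurable_inr, fun _ h => measurableSet_inr_image.2 h⟩

/-- Two copies of Lebesgue measure. -/
def doubleVolume : Measure (ℝ ⊕ ℝ) :=
  (volume : Measure ℝ).map Sum.inl + (volume : Measure ℝ).map Sum.inr

theorem ae_doubleVolume {P : ℝ ⊕ ℝ → Prop} :
    (∀ᵐ x ∂doubleVolume, P x) ↔ (∀ᵐ ξ : ℝ, P (Sum.inl ξ)) ∧ ∀ᵐ ξ : ℝ, P (Sum.inr ξ) := by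
  rw [doubleVolume, ae_add_measure_iff, measurableEmbedding_inl.ae_map_iff,
    measurableEmbedding_inr.ae_map_iff]

theorem lintegral_doubleVolume (f : ℝ ⊕ ℝ → ℝ≥0∞) : ∫⁻ x, f x ∂doubleVolume =
    (∫⁻ ξ : ℝ, f (Sum.inl ξ)) + ∫⁻ ξ : ℝ, f (Sum.inr ξ) := by
  rw [doubleVolume, lintegral_add_measure, measurableEmbedding_inl.lintegral_map,
    measurableEmbedding_inr.lintegral_map]

theorem aestronglyMeasurable_doubleVolume {f : ℝ ⊕ ℝ → ℂ} :
    AEStronglyMeasurable f doubleVolume ↔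
      AEStronglyMeasurable (fun ξ => f (Sum.inl ξ)) (volume : Measure ℝ) ∧
        AEStronglyMeasurable (fun ξ => f (Sum.inr ξ)) (volume : Measure ℝ) := by
  rw [doubleVolume, aestronglyMeasurable_add_measure_iff,
    measurableEmbedding_inl.aestronglyMeasurable_map_iff,
    measurableEmbedding_inr.aestronglyMeasurable_map_iff]
  rfl

theorem memLp_sumElim (u v : LpC 2) : MemLp (Sum.elim u v) 2 doubleVolume := by
  refine ⟨?_, ?_⟩
  · exact aestronglyMeasurable_doubleVolume.2 ⟨(Lp.memLp u).1, (Lp.memLp v).1⟩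
  · rw [eLpNorm_lt_top_iff_lintegral_rpow_enorm_lt_top two_ne_zero ENNReal.ofNat_ne_top,
      lintegral_doubleVolume, ENNReal.add_lt_top]
    exact ⟨lintegral_rpow_enorm_lt_top_of_eLpNorm_lt_top two_ne_zero ENNReal.ofNat_ne_top
      (Lp.memLp u).2, lintegral_rpow_enorm_lt_top_of_eLpNorm_lt_top two_ne_zero
      ENNReal.ofNat_ne_top (Lp.memLp v).2⟩

/-- The function on two copies of `ℝ` which consists of `u` and `v`. -/
def join (u v : LpC 2) : Lp ℂ 2 doubleVolume := (memLp_sumElim u v).toLp _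

theorem coeFn_join (u v : LpC 2) : (∀ᵐ ξ : ℝ, join u v (Sum.inl ξ) = u ξ) ∧
    ∀ᵐ ξ : ℝ, join u v (Sum.inr ξ) = v ξ :=
  ae_doubleVolume.1 (memLp_sumElim u v).coeFn_toLp

theorem norm_sq_join (u v : LpC 2) : ‖join u v‖ ^ 2 = ‖u‖ ^ 2 + ‖v‖ ^ 2 := by
  have e : ENNReal.ofReal (‖join u v‖ ^ 2) = ENNReal.ofReal (‖u‖ ^ 2 + ‖v‖ ^ 2) := by
    rw [ENNReal.ofReal_add (by positivity) (by positivity), ofReal_norm_sq_Lp, ofReal_norm_sq_Lp,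
      ofReal_norm_sq_Lp, lintegral_doubleVolume]
    congr 1
    · exact lintegral_congr_ae ((coeFn_join u v).1.mono fun ξ h => by simp only [h])
    · exact lintegral_congr_ae ((coeFn_join u v).2.mono fun ξ h => by simp only [h])
  exact (ENNReal.ofReal_eq_ofReal_iff (by positivity) (by positivity)).1 e

theorem join_add (u v u' v' : LpC 2) : join (u + u') (v + v') = join u v + join u' v' := by
  apply Lp.ext
  obtain ⟨a1, a2⟩ := ae_doubleVolume.1 (Lp.coeFn_add (join u v) (join u' v'))
  refine ae_doubleVolume.2 ⟨?_, ?_⟩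
  · filter_upwards [a1, (coeFn_join (u + u') (v + v')).1, (coeFn_join u v).1, (coeFn_join u' v').1,
      Lp.coeFn_add u u'] with ξ h1 h2 h3 h4 h5
    rw [h1, h2, Pi.add_apply, h3, h4, h5, Pi.add_apply]
  · filter_upwards [a2, (coeFn_join (u + u') (v + v')).2, (coeFn_join u v).2, (coeFn_join u' v').2,
      Lp.coeFn_add v v'] with ξ h1 h2 h3 h4 h5
    rw [h1, h2, Pi.add_apply, h3, h4, h5, Pi.add_apply]

theorem join_smul (c : ℂ) (u v : LpC 2) : join (c • u) (c • v) = c • join u v := by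
  apply Lp.ext
  obtain ⟨a1, a2⟩ := ae_doubleVolume.1 (Lp.coeFn_smul c (join u v))
  refine ae_doubleVolume.2 ⟨?_, ?_⟩
  · filter_upwards [a1, (coeFn_join (c • u) (c • v)).1, (coeFn_join u v).1,
      Lp.coeFn_smul c u] with ξ h1 h2 h3 h5
    rw [h1, h2, Pi.smul_apply, h3, h5, Pi.smul_apply]
  · filter_upwards [a2, (coeFn_join (c • u) (c • v)).2, (coeFn_join u v).2,
      Lp.coeFn_smul c v] with ξ h1 h2 h3 h5
    rw [h1, h2, Pi.smul_apply, h3, h5, Pi.smul_apply]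

theorem exists_join_eq (G : Lp ℂ 2 doubleVolume) : ∃ u v : LpC 2, join u v = G := by
  have hm : AEStronglyMeasurable (fun ξ => G (Sum.inl ξ)) (volume : Measure ℝ) ∧
      AEStronglyMeasurable (fun ξ => G (Sum.inr ξ)) (volume : Measure ℝ) := by
    exact aestronglyMeasurable_doubleVolume.1 (Lp.memLp G).1
  have hn := lintegral_rpow_enorm_lt_top_of_eLpNorm_lt_top two_ne_zero ENNReal.ofNat_ne_top
    (Lp.memLp G).2
  rw [lintegral_doubleVolume, ENNReal.add_lt_top] at hn
  have m1 : MemLp (fun ξ => G (Sum.inl ξ)) 2 (volume : Measure ℝ) := ⟨hm.1,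
    (eLpNorm_lt_top_iff_lintegral_rpow_enorm_lt_top two_ne_zero ENNReal.ofNat_ne_top).2 hn.1⟩
  have m2 : MemLp (fun ξ => G (Sum.inr ξ)) 2 (volume : Measure ℝ) := ⟨hm.2,
    (eLpNorm_lt_top_iff_lintegral_rpow_enorm_lt_top two_ne_zero ENNReal.ofNat_ne_top).2 hn.2⟩
  refine ⟨m1.toLp _, m2.toLp _, Lp.ext (ae_doubleVolume.2 ⟨?_, ?_⟩)⟩
  · filter_upwards [(coeFn_join (m1.toLp _) (m2.toLp _)).1, m1.coeFn_toLp] with ξ h1 h2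
    rw [h1, h2]
  · filter_upwards [(coeFn_join (m1.toLp _) (m2.toLp _)).2, m2.coeFn_toLp] with ξ h1 h2
    rw [h1, h2]

/-- The unitary map which diagonalizes `T_k`. -/
theorem exists_spectralMap (k : ℝ) : ∃ V : LpV 2 ≃ₗᵢ[ℂ] Lp ℂ 2 doubleVolume, ∀ h,
    V h = join ((((Real.sqrt (1 + k ^ 2))⁻¹ : ℝ) : ℂ) • (𝓕 (fwdZero k 2 h) : LpC 2))
      (𝓕 (fwdOne 2 h) : LpC 2) := by
  set c : ℂ := (((Real.sqrt (1 + k ^ 2))⁻¹ : ℝ) : ℂ) with hc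
  have hk : 0 < 1 + k ^ 2 := by positivity
  have hc2 : ‖c‖ ^ 2 = (1 + k ^ 2)⁻¹ := by
    rw [hc, Complex.norm_real, Real.norm_of_nonneg (by positivity), inv_pow, Real.sq_sqrt hk.le]
  have hc0 : c ≠ 0 := by
    intro h
    rw [h, norm_zero] at hc2
    have := inv_pos.2 hk
    simp at hc2
    linarith
  let L : LpV 2 →ₗ[ℂ] Lp ℂ 2 doubleVolume :=
    { toFun := fun h => join (c • (𝓕 (fwdZero k 2 h) : LpC 2)) (𝓕 (fwdOne 2 h) : LpC 2)
      map_add' := fun h h' => by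
        have e1 : 𝓕 (fwdZero k 2 h + fwdZero k 2 h') = 𝓕 (fwdZero k 2 h) + 𝓕 (fwdZero k 2 h') :=
          FourierAdd.fourier_add _ _
        have e2 : 𝓕 (fwdOne 2 h + fwdOne 2 h') = 𝓕 (fwdOne 2 h) + 𝓕 (fwdOne 2 h') :=
          FourierAdd.fourier_add _ _
        rw [map_add, map_add, e1, e2, smul_add, join_add]
      map_smul' := fun d h => by
        have e1 : 𝓕 (d • fwdZero k 2 h) = d • 𝓕 (fwdZero k 2 h) := FourierSMul.fourier_smul _ _
        have e2 : 𝓕 (d • fwdOne 2 h) = d • 𝓕 (fwdOne 2 h) := FourierSMul.fourier_smul _ _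
        rw [map_smul, map_smul, e1, e2, smul_comm, join_smul, RingHom.id_apply] }
  have hL : ∀ h, L h = join (c • (𝓕 (fwdZero k 2 h) : LpC 2)) (𝓕 (fwdOne 2 h) : LpC 2) :=
    fun h => rfl
  have hn : ∀ h, ‖L h‖ = ‖h‖ := by
    intro h
    rw [← sq_eq_sq₀ (norm_nonneg _) (norm_nonneg _), hL, norm_sq_join, norm_smul, mul_pow, hc2,
      Lp.norm_fourier_eq, Lp.norm_fourier_eq, norm_sq_fwd]
  have hs : Function.Surjective L := by
    intro G
    obtain ⟨u, v, rfl⟩ := exists_join_eq G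
    -- The explicit inverse transformation supplies the preimage, and the cross terms vanish.
    refine ⟨bwdZero k 2 (𝓕⁻ (c⁻¹ • u)) + bwdOne 2 (𝓕⁻ v), ?_⟩
    rw [hL, map_add, map_add, fwdZero_bwdZero, fwdZero_bwdOne, fwdOne_bwdZero, fwdOne_bwdOne,
      add_zero, zero_add]
    have e1 : 𝓕 (𝓕⁻ (c⁻¹ • u)) = c⁻¹ • u := FourierTransform.fourier_fourierInv_eq _
    have e2 : 𝓕 (𝓕⁻ v) = v := FourierTransform.fourier_fourierInv_eq _
    rw [e1, e2, smul_inv_smul₀ hc0]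
  exact ⟨LinearIsometryEquiv.ofSurjective ⟨L, hn⟩ hs, fun h => rfl⟩

/-! ### The graph of T_k in the diagonalizing coordinates. -/

section Graph

variable {v w v' w' : LpC 2}

theorem IsWeakDeriv.congr_eq (h : IsWeakDeriv v w) (hv : v = v') (hw : w = w') :
    IsWeakDeriv v' w' := by
  subst hv hw
  exact h

theorem IsWeakDeriv.reflect (h : IsWeakDeriv v w) :
    IsWeakDeriv (JumpBVP.reflect 2 v) (-JumpBVP.reflect 2 w : LpC 2) := by
  refine h.comp_neg.congr (coeFn_reflect v).symm ?_
  filter_upwards [coeFn_reflect w, Lp.coeFn_neg (JumpBVP.reflect 2 w)] with x h1 h2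
  rw [h2, Pi.neg_apply, h1]

theorem IsWeakDeriv.evenOp (h : IsWeakDeriv v w) :
    IsWeakDeriv (JumpBVP.evenOp 2 v) (oddOp 2 w) := by
  have := (h.add h.reflect).smul (1 / 2 : ℂ)
  rwa [← sub_eq_add_neg] at this

theorem IsWeakDeriv.oddOp (h : IsWeakDeriv v w) :
    IsWeakDeriv (JumpBVP.oddOp 2 v) (JumpBVP.evenOp 2 w) := by
  have := (h.add (h.reflect.smul (-1))).smul (1 / 2 : ℂ)
  rwa [neg_one_smul, neg_one_smul, neg_neg, ← sub_eq_add_neg] at this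

/-- The product of the odd part with `sgn` is weakly differentiable. -/
theorem IsWeakDeriv.sgnOp_oddOp (h : IsWeakDeriv v w) :
    IsWeakDeriv (sgnOp 2 (JumpBVP.oddOp 2 v)) (sgnOp 2 (JumpBVP.evenOp 2 w)) := by
  refine (h.oddOp.sgn_mul (locallyIntegrable_coe_Lp _) (locallyIntegrable_coe_Lp _) ?_).congr
    (coeFn_sgnOp _).symm (coeFn_sgnOp _).symm
  have e : JumpBVP.reflect 2 (JumpBVP.oddOp 2 v) = -JumpBVP.oddOp 2 v := by
    simp only [oddOp_apply, map_smul, map_sub, reflect_reflect]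
    module
  filter_upwards [coeFn_reflect (JumpBVP.oddOp 2 v), Lp.coeFn_neg (JumpBVP.oddOp 2 v)] with x h1 h2
  rw [← h1, e, h2, Pi.neg_apply]

/-- The graph of `T_k` in terms of `f₀`, `f₁ - k sgn f₀`, `-g₁` and `g₀ + k sgn g₁`. -/
theorem graphT_iff_coord (k : ℝ) (f g : LpV 2) : graphT k f g ↔
    IsWeakDeriv (coord 0 2 f) (-coord 1 2 g : LpC 2) ∧
      IsWeakDeriv (coord 1 2 f - (k : ℂ) • sgnOp 2 (coord 0 2 f) : LpC 2)
        (coord 0 2 g + (k : ℂ) • sgnOp 2 (coord 1 2 g) : LpC 2) := by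
  have hcoe : (coord 1 2 f - (k : ℂ) • sgnOp 2 (coord 0 2 f) : LpC 2) =ᵐ[volume]
      fun x => f x 1 - (k : ℂ) * sgn x * f x 0 := by
    filter_upwards [Lp.coeFn_sub (coord 1 2 f) ((k : ℂ) • sgnOp 2 (coord 0 2 f)),
      Lp.coeFn_smul (k : ℂ) (sgnOp 2 (coord 0 2 f)), coeFn_sgnOp (coord 0 2 f), coeFn_coord 0 f,
      coeFn_coord 1 f] with x h1 h2 h3 h4 h5
    rw [h1, Pi.sub_apply, h2, Pi.smul_apply, h3, h4, h5, smul_eq_mul, mul_assoc]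
  have ha : (-coord 1 2 g : LpC 2) =ᵐ[volume] fun x => -g x 1 := by
    filter_upwards [Lp.coeFn_neg (coord 1 2 g), coeFn_coord 1 g] with x h5 h6
    rw [h5, Pi.neg_apply, h6]
  have hb : (coord 0 2 g + (k : ℂ) • sgnOp 2 (coord 1 2 g) : LpC 2) =ᵐ[volume]
      fun x => g x 0 + k * sgn x * g x 1 := by
    filter_upwards [Lp.coeFn_add (coord 0 2 g) ((k : ℂ) • sgnOp 2 (coord 1 2 g)),
      Lp.coeFn_smul (k : ℂ) (sgnOp 2 (coord 1 2 g)), coeFn_sgnOp (coord 1 2 g), coeFn_coord 0 g,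
      coeFn_coord 1 g] with x h5 h6 h7 h8 h9
    rw [h5, Pi.add_apply, h6, Pi.smul_apply, h7, h8, h9, smul_eq_mul, mul_assoc]
  constructor
  · rintro ⟨a', b', -, -, h1, h2, h3⟩
    refine ⟨h1.congr (coeFn_coord 0 f).symm ?_, h2.congr hcoe.symm ?_⟩
    · filter_upwards [h3, ha] with x h4 h5
      rw [h5, h4.2, neg_neg]
    · filter_upwards [h3, hb] with x h4 h5
      rw [h5, h4.1, h4.2]
      ring
  · rintro ⟨h1, h2⟩
    refine ⟨_, _, Lp.memLp _, Lp.memLp _, h1.congr (coeFn_coord 0 f) (ae_eq_refl _),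
      h2.congr hcoe (ae_eq_refl _), ?_⟩
    filter_upwards [ha, hb] with x h4 h5
    rw [h4, h5]
    constructor <;> ring

set_option maxHeartbeats 2000000 in
-- The transformation intertwines T_k with two copies of D = -i d/dx. Each H¹ condition is a linear
-- combination of those on the other side, formed with E, O and sgn O, all of which preserve weak
-- differentiability; the rest is comparison of coefficients.
theorem graphT_iff (k : ℝ) (f g : LpV 2) : graphT k f g ↔
    IsWeakDeriv (fwdZero k 2 f) (Complex.I • fwdZero k 2 g : LpC 2) ∧
      IsWeakDeriv (fwdOne 2 f) (Complex.I • fwdOne 2 g : LpC 2) := by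
  have hI := Complex.I_sq
  have hk := one_add_sq_ne_zero k
  rw [graphT_iff_coord]
  simp only [fwdZero_apply, fwdOne_apply]
  generalize coord 0 2 f = f₀
  generalize coord 1 2 f = f₁
  generalize coord 0 2 g = g₀
  generalize coord 1 2 g = g₁
  constructor
  · rintro ⟨h1, h2⟩
    constructor
    -- With w = f₁ - k sgn f₀, the first coordinate equals (1 + k²) E f₀ + i O w + k sgn O w, where
    -- sgn meets only an odd function.
    · have := ((h1.evenOp.smul (1 + k ^ 2)).add (h2.oddOp.smul Complex.I)).add
        (h2.sgnOp_oddOp.smul k)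
      refine this.congr_eq ?_ ?_
      all_goals
        simp only [affineOp_apply, evenOp_apply, oddOp_apply, map_add, map_sub,
          map_smul, map_neg, reflect_sgnOp, sgnOp_sgnOp]
        match_scalars <;> grobner
    -- Here E f₁ = E w + k sgn O f₀, again with sgn against an odd function.
    · have := (h1.oddOp.add (h2.evenOp.smul Complex.I)).add
        (h1.sgnOp_oddOp.smul (Complex.I * k))
      refine this.congr_eq ?_ ?_
      all_goals
        simp only [evenOp_apply, oddOp_apply, map_add, map_sub, map_smul, map_neg, reflect_sgnOp]
        match_scalars <;> grobner
  · rintro ⟨h0, h1⟩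
    -- From the two coordinates one recovers O w, E f₀, O f₀ and E w in turn, where w = f₁ - k sgn
    -- f₀.
    have e1 := h0.oddOp.smul (-Complex.I)
    have e2 := (h0.evenOp.add (h0.sgnOp_oddOp.smul (Complex.I * k))).smul ((1 + k ^ 2 : ℂ)⁻¹)
    have e3 := h1.oddOp
    have e4 := (h1.evenOp.add (h1.sgnOp_oddOp.smul (-(Complex.I * k)))).smul (-Complex.I)
    constructor
    · refine (e2.add e3).congr_eq ?_ ?_
      all_goals
        simp only [affineOp_apply, evenOp_apply, oddOp_apply,
          map_add, map_sub, map_smul, map_neg, reflect_sgnOp, sgnOp_sgnOp, reflect_reflect]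
        match_scalars <;> grobner
    · refine (e1.add e4).congr_eq ?_ ?_
      all_goals
        simp only [affineOp_apply, evenOp_apply, oddOp_apply,
          map_add, map_sub, map_smul, reflect_sgnOp, reflect_reflect]
        match_scalars <;> grobner

end Graph

theorem isWeakDeriv_I_smul_iff (v w : LpC 2) : IsWeakDeriv v (Complex.I • w : LpC 2) ↔
    ∀ᵐ ξ : ℝ, (𝓕 w : LpC 2) ξ = ((2 * Real.pi * ξ : ℝ) : ℂ) * (𝓕 v : LpC 2) ξ := by
  rw [isWeakDeriv_iff_fourier]
  have e : 𝓕 (Complex.I • w) = Complex.I • 𝓕 w := FourierSMul.fourier_smul _ _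
  rw [e]
  refine eventually_congr ?_
  filter_upwards [Lp.coeFn_smul Complex.I (𝓕 w)] with ξ h
  rw [h, Pi.smul_apply, smul_eq_mul]
  constructor
  · intro h1
    refine mul_left_cancel₀ Complex.I_ne_zero (h1.trans ?_)
    push_cast
    ring
  · intro h1
    rw [h1]
    push_cast
    ring

theorem hardySymbol_two_pi_mul (t ξ : ℝ) : hardySymbol t (2 * Real.pi * ξ) = cauchySymbol t ξ := by
  unfold hardySymbol cauchySymbol
  have hπ := Real.pi_pos
  by_cases h : 0 < ξ
  · rw [if_pos (by positivity), if_pos h, abs_of_pos (by positivity)]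
    congr 1
    ring
  · rw [if_neg h, if_neg]
    intro h1
    exact h (pos_of_mul_pos_right h1 (by positivity))

/-- The extension of the Cauchy operator is `e^{-t|T_k|} χ₊(T_k)`. -/
theorem isFunctionOf_extend (k : ℝ) {t : ℝ} (ht : 0 < t) {C : LpC 2 →L[ℂ] LpC 2}
    (hC : ∀ f, C f =ᵐ[volume] fun x => cauchyInt f (pt t x)) :
    IsFunctionOf (graphT k) (hardySymbol t) (extend k C) := by
  obtain ⟨V, hV⟩ := exists_spectralMap k
  have hc0 : (((Real.sqrt (1 + k ^ 2))⁻¹ : ℝ) : ℂ) ≠ 0 := by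
    have : 0 < Real.sqrt (1 + k ^ 2) := Real.sqrt_pos.2 (by positivity)
    exact_mod_cast (inv_pos.2 this).ne'
  set c : ℂ := (((Real.sqrt (1 + k ^ 2))⁻¹ : ℝ) : ℂ)
  have hVl : ∀ h, ∀ᵐ ξ : ℝ, V h (Sum.inl ξ) = c * (𝓕 (fwdZero k 2 h) : LpC 2) ξ := by
    intro h
    rw [hV]
    filter_upwards [(coeFn_join (c • 𝓕 (fwdZero k 2 h)) (𝓕 (fwdOne 2 h))).1,
      Lp.coeFn_smul c (𝓕 (fwdZero k 2 h))] with ξ h1 h2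
    rw [h1, h2, Pi.smul_apply, smul_eq_mul]
  have hVr : ∀ h, ∀ᵐ ξ : ℝ, V h (Sum.inr ξ) = (𝓕 (fwdOne 2 h) : LpC 2) ξ := by
    intro h
    rw [hV]
    exact (coeFn_join (c • 𝓕 (fwdZero k 2 h)) (𝓕 (fwdOne 2 h))).2
  -- On both copies the spectral variable is 2πξ, the symbol of D in the present normalization of
  -- the Fourier transform.
  refine ⟨ℝ ⊕ ℝ, inferInstance, doubleVolume,
    Sum.elim (fun ξ => 2 * Real.pi * ξ) (fun ξ => 2 * Real.pi * ξ), V,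
    Measurable.sumElim (by fun_prop) (by fun_prop), fun f g => ?_, fun f => ?_⟩
  · rw [graphT_iff, isWeakDeriv_I_smul_iff, isWeakDeriv_I_smul_iff, ae_doubleVolume]
    refine and_congr (eventually_congr ?_) (eventually_congr ?_)
    · filter_upwards [hVl f, hVl g] with ξ h1 h2
      rw [h1, h2, Sum.elim_inl, mul_left_comm]
      exact (mul_right_inj' hc0).symm
    · filter_upwards [hVr f, hVr g] with ξ h1 h2
      rw [h1, h2, Sum.elim_inr]
  · refine ae_doubleVolume.2 ⟨?_, ?_⟩
    · filter_upwards [hVl f, hVl (extend k C f), fourier_cauchyOperator ht hC (fwdZero k 2 f)]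
        with ξ h1 h2 h3
      rw [h2, h1, fwdZero_extend, h3, Sum.elim_inl, hardySymbol_two_pi_mul, mul_left_comm]
    · filter_upwards [hVr f, hVr (extend k C f), fourier_cauchyOperator ht hC (fwdOne 2 f)]
        with ξ h1 h2 h3
      rw [h2, h1, fwdOne_extend, h3, Sum.elim_inr, hardySymbol_two_pi_mul]

/-! ### Principal values and the double layer operator -/

theorem HasPV.unique {f : ℝ → ℂ} {x : ℝ} {L L' : ℂ} (h : HasPV f x L) (h' : HasPV f x L') :
    L = L' :=
  tendsto_nhds_unique h h'

theorem HasPV.congr_ae {f g : ℝ → ℂ} {x : ℝ} {L : ℂ} (h : HasPV f x L) (hfg : f =ᵐ[volume] g) :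
    HasPV g x L := by
  refine Tendsto.congr (fun ε => integral_congr_ae (ae_restrict_of_ae ?_)) h
  filter_upwards [hfg] with y hy
  rw [hy]

theorem measurableSet_lt_abs_sub (ε x : ℝ) : MeasurableSet {y : ℝ | ε < |x - y|} :=
  measurableSet_lt measurable_const (by fun_prop)

theorem HasPV.comp_neg {f : ℝ → ℂ} {x : ℝ} {L : ℂ} (h : HasPV f (-x) L) :
    HasPV (fun y => f (-y)) x (-L) := by
  refine Tendsto.congr (fun ε => ?_) (Tendsto.neg h)
  rw [← integral_indicator (measurableSet_lt_abs_sub _ _),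
    ← integral_indicator (measurableSet_lt_abs_sub _ _), ← integral_neg, ← integral_neg_eq_self]
  refine integral_congr_ae (ae_of_all _ fun y => ?_)
  have e : |-x - -y| = |x - y| := by rw [← abs_neg]; ring_nf
  have e' : ((-x - -y : ℝ) : ℂ) = -((x - y : ℝ) : ℂ) := by push_cast; ring
  simp only [Set.indicator_apply, Set.mem_ofPred_eq, e, e', div_neg]
  split_ifs <;> simp

section DoubleLayer

variable {p : ℝ≥0∞} [Fact (1 ≤ p)]

/-- The kernel 1/(x - y) changes sign when both variables are reflected. Only the principal value
description of H enters, through uniqueness of limits. -/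
theorem reflect_hilbert {H : LpC p →L[ℂ] LpC p}
    (hH : ∀ f : LpC p, ∀ᵐ x, HasPV f x (Real.pi * H f x)) (f : LpC p) :
    reflect p (H f) = -H (reflect p f) := by
  apply Lp.ext
  filter_upwards [hH (reflect p f), ae_comp_neg (hH f), coeFn_reflect (H f),
    Lp.coeFn_neg (H (reflect p f))] with x h1 h2 h3 h4
  have h := (h1.congr_ae (coeFn_reflect f)).unique h2.comp_neg
  have hpi : (Real.pi : ℂ) ≠ 0 := by exact_mod_cast Real.pi_ne_zero
  rw [h3, h4, Pi.neg_apply]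
  refine mul_left_cancel₀ hpi ?_
  rw [mul_neg, h, neg_neg]

omit [Fact (1 ≤ p)] in
theorem integrable_div_abs_add_abs (hp : 1 < p) (hp' : p ≠ ⊤) {f : ℝ → ℂ} (hf : MemLp f p volume)
    {x : ℝ} (hx : x ≠ 0) : Integrable (fun y : ℝ => f y / ((|x| + |y| : ℝ) : ℂ)) := by
  have h := integrable_mul_of_decay (k := fun y : ℝ => (((|x| + |y| : ℝ) : ℂ))⁻¹)
    (B := 1 + |x|⁻¹) (by fun_prop) (fun y => ?_) hp hp' hf
  · refine h.congr (ae_of_all _ fun y => ?_)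
    exact (div_eq_inv_mul _ _).symm
  · have hx' := abs_pos.2 hx
    have hy := abs_nonneg y
    rw [norm_inv, Complex.norm_real, Real.norm_of_nonneg (by positivity), inv_le_iff_one_le_mul₀
      (by positivity), mul_assoc, mul_comm, mul_assoc, ← div_eq_inv_mul,
      le_div_iff₀ (by positivity), one_mul]
    have : (|x| + |y|) * (1 + |x|⁻¹) = |x| + |y| + 1 + |y| * |x|⁻¹ := by
      field_simp
      ring
    rw [this]
    nlinarith [mul_nonneg hy (inv_nonneg.2 hx'.le)]

/-- If the signs agree both sides vanish; if they differ, |x - y| = |x| + |y|. This converts the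
singular commutator kernel into the positive kernel in K. -/
theorem sgn_sub_div {x y : ℝ} (hx : x ≠ 0) (hy : y ≠ 0) :
    (sgn x - sgn y) / ((x - y : ℝ) : ℂ) = (1 - sgn x * sgn y) / ((|x| + |y| : ℝ) : ℂ) := by
  rcases hx.lt_or_gt with hx | hx <;> rcases hy.lt_or_gt with hy | hy <;>
    simp only [sgn, Real.sign_of_neg, Real.sign_of_pos, hx, hy, abs_of_neg, abs_of_pos]
  · simp
  · rw [← neg_div_neg_eq]
    push_cast
    ring_nf
  · push_cast
    ring_nf
  · simp

omit [Fact (1 ≤ p)] in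
-- The commutator of sgn with the Hilbert transform has kernel (1 - sgn x sgn y)/(|x| + |y|),
-- without singularity for x ≠ 0. On even f the part with sgn y integrates to zero.
theorem sgn_mul_sub_eq_integral (hp : 1 < p) (hp' : p ≠ ⊤) {f : ℝ → ℂ} (hf : MemLp f p volume)
    (he : ∀ᵐ y, f (-y) = f y) {x : ℝ} (hx : x ≠ 0) {L L' : ℂ} (hL : HasPV f x L)
    (hL' : HasPV (fun y => sgn y * f y) x L') :
    sgn x * L - L' = ∫ y : ℝ, f y / ((|x| + |y| : ℝ) : ℂ) := by
  have hsf : MemLp (fun y => sgn y * f y) p volume := by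
    refine hf.of_le (measurable_sgn.aestronglyMeasurable.mul hf.1) (ae_of_all _ fun y => ?_)
    rw [norm_mul]
    exact mul_le_of_le_one_left (norm_nonneg _) (norm_sgn_le y)
  have hodd : ∫ y : ℝ, (sgn y * f y) / ((|x| + |y| : ℝ) : ℂ) = 0 := by
    have h1 := integral_neg_eq_self (fun y : ℝ => (sgn y * f y) / ((|x| + |y| : ℝ) : ℂ)) volume
    have h2 : ∫ y : ℝ, (sgn (-y) * f (-y)) / ((|x| + |-y| : ℝ) : ℂ) =
        -∫ y : ℝ, (sgn y * f y) / ((|x| + |y| : ℝ) : ℂ) := by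
      rw [← integral_neg]
      refine integral_congr_ae ?_
      filter_upwards [he] with y hy
      rw [hy, sgn_neg, abs_neg]
      ring
    rw [h2] at h1
    exact self_eq_neg.1 h1.symm
  have hint : ∫ y : ℝ, (sgn x - sgn y) * f y / ((x - y : ℝ) : ℂ) =
      ∫ y : ℝ, f y / ((|x| + |y| : ℝ) : ℂ) := by
    have h1 : ∫ y : ℝ, (sgn x - sgn y) * f y / ((x - y : ℝ) : ℂ) =
        ∫ y : ℝ, (f y / ((|x| + |y| : ℝ) : ℂ) -
          sgn x * ((sgn y * f y) / ((|x| + |y| : ℝ) : ℂ))) := by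
      refine integral_congr_ae ?_
      filter_upwards [ae_ne_zero] with y hy
      rw [mul_div_right_comm, sgn_sub_div hx hy]
      ring
    rw [h1, integral_sub (integrable_div_abs_add_abs hp hp' hf hx)
      ((integrable_div_abs_add_abs hp hp' hsf hx).const_mul _), integral_const_mul, hodd, mul_zero,
      sub_zero]
  rw [← hint]
  refine tendsto_nhds_unique ((Tendsto.const_mul (sgn x) hL).sub hL')
    (tendsto_const_nhds.congr' ?_)
  -- For ε < |x| every y removed by the truncation has the sign of x and contributes nothing, so the
  -- truncated commutator no longer depends on ε.
  filter_upwards [Ioo_mem_nhdsGT (abs_pos.2 hx)] with ε hε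
  rw [← integral_const_mul, ← integral_sub
    ((integrable_div_truncated hp hp' hf hε.1 x).const_mul _)
    (integrable_div_truncated hp hp' hsf hε.1 x), ← setIntegral_eq_integral_of_forall_compl_eq_zero
    (s := {y : ℝ | ε < |x - y|}) fun y hy => ?_]
  · refine integral_congr_ae (ae_of_all _ fun y => ?_)
    ring
  · have h1 : |x - y| < |x| := (not_lt.1 hy).trans_lt hε.2
    have h2 : sgn x = sgn y := by
      rw [abs_sub_lt_iff] at h1
      rcases hx.lt_or_gt with h | h
      · rw [abs_of_neg h] at h1
        have hy : y < 0 := by linarith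
        simp only [sgn, Real.sign_of_neg, h, hy]
      · rw [abs_of_pos h] at h1
        have hy : 0 < y := by linarith
        simp only [sgn, Real.sign_of_pos, h, hy]
    rw [h2, sub_self, zero_mul, zero_div]

/-- The double layer operator, expressed through the Hilbert transform `H`. -/
def doubleLayer (H : LpC p →L[ℂ] LpC p) : LpC p →L[ℂ] LpC p :=
  H ∘L sgnOp p ∘L evenOp p + sgnOp p ∘L H ∘L oddOp p

theorem doubleLayer_apply (H : LpC p →L[ℂ] LpC p) (f : LpC p) :
    doubleLayer H f = H (sgnOp p (evenOp p f)) + sgnOp p (H (oddOp p f)) := rfl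

theorem coeFn_evenOp (f : LpC p) : evenOp p f =ᵐ[volume] fun x => (1 / 2 : ℂ) * (f x + f (-x)) := by
  rw [evenOp_apply]
  filter_upwards [Lp.coeFn_smul (1 / 2 : ℂ) (f + reflect p f), Lp.coeFn_add f (reflect p f),
    coeFn_reflect f] with x h1 h2 h3
  rw [h1, Pi.smul_apply, h2, Pi.add_apply, h3, smul_eq_mul]

/-- The integral against 1/(|x| + |y|) sees only E f, where it is π times the commutator (sgn H - H
sgn) E f. Subtracting the commutator from sgn H f leaves H sgn E f + sgn H O f. -/
theorem isDoubleLayer_doubleLayer (hp : 1 < p) (hp' : p ≠ ⊤) {H : LpC p →L[ℂ] LpC p}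
    (hH : ∀ f : LpC p, ∀ᵐ x, HasPV f x (Real.pi * H f x)) : IsDoubleLayer p (doubleLayer H) := by
  intro f
  have hsplit : doubleLayer H f = sgnOp p (H f) -
      (sgnOp p (H (evenOp p f)) - H (sgnOp p (evenOp p f))) := by
    simp only [doubleLayer_apply, evenOp_apply, oddOp_apply, map_add, map_sub, map_smul]
    module
  filter_upwards [hH f, hH (evenOp p f), hH (sgnOp p (evenOp p f)), ae_ne_zero,
    Lp.coeFn_sub (sgnOp p (H f)) (sgnOp p (H (evenOp p f)) - H (sgnOp p (evenOp p f))),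
    Lp.coeFn_sub (sgnOp p (H (evenOp p f))) (H (sgnOp p (evenOp p f))), coeFn_sgnOp (H f),
    coeFn_sgnOp (H (evenOp p f))] with x h1 h2 h3 hx e1 e2 e3 e4
  have hint := integrable_div_abs_add_abs hp hp' (Lp.memLp f) hx
  refine ⟨_, h1, hint, ?_⟩
  have heven : ∀ᵐ y, evenOp p f (-y) = evenOp p f y := by
    filter_upwards [coeFn_evenOp f, ae_comp_neg (coeFn_evenOp f)] with y a b
    rw [a, b, neg_neg, add_comm]
  have h4 := sgn_mul_sub_eq_integral hp hp' (Lp.memLp (evenOp p f)) heven hx h2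
    (h3.congr_ae (coeFn_sgnOp _))
  have h5 : ∫ y : ℝ, evenOp p f y / ((|x| + |y| : ℝ) : ℂ) =
      ∫ y : ℝ, f y / ((|x| + |y| : ℝ) : ℂ) := by
    have h6 : ∫ y : ℝ, evenOp p f y / ((|x| + |y| : ℝ) : ℂ) =
        ∫ y : ℝ, (1 / 2 : ℂ) * (f y / ((|x| + |y| : ℝ) : ℂ) +
          f (-y) / ((|x| + |-y| : ℝ) : ℂ)) := by
      refine integral_congr_ae ?_
      filter_upwards [coeFn_evenOp f] with y hy
      rw [hy, abs_neg]
      ring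
    rw [h6, integral_const_mul, integral_add hint hint.comp_neg,
      integral_neg_eq_self (fun y : ℝ => f y / ((|x| + |y| : ℝ) : ℂ)) volume]
    ring
  have hpi : (Real.pi : ℂ) ≠ 0 := by exact_mod_cast Real.pi_ne_zero
  rw [hsplit, e1, Pi.sub_apply, e2, Pi.sub_apply, e3, e4, ← h5, ← h4]
  push_cast
  field_simp

end DoubleLayer

/-! ### Adjoints with respect to the pairing of `L_q` and `L_p` -/

section Adjoint

variable {p q : ℝ≥0∞} [Fact (1 ≤ p)] [Fact (1 ≤ q)]

/-- The pairing `⟨g, f⟩ = ∫ conj(g) f` as a continuous real bilinear map. -/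
def pairing (p q : ℝ≥0∞) [Fact (1 ≤ p)] [Fact (1 ≤ q)] [ENNReal.HolderConjugate q p] :
    LpC q →L[ℝ] LpC p →L[ℝ] ℂ :=
  ((ContinuousLinearMap.mul ℝ ℂ).comp (Complex.conjCLE : ℂ →L[ℝ] ℂ)).lpPairing volume q p

theorem pairing_apply [ENNReal.HolderConjugate q p] (g : LpC q) (f : LpC p) :
    pairing p q g f = ∫ x, (starRingEnd ℂ) (g x) * f x := by
  rw [pairing, ContinuousLinearMap.lpPairing_eq_integral]
  rfl

theorem isAdjoint_iff [ENNReal.HolderConjugate q p] {M : LpC q →L[ℂ] LpC q}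
    {N : LpC p →L[ℂ] LpC p} :
    IsAdjoint p q M N ↔ ∀ g f, pairing p q (M g) f = pairing p q g (N f) := by
  simp only [pairing_apply]
  rfl

namespace IsAdjoint

theorem one : IsAdjoint p q 1 1 := fun _ _ => rfl

theorem comp {M M' : LpC q →L[ℂ] LpC q} {N N' : LpC p →L[ℂ] LpC p} (h : IsAdjoint p q M N)
    (h' : IsAdjoint p q M' N') : IsAdjoint p q (M ∘L M') (N' ∘L N) := fun g f =>
  (h (M' g) f).trans (h' g (N f))

theorem add [ENNReal.HolderConjugate q p] {M M' : LpC q →L[ℂ] LpC q} {N N' : LpC p →L[ℂ] LpC p}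
    (h : IsAdjoint p q M N) (h' : IsAdjoint p q M' N') : IsAdjoint p q (M + M') (N + N') := by
  rw [isAdjoint_iff] at *
  intro g f
  simp only [_root_.add_apply, map_add, h, h']

theorem smul {M : LpC q →L[ℂ] LpC q} {N : LpC p →L[ℂ] LpC p} (c : ℝ) (h : IsAdjoint p q M N) :
    IsAdjoint p q ((c : ℂ) • M) ((c : ℂ) • N) := fun g f => by
  have h1 : ∫ x, (starRingEnd ℂ) (((c : ℂ) • M) g x) * f x =
      ∫ x, (c : ℂ) * ((starRingEnd ℂ) (M g x) * f x) := by
    refine integral_congr_ae ?_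
    filter_upwards [Lp.coeFn_smul (c : ℂ) (M g)] with x hx
    rw [_root_.smul_apply, hx, Pi.smul_apply, smul_eq_mul, map_mul, Complex.conj_ofReal, mul_assoc]
  have h2 : ∫ x, (starRingEnd ℂ) (g x) * ((c : ℂ) • N) f x =
      ∫ x, (c : ℂ) * ((starRingEnd ℂ) (g x) * N f x) := by
    refine integral_congr_ae ?_
    filter_upwards [Lp.coeFn_smul (c : ℂ) (N f)] with x hx
    rw [_root_.smul_apply, hx, Pi.smul_apply, smul_eq_mul, mul_left_comm]
  rw [h1, h2, integral_const_mul, integral_const_mul, h g f]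

theorem sgnOp : IsAdjoint p q (sgnOp q) (sgnOp p) := fun g f => by
  refine integral_congr_ae ?_
  filter_upwards [coeFn_sgnOp g, coeFn_sgnOp f] with x h1 h2
  rw [h1, h2, map_mul, sgn, Complex.conj_ofReal]
  ring

theorem reflect : IsAdjoint p q (reflect q) (reflect p) := fun g f => by
  rw [← integral_neg_eq_self]
  refine integral_congr_ae ?_
  filter_upwards [ae_comp_neg (coeFn_reflect g), coeFn_reflect f] with x h1 h2
  rw [h1, h2, neg_neg]

theorem evenOp [ENNReal.HolderConjugate q p] : IsAdjoint p q (evenOp q) (evenOp p) := by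
  have h := (one.add reflect : IsAdjoint p q _ _).smul (1 / 2)
  push_cast at h
  exact h

theorem oddOp [ENNReal.HolderConjugate q p] : IsAdjoint p q (oddOp q) (oddOp p) := by
  have h := (one.add (reflect.smul (-1)) : IsAdjoint p q _ _).smul (1 / 2)
  push_cast at h
  simp only [neg_smul, one_smul, ← sub_eq_add_neg] at h
  exact h

/-- At each height the Cauchy operators on L_q and L_p are adjoint to each other, hence so are their
limits (I + iH)/2. The pairing is conjugate-linear in its first argument, so the factor i forces H*
= -H. -/
theorem hilbert [ENNReal.HolderConjugate q p] (hp : 1 < p) (hp' : p ≠ ⊤) (hq : 1 < q)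
    (hq' : q ≠ ⊤) {C : ℝ → LpC p →L[ℂ] LpC p} {H : LpC p →L[ℂ] LpC p}
    {Cq : ℝ → LpC q →L[ℂ] LpC q} {Hq : LpC q →L[ℂ] LpC q}
    (hC : ∀ t : ℝ, 0 < t → ∀ f, C t f =ᵐ[volume] fun x => cauchyInt f (pt t x))
    (hCq : ∀ t : ℝ, 0 < t → ∀ f, Cq t f =ᵐ[volume] fun x => cauchyInt f (pt t x))
    (hH : ∀ f, Tendsto (fun t => C t f) (𝓝[>] 0) (𝓝 ((1 / 2 : ℂ) • (f + Complex.I • H f))))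
    (hHq : ∀ f, Tendsto (fun t => Cq t f) (𝓝[>] 0) (𝓝 ((1 / 2 : ℂ) • (f + Complex.I • Hq f)))) :
    IsAdjoint p q Hq (-H) := by
  have hdense : Dense {f : LpC p | ∃ g, IsNice g ∧ f =ᵐ[volume] g} := by
    refine Metric.dense_iff.2 fun f r hr => ?_
    obtain ⟨g, hg, -, hfg⟩ := exists_isNice_eLpNorm_sub_le hp' (Lp.memLp f)
      (ε := ENNReal.ofReal (r / 2)) (by simpa using hr)
    refine ⟨(hg.memLp hp hp').toLp g, ?_, g, hg, MemLp.coeFn_toLp _⟩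
    rw [Metric.mem_ball, dist_comm, Lp.dist_def]
    refine lt_of_le_of_lt (ENNReal.toReal_mono ENNReal.ofReal_ne_top ?_)
      ((ENNReal.toReal_ofReal (by positivity : 0 ≤ r / 2)).trans_lt (half_lt_self hr))
    refine le_trans (le_of_eq (eLpNorm_congr_ae ?_)) hfg
    filter_upwards [MemLp.coeFn_toLp (hg.memLp hp hp')] with x hx
    rw [Pi.sub_apply, Pi.sub_apply, hx]
  have hadj : ∀ t : ℝ, 0 < t → IsAdjoint p q (Cq t) (C t) := fun t ht => by
    rw [isAdjoint_iff]
    intro g f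
    refine congrFun (Continuous.ext_on hdense (pairing p q (Cq t g)).continuous
      ((pairing p q g).continuous.comp (C t).continuous) ?_) f
    rintro f ⟨f', hf', hff'⟩
    rw [pairing_apply, Function.comp_apply, pairing_apply]
    have h1 : ∫ x, (starRingEnd ℂ) (Cq t g x) * f x =
        ∫ x, (starRingEnd ℂ) (cauchyInt g (pt t x)) * f' x := by
      refine integral_congr_ae ?_
      filter_upwards [hCq t ht g, hff'] with x h1 h2
      rw [h1, h2]
    rw [h1, hf'.integral_conj_cauchyInt_mul hq hq' (Lp.memLp g) ht]
    refine integral_congr_ae ?_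
    filter_upwards [hC t ht f] with x h1
    rw [h1, cauchyInt_congr_ae hff']
  have hlim : ∀ g f, pairing p q ((1 / 2 : ℂ) • (g + Complex.I • Hq g)) f =
      pairing p q g ((1 / 2 : ℂ) • (f + Complex.I • H f)) := fun g f => by
    have h1 := (((pairing p q).flip f).continuous.tendsto _).comp (hHq g)
    have h2 := ((pairing p q g).continuous.tendsto _).comp (hH f)
    refine tendsto_nhds_unique h1 (h2.congr' ?_)
    filter_upwards [self_mem_nhdsWithin] with t ht
    exact ((isAdjoint_iff.1 (hadj t ht)) g f).symm
  have hl : ∀ (c : ℂ) g f, pairing p q (c • g) f = (starRingEnd ℂ) c * pairing p q g f :=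
    fun c g f => by
      rw [pairing_apply, pairing_apply, ← integral_const_mul]
      refine integral_congr_ae ?_
      filter_upwards [Lp.coeFn_smul c g] with x hx
      rw [hx, Pi.smul_apply, smul_eq_mul, map_mul, mul_assoc]
  have hr : ∀ (c : ℂ) g f, pairing p q g (c • f) = c * pairing p q g f :=
    fun c g f => by
      rw [pairing_apply, pairing_apply, ← integral_const_mul]
      refine integral_congr_ae ?_
      filter_upwards [Lp.coeFn_smul c f] with x hx
      rw [hx, Pi.smul_apply, smul_eq_mul, mul_left_comm]
  rw [isAdjoint_iff]
  intro g f
  have h := hlim g f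
  rw [hl, hr, map_add, _root_.add_apply, map_add, hl, hr, Complex.conj_I] at h
  rw [_root_.neg_apply, map_neg]
  have h2 : (starRingEnd ℂ) (1 / 2 : ℂ) = 1 / 2 := by
    rw [map_div₀, map_one, map_ofNat]
  rw [h2] at h
  have h3 := mul_left_cancel₀ (by norm_num) h
  have h4 : Complex.I * pairing p q (Hq g) f = Complex.I * -pairing p q g (H f) := by
    linear_combination -h3
  exact mul_left_cancel₀ Complex.I_ne_zero h4

/-- The adjoint of `1 + k K`. -/
theorem one_add_doubleLayer [ENNReal.HolderConjugate q p] (k : ℝ) {H : LpC p →L[ℂ] LpC p}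
    {Hq : LpC q →L[ℂ] LpC q} (h : IsAdjoint p q Hq (-H)) :
    IsAdjoint p q (1 + (k : ℂ) • doubleLayer Hq)
      (1 + (k : ℂ) • (JumpBVP.evenOp p ∘L JumpBVP.sgnOp p ∘L (-H) +
        JumpBVP.oddOp p ∘L (-H) ∘L JumpBVP.sgnOp p)) :=
  one.add (((h.comp (sgnOp.comp evenOp)).add (sgnOp.comp (h.comp oddOp))).smul k)

end IsAdjoint

end Adjoint

/-! ### The Cauchy extension as a gradient, and its boundary values -/

section Solutions

variable {p : ℝ≥0∞} [Fact (1 ≤ p)]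

theorem coeFn_affineOp (c : ℂ) (f : LpC p) :
    affineOp c p f =ᵐ[volume] fun x => f x + c * (sgn x * f x) := by
  rw [affineOp_apply]
  filter_upwards [Lp.coeFn_add f (c • sgnOp p f), Lp.coeFn_smul c (sgnOp p f), coeFn_sgnOp f]
    with x h1 h2 h3
  rw [h1, Pi.add_apply, h2, Pi.smul_apply, h3, smul_eq_mul]

theorem coord_zero_extend (k : ℝ) (C : LpC p →L[ℂ] LpC p) (h : LpV p) :
    coord 0 p (extend k C h) = (1 + k ^ 2 : ℂ)⁻¹ • evenOp p (affineOp (Complex.I * k) p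
      (C (fwdZero k p h))) + oddOp p (C (fwdOne p h)) := by
  rw [extend_apply, bwdZero_apply, bwdOne_apply]
  simp only [map_add, map_sub, map_smul, coord_inc, coord_zero_inc_one, smul_zero, sub_zero]

theorem coord_one_extend (k : ℝ) (C : LpC p →L[ℂ] LpC p) (h : LpV p) :
    coord 1 p (extend k C h) = -Complex.I • ((1 + k ^ 2 : ℂ)⁻¹ •
      oddOp p (affineOp (Complex.I * k) p (C (fwdZero k p h))) + evenOp p (C (fwdOne p h))) := by
  rw [extend_apply, bwdZero_apply, bwdOne_apply]
  simp only [map_add, map_sub, map_smul, coord_inc, coord_one_inc_zero, zero_sub]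
  module

theorem coeFn_oddOp (f : LpC p) : oddOp p f =ᵐ[volume] fun x => (1 / 2 : ℂ) * (f x - f (-x)) := by
  rw [oddOp_apply]
  filter_upwards [Lp.coeFn_smul (1 / 2 : ℂ) (f - reflect p f), Lp.coeFn_sub f (reflect p f),
    coeFn_reflect f] with x h1 h2 h3
  rw [h1, Pi.smul_apply, h2, Pi.sub_apply, h3, smul_eq_mul]

section Slices

variable {k t : ℝ} {C : LpC p →L[ℂ] LpC p} {h : LpV p} {A B : ℂ → ℂ}

theorem coeFn_coord_zero_extend
    (hA : (fun x => (1 + k ^ 2 : ℂ)⁻¹ * C (fwdZero k p h) x) =ᵐ[volume] fun x => A (pt t x))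
    (hB : C (fwdOne p h) =ᵐ[volume] fun x => B (pt t x)) :
    coord 0 p (extend k C h) =ᵐ[volume] fun x => evenPart A (t, x) +
      Complex.I * k * (sgn x * oddPart A (t, x)) + oddPart B (t, x) := by
  rw [coord_zero_extend]
  set a := C (fwdZero k p h)
  set b := C (fwdOne p h)
  filter_upwards [hA, hB, ae_comp_neg hA, ae_comp_neg hB,
    Lp.coeFn_add ((1 + k ^ 2 : ℂ)⁻¹ • evenOp p (affineOp (Complex.I * k) p a)) (oddOp p b),
    Lp.coeFn_smul (1 + k ^ 2 : ℂ)⁻¹ (evenOp p (affineOp (Complex.I * k) p a)),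
    coeFn_evenOp (affineOp (Complex.I * k) p a), coeFn_oddOp b, coeFn_affineOp (Complex.I * k) a,
    ae_comp_neg (coeFn_affineOp (Complex.I * k) a)] with x a1 b1 a2 b2 h1 h2 h3 h4 h5 h6
  rw [h1, Pi.add_apply, h2, Pi.smul_apply, h3, h4, h5, h6, b1, b2, smul_eq_mul, sgn_neg, evenPart,
    oddPart, oddPart, ← a1, ← a2]
  ring

theorem coeFn_coord_one_extend
    (hA : (fun x => (1 + k ^ 2 : ℂ)⁻¹ * C (fwdZero k p h) x) =ᵐ[volume] fun x => A (pt t x))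
    (hB : C (fwdOne p h) =ᵐ[volume] fun x => B (pt t x)) :
    coord 1 p (extend k C h) =ᵐ[volume] fun x => -Complex.I * (oddPart A (t, x) +
      Complex.I * k * (sgn x * evenPart A (t, x)) + evenPart B (t, x)) := by
  rw [coord_one_extend]
  set a := C (fwdZero k p h)
  set b := C (fwdOne p h)
  filter_upwards [hA, hB, ae_comp_neg hA, ae_comp_neg hB,
    Lp.coeFn_smul (-Complex.I) ((1 + k ^ 2 : ℂ)⁻¹ • oddOp p (affineOp (Complex.I * k) p a) +
      evenOp p b),
    Lp.coeFn_add ((1 + k ^ 2 : ℂ)⁻¹ • oddOp p (affineOp (Complex.I * k) p a)) (evenOp p b),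
    Lp.coeFn_smul (1 + k ^ 2 : ℂ)⁻¹ (oddOp p (affineOp (Complex.I * k) p a)),
    coeFn_oddOp (affineOp (Complex.I * k) p a), coeFn_evenOp b, coeFn_affineOp (Complex.I * k) a,
    ae_comp_neg (coeFn_affineOp (Complex.I * k) a)] with x a1 b1 a2 b2 h0 h1 h2 h3 h4 h5 h6
  rw [h0, Pi.smul_apply, h1, Pi.add_apply, h2, Pi.smul_apply, h3, h4, h5, h6, b1, b2, smul_eq_mul,
    smul_eq_mul, sgn_neg, oddPart, evenPart, evenPart, ← a1, ← a2]
  ring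

end Slices

theorem exists_norm_extend_le (k M : ℝ) {C : ℝ → LpC p →L[ℂ] LpC p}
    (hM : ∀ t : ℝ, 0 < t → ∀ f, ‖C t f‖ ≤ M * ‖f‖) (h : LpV p) :
    ∃ M' : ℝ, ∀ t : ℝ, 0 < t → ‖extend k (C t) h‖ ≤ M' := by
  refine ⟨‖bwdZero k p‖ * (M * ‖fwdZero k p h‖) + ‖bwdOne p‖ * (M * ‖fwdOne p h‖), fun t ht => ?_⟩
  rw [extend_apply]
  refine (norm_add_le _ _).trans (add_le_add ?_ ?_)
  · exact ((bwdZero k p).le_opNorm _).trans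
      (mul_le_mul_of_nonneg_left (hM t ht _) (norm_nonneg _))
  · exact ((bwdOne p).le_opNorm _).trans
      (mul_le_mul_of_nonneg_left (hM t ht _) (norm_nonneg _))

theorem tendsto_extend (k : ℝ) {C : ℝ → LpC p →L[ℂ] LpC p} {C₀ : LpC p →L[ℂ] LpC p} {l : Filter ℝ}
    (hC : ∀ f, Tendsto (fun t => C t f) l (𝓝 (C₀ f))) (h : LpV p) :
    Tendsto (fun t => extend k (C t) h) l (𝓝 (extend k C₀ h)) := by
  simp only [extend_apply]
  exact (((bwdZero k p).continuous.tendsto _).comp (hC _)).add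
    (((bwdOne p).continuous.tendsto _).comp (hC _))

/-- The two holomorphic functions which represent the Cauchy extension of a field. -/
theorem exists_holomorphic (hp : 1 < p) (hp' : p ≠ ⊤) (k : ℝ) {C : ℝ → LpC p →L[ℂ] LpC p}
    (hC : ∀ t : ℝ, 0 < t → ∀ f, C t f =ᵐ[volume] fun x => cauchyInt f (pt t x)) (h : LpV p) :
    ∃ A B : ℂ → ℂ, DifferentiableOn ℂ A {z | 0 < z.im} ∧ DifferentiableOn ℂ B {z | 0 < z.im} ∧
      ∀ t : ℝ, 0 < t →
        coord 0 p (extend k (C t) h) =ᵐ[volume] (fun x => evenPart A (t, x) +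
          Complex.I * k * (sgn x * oddPart A (t, x)) + oddPart B (t, x)) ∧
        coord 1 p (extend k (C t) h) =ᵐ[volume] fun x => -Complex.I * (oddPart A (t, x) +
          Complex.I * k * (sgn x * evenPart A (t, x)) + evenPart B (t, x)) := by
  refine ⟨fun z => (1 + k ^ 2 : ℂ)⁻¹ * cauchyInt (fwdZero k p h) z, cauchyInt (fwdOne p h),
    (differentiableOn_cauchyInt hp hp' (Lp.memLp _)).const_mul _,
    differentiableOn_cauchyInt hp hp' (Lp.memLp _), fun t ht => ?_⟩
  have hA : (fun x => (1 + k ^ 2 : ℂ)⁻¹ * C t (fwdZero k p h) x) =ᵐ[volume]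
      fun x => (1 + k ^ 2 : ℂ)⁻¹ * cauchyInt (fwdZero k p h) (pt t x) := by
    filter_upwards [hC t ht (fwdZero k p h)] with x hx
    rw [hx]
  exact ⟨coeFn_coord_zero_extend hA (hC t ht _), coeFn_coord_one_extend hA (hC t ht _)⟩

theorem isGradientSolution_extend (hp : 1 < p) (hp' : p ≠ ⊤) (k : ℝ) {M : ℝ}
    {C : ℝ → LpC p →L[ℂ] LpC p} {C₀ : LpC p →L[ℂ] LpC p}
    (hC : ∀ t : ℝ, 0 < t → ∀ f, C t f =ᵐ[volume] fun x => cauchyInt f (pt t x))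
    (hM : ∀ t : ℝ, 0 < t → ∀ f, ‖C t f‖ ≤ M * ‖f‖)
    (hC₀ : ∀ f, Tendsto (fun t => C t f) (𝓝[>] 0) (𝓝 (C₀ f))) (h : LpV p) :
    IsGradientSolution k p (fun t => extend k (C t) h) (extend k C₀ h) := by
  refine ⟨?_, exists_norm_extend_le k M hM h, tendsto_extend k hC₀ h⟩
  obtain ⟨A, B, hA, hB, hAB⟩ := exists_holomorphic hp hp' k hC h
  obtain ⟨Φ, hΦ⟩ := exists_primitive hA
  obtain ⟨Ψ, hΨ⟩ := exists_primitive hB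
  refine ⟨_, _, isWeakSolution_of_hasDerivAt k hΦ hΨ, fun t ht => ?_⟩
  filter_upwards [(hAB t ht).1, (hAB t ht).2, coeFn_coord 0 (extend k (C t) h),
    coeFn_coord 1 (extend k (C t) h)] with x h1 h2 h3 h4
  ext i
  fin_cases i
  · exact h3.symm.trans h1
  · exact h4.symm.trans h2

/-- The first component has the form of the general potential with iA and iB in the role of the
primitives, the factor i cancelling the -i there. As A and B are holomorphic, it is itself a
solution. -/
theorem exists_isWeakSolution_coord_zero_extend (hp : 1 < p) (hp' : p ≠ ⊤) (k : ℝ)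
    {C : ℝ → LpC p →L[ℂ] LpC p}
    (hC : ∀ t : ℝ, 0 < t → ∀ f, C t f =ᵐ[volume] fun x => cauchyInt f (pt t x)) (h : LpV p) :
    ∃ (U : ℝ × ℝ → ℂ) (G : ℝ × ℝ → C2), IsWeakSolution (coeff k) U G ∧
      ∀ t : ℝ, 0 < t → coord 0 p (extend k (C t) h) =ᵐ[volume] fun x => U (t, x) := by
  obtain ⟨A, B, hA, hB, hAB⟩ := exists_holomorphic hp hp' k hC h
  have hd : ∀ {D : ℂ → ℂ}, DifferentiableOn ℂ D {z | 0 < z.im} → ∀ z : ℂ, 0 < z.im →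
      HasDerivAt (fun z => Complex.I * D z) (Complex.I * deriv D z) z := fun hD z hz =>
    (hD.differentiableAt ((isOpen_lt continuous_const Complex.continuous_im).mem_nhds
      hz)).hasDerivAt.const_mul _
  refine ⟨_, _, isWeakSolution_of_hasDerivAt k (hd hA) (hd hB), fun t ht => ?_⟩
  filter_upwards [(hAB t ht).1] with x hx
  rw [hx]
  simp only [evenPart, oddPart]
  linear_combination (((A (pt t x) + A (pt t (-x))) / 2 + Complex.I * k * (sgn x *
    ((A (pt t x) - A (pt t (-x))) / 2)) + (B (pt t x) - B (pt t (-x))) / 2)) * Complex.I_mul_I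

/-! ### The traces of the three ansatzes -/

theorem coord_toLp_pair {i : Fin 2} {F : ℝ → C2} {f : ℝ → ℂ} (hF : MemLp F p volume)
    (hf : MemLp f p volume) (h : ∀ x, F x i = f x) : coord i p (hF.toLp F) = hf.toLp f := by
  apply Lp.ext
  filter_upwards [coeFn_coord i (hF.toLp F), hF.coeFn_toLp, hf.coeFn_toLp] with x h1 h2 h3
  rw [h1, h2, h3, h]

theorem toLp_mul_sgn (c : ℂ) (ψ : LpC p) : (memLp_mul_sgn c ψ).toLp _ = c • sgnOp p ψ := by
  apply Lp.ext
  filter_upwards [(memLp_mul_sgn c ψ).coeFn_toLp, Lp.coeFn_smul c (sgnOp p ψ), coeFn_sgnOp ψ]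
    with x h1 h2 h3
  rw [h1, h2, Pi.smul_apply, h3, smul_eq_mul, mul_assoc]

theorem neumannAnsatz_eq (ψ : LpC p) : neumannAnsatz ψ = inc 0 p ψ := by
  refine ext_coord ?_ ?_
  · rw [coord_inc, neumannAnsatz, coord_toLp_pair _ (Lp.memLp ψ) fun x => rfl, Lp.toLp_coeFn]
  · rw [coord_one_inc_zero, neumannAnsatz, coord_toLp_pair _ MemLp.zero fun x => rfl]
    exact MemLp.toLp_zero _

theorem regularityAnsatz_eq (k : ℝ) (ψ : LpC p) :
    regularityAnsatz k ψ = -(k : ℂ) • inc 0 p (sgnOp p ψ) + inc 1 p ψ := by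
  refine ext_coord ?_ ?_
  · rw [regularityAnsatz, coord_toLp_pair _ (memLp_mul_sgn _ ψ) fun x => rfl, toLp_mul_sgn, map_add,
      map_smul, coord_inc, coord_zero_inc_one, add_zero]
  · rw [regularityAnsatz, coord_toLp_pair _ (Lp.memLp ψ) fun x => rfl, Lp.toLp_coeFn, map_add,
      map_smul, coord_inc, coord_one_inc_zero, smul_zero, zero_add]

theorem dirichletAnsatz_eq (k : ℝ) (ψ : LpC p) :
    dirichletAnsatz k ψ = inc 0 p ψ + (k : ℂ) • inc 1 p (sgnOp p ψ) := by
  refine ext_coord ?_ ?_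
  · rw [dirichletAnsatz, coord_toLp_pair _ (Lp.memLp ψ) fun x => rfl, Lp.toLp_coeFn, map_add,
      map_smul, coord_inc, coord_zero_inc_one, smul_zero, add_zero]
  · rw [dirichletAnsatz, coord_toLp_pair _ (memLp_mul_sgn _ ψ) fun x => rfl, toLp_mul_sgn, map_add,
      map_smul, coord_inc, coord_one_inc_zero, zero_add]

/-- The boundary values `(I + i H) / 2` of the Cauchy integral. -/
def cauchyTrace (H : LpC p →L[ℂ] LpC p) : LpC p →L[ℂ] LpC p :=
  (1 / 2 : ℂ) • (ContinuousLinearMap.id ℂ _ + Complex.I • H)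

theorem cauchyTrace_apply (H : LpC p →L[ℂ] LpC p) (f : LpC p) :
    cauchyTrace H f = (1 / 2 : ℂ) • (f + Complex.I • H f) := rfl

/-! ### Boundary operators of the three ansatzes. -/

section Trace

variable {H : LpC p →L[ℂ] LpC p}

/-- The commutation relations bring every term to a normal form in words formed from H, sgn and R
applied to ψ, and the coefficients agree. Only RH = -HR is used of H; neither H² = -I nor
boundedness properties enter. The same holds for the other two traces. -/
theorem conormal_extend_neumannAnsatz (hR : ∀ f, reflect p (H f) = -H (reflect p f))
    (k : ℝ) (ψ : LpC p) :
    coord 0 p (extend k (cauchyTrace H) (neumannAnsatz ψ)) +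
      (k : ℂ) • sgnOp p (coord 1 p (extend k (cauchyTrace H) (neumannAnsatz ψ))) =
      (1 / 2 : ℂ) • (1 + (k : ℂ) • doubleLayer H) ψ := by
  have hk := one_add_sq_ne_zero k
  have hI := Complex.I_sq
  rw [coord_zero_extend, coord_one_extend, neumannAnsatz_eq, fwdZero_apply, fwdOne_apply]
  simp only [coord_inc, coord_one_inc_zero, cauchyTrace_apply, affineOp_apply, evenOp_apply,
    oddOp_apply, map_add, map_sub, map_smul, map_neg, map_zero, reflect_reflect, sgnOp_sgnOp,
    reflect_sgnOp, hR, _root_.add_apply, _root_.smul_apply, doubleLayer_apply,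
    one_apply_eq_self]
  match_scalars <;> grobner

theorem tangential_extend_regularityAnsatz (hR : ∀ f, reflect p (H f) = -H (reflect p f))
    (k : ℝ) (ψ : LpC p) :
    sgnOp p (coord 1 p (extend k (cauchyTrace H) (regularityAnsatz k ψ))) =
      (1 / 2 : ℂ) • (1 - (k : ℂ) • doubleLayer H) (sgnOp p ψ) := by
  have hk := one_add_sq_ne_zero k
  have hI := Complex.I_sq
  rw [coord_one_extend, regularityAnsatz_eq, fwdZero_apply, fwdOne_apply]
  simp only [coord_inc, coord_one_inc_zero, coord_zero_inc_one, cauchyTrace_apply, affineOp_apply,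
    evenOp_apply, oddOp_apply, map_add, map_sub, map_smul, map_neg, map_zero, reflect_reflect,
    sgnOp_sgnOp, reflect_sgnOp, hR, _root_.sub_apply, _root_.smul_apply, doubleLayer_apply,
    one_apply_eq_self]
  match_scalars <;> grobner

theorem coord_zero_extend_dirichletAnsatz (hR : ∀ f, reflect p (H f) = -H (reflect p f))
    (k : ℝ) (ψ : LpC p) :
    coord 0 p (extend k (cauchyTrace H) (dirichletAnsatz k ψ)) =
      (1 / 2 : ℂ) • (1 + (k : ℂ) • (evenOp p ∘L sgnOp p ∘L (-H) + oddOp p ∘L (-H) ∘L sgnOp p)) ψ := by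
  have hk := one_add_sq_ne_zero k
  have hI := Complex.I_sq
  rw [coord_zero_extend, dirichletAnsatz_eq, fwdZero_apply, fwdOne_apply]
  simp only [coord_inc, coord_one_inc_zero, coord_zero_inc_one, cauchyTrace_apply, affineOp_apply,
    evenOp_apply, oddOp_apply, map_add, map_sub, map_smul, map_neg, map_zero, reflect_reflect,
    sgnOp_sgnOp, reflect_sgnOp, hR, _root_.add_apply, _root_.neg_apply, _root_.smul_apply,
    one_apply_eq_self, ContinuousLinearMap.comp_apply]
  match_scalars <;> grobner

end Trace

end Solutions

end JumpBVP

end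

/-! ### Assembly of the boundary value problems. -/

theorem proposition3p4 (k : ℝ) (p q : ℝ≥0∞) [Fact (1 ≤ p)] [Fact (1 ≤ q)]
    (hp : 1 < p) (hp' : p < ⊤) (hpq : ENNReal.HolderConjugate p q) :
    ∃ (K : Lp ℂ p (volume : Measure ℝ) →L[ℂ] Lp ℂ p (volume : Measure ℝ))
      (Kq : Lp ℂ q (volume : Measure ℝ) →L[ℂ] Lp ℂ q (volume : Measure ℝ))
      (N : Lp ℂ p (volume : Measure ℝ) →L[ℂ] Lp ℂ p (volume : Measure ℝ))
      (C : ℝ → Lp JumpBVP.C2 p (volume : Measure ℝ) →L[ℂ]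
        Lp JumpBVP.C2 p (volume : Measure ℝ)),
      -- `K` on `L_p`, `Kq` is the same operator on `L_q`, and `N = (I + k K)^*`
      JumpBVP.IsDoubleLayer p K ∧
      JumpBVP.IsDoubleLayer q Kq ∧
      JumpBVP.IsAdjoint p q (1 + (k : ℂ) • Kq) N ∧
      -- `C t h = C_k⁺ h (t, ·)` for `t > 0`
      (∀ t : ℝ, 0 < t → JumpBVP.IsCauchyExtension k p t (C t)) ∧
      -- the Neumann problem
      (∀ φ ψ : Lp ℂ p (volume : Measure ℝ),
        JumpBVP.SolvesNeumann k p φ (fun t => C t (JumpBVP.neumannAnsatz ψ)) ↔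
          φ = (1 / 2 : ℂ) • (1 + (k : ℂ) • K) ψ) ∧
      -- the regularity problem
      (∀ (u : ℝ → ℂ) (du ψ : Lp ℂ p (volume : Measure ℝ)),
        LocallyIntegrable u → JumpBVP.IsWeakDeriv u du →
        (JumpBVP.SolvesRegularity k p du (fun t => C t (JumpBVP.regularityAnsatz k ψ)) ↔
          JumpBVP.sgnMul du = (1 / 2 : ℂ) • (1 - (k : ℂ) • K) (JumpBVP.sgnMul ψ))) ∧
      -- the Dirichlet problem
      (∀ u ψ : Lp ℂ p (volume : Measure ℝ),
        JumpBVP.SolvesDirichlet k p u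
            (fun t => JumpBVP.normalPart (C t (JumpBVP.dirichletAnsatz k ψ))) ↔
          u = (1 / 2 : ℂ) • N ψ) := by
  have := hpq.symm
  have hq : 1 < q := by
    refine lt_of_le_of_ne hpq.symm.one_le fun h => ?_
    subst h
    exact hp'.ne ((ENNReal.HolderConjugate.eq_top_iff_eq_one p 1).2 rfl)
  have hq' : q ≠ ⊤ := fun h => hp.ne' ((ENNReal.HolderConjugate.eq_top_iff_eq_one q p).1 h)
  obtain ⟨C, H, M, hC, hM, hlim, hH⟩ := JumpBVP.exists_hilbertTransform hp hp'.ne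
  obtain ⟨Cq, Hq, -, hCq, -, hlimq, hHq⟩ := JumpBVP.exists_hilbertTransform hq hq'
  -- The L₂ operators realize the functional calculus; those on L_p agree with them on the
  -- intersection because both are given by the same Cauchy integral.
  obtain ⟨C₂, -, -, hC₂, -⟩ := JumpBVP.exists_hilbertTransform (p := 2) (by norm_num) (by norm_num)
  have hR := JumpBVP.reflect_hilbert hH
  have hgrad := JumpBVP.isGradientSolution_extend hp hp'.ne k hC hM
    (C₀ := JumpBVP.cauchyTrace H) hlim
  refine ⟨JumpBVP.doubleLayer H, JumpBVP.doubleLayer Hq, _, fun t => JumpBVP.extend k (C t),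
    JumpBVP.isDoubleLayer_doubleLayer hp hp'.ne hH, JumpBVP.isDoubleLayer_doubleLayer hq hq' hHq,
    (JumpBVP.IsAdjoint.hilbert hp hp'.ne hq hq' hC hCq hlim hlimq).one_add_doubleLayer k,
    fun t ht => ⟨JumpBVP.extend k (C₂ t), JumpBVP.isFunctionOf_extend k ht (hC₂ t ht),
      JumpBVP.Compatible.extend k fun f g hfg => ?_⟩, fun φ ψ => ?_, fun u du ψ _ _ => ?_,
    fun u ψ => ?_⟩
  · filter_upwards [hC t ht f, hC₂ t ht g] with x h1 h2
    rw [h1, h2, JumpBVP.cauchyInt_congr_ae hfg]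
  · rw [← JumpBVP.conormal_extend_neumannAnsatz hR]
    set f := JumpBVP.extend k (JumpBVP.cauchyTrace H) (JumpBVP.neumannAnsatz ψ)
    have h0 : ∀ᵐ x : ℝ, (JumpBVP.coeff k x *ᵥ (f x).ofLp) 0 =
        (JumpBVP.coord 0 p f + (k : ℂ) • JumpBVP.sgnOp p (JumpBVP.coord 1 p f) : JumpBVP.LpC p) x := by
      filter_upwards [Lp.coeFn_add (JumpBVP.coord 0 p f)
        ((k : ℂ) • JumpBVP.sgnOp p (JumpBVP.coord 1 p f)),
        Lp.coeFn_smul (k : ℂ) (JumpBVP.sgnOp p (JumpBVP.coord 1 p f)),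
        JumpBVP.coeFn_sgnOp (JumpBVP.coord 1 p f), JumpBVP.coeFn_coord 0 f,
        JumpBVP.coeFn_coord 1 f] with x h1 h2 h3 h4 h5
      rw [h1, Pi.add_apply, h2, Pi.smul_apply, h3, h4, h5]
      simp [JumpBVP.coeff, Matrix.mulVec, dotProduct, Fin.sum_univ_two, mul_assoc]
    constructor
    · rintro ⟨f', hf', hφ⟩
      -- Uniqueness of the L_p limit: any trace admitted by the problem is the explicit one.
      obtain rfl := tendsto_nhds_unique hf'.2.2 (hgrad _).2.2
      apply Lp.ext
      filter_upwards [h0, hφ] with x h1 h2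
      rw [← h1, h2]
    · rintro rfl
      exact ⟨f, hgrad _, h0⟩
  · rw [← JumpBVP.sgnOp_apply, ← JumpBVP.sgnOp_apply,
      ← JumpBVP.tangential_extend_regularityAnsatz hR]
    set f := JumpBVP.extend k (JumpBVP.cauchyTrace H) (JumpBVP.regularityAnsatz k ψ)
    constructor
    · rintro ⟨f', hf', hdu⟩
      obtain rfl := tendsto_nhds_unique hf'.2.2 (hgrad _).2.2
      congr 1
      apply Lp.ext
      filter_upwards [JumpBVP.coeFn_coord 1 f, hdu] with x h1 h2
      rw [h1, ← h2]
    · intro h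
      refine ⟨f, hgrad _, ?_⟩
      -- Multiplication by sgn is an involution almost everywhere, so it can be cancelled from both
      -- sides.
      have h' := congrArg (JumpBVP.sgnOp p) h
      rw [JumpBVP.sgnOp_sgnOp, JumpBVP.sgnOp_sgnOp] at h'
      rw [h']
      filter_upwards [JumpBVP.coeFn_coord 1 f] with x hx
      exact hx.symm
  · rw [← JumpBVP.coord_zero_extend_dirichletAnsatz hR]
    have hlim' := ((JumpBVP.coord 0 p).continuous.tendsto _).comp
      (hgrad (JumpBVP.dirichletAnsatz k ψ)).2.2
    constructor
    · rintro ⟨-, -, h⟩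
      exact tendsto_nhds_unique h hlim'
    · rintro rfl
      obtain ⟨M', hM'⟩ := (hgrad (JumpBVP.dirichletAnsatz k ψ)).2.1
      refine ⟨JumpBVP.exists_isWeakSolution_coord_zero_extend hp hp'.ne k hC _,
        ⟨‖JumpBVP.coord 0 p‖ * M', fun t ht => ?_⟩, hlim'⟩
      exact ((JumpBVP.coord 0 p).le_opNorm _).trans
        (mul_le_mul_of_nonneg_left (hM' t ht) (norm_nonneg _))
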